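/- Consider the state-feedback LQR (SLQR) problem: the system $\dot x=Ax+Bu$ with $x\in\mathbb R^n$, $u=-Kx\in\mathbb R^m$, $n,m\ge 1$, random $x(0)$ with zero mean and covariance $\Sigma\succ0$, weights $Q,R\succ0$, the set $\mathcal S=\{K\in\mathbb R^{m\times n}: A-BK \text{ is Hurwitz}\}$ and, for $K\in\mathcal S$, the cost $f(K)=\mathbb E\int_0^\infty (x^{\rm T}Qx+u^{\rm T}Ru)\,dt$. Let $K_0\in\mathcal S$, let $K^*$ be a minimizer of $f$ over $\mathcal S$, and put $z^*=(K^*,0)$, $\mathcal S_1=\{K\in\mathcal S: f(K)\le f(K_0)\}$ and $\mathcal A_f=\mathcal S_1\times\mathbb R^{m\times n}$. With $\lambda_1,\lambda_n$ denoting the smallest and the largest eigenvalue of a symmetric matrix and $\|\cdot\|$ the spectral norm of a matrix, let $$\xi(\alpha)=\frac{\sqrt n\,\alpha}{\lambda_1(\Sigma)}\left(\frac{\alpha\|B\|}{\lambda_1(Q)\lambda_1(\Sigma)}+\sqrt{\Big(\frac{\alpha\|B\|}{\lambda_1(Q)\lambda_1(\Sigma)}\Big)^2+\lambda_n(R)}\right),\qquad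 L=\frac{2f(K^*)}{\lambda_1(Q)}\big(\lambda_n(R)+\sqrt n\,\|B\|\,\xi(f(K^*))\big),$$ $$\mu=\frac{\lambda_1(R)\lambda_1(\Sigma)^2\lambda_1(Q)}{8f(K^*)\Big(\|A\|+\frac{\|B\|^2f(K^*)}{\lambda_1(\Sigma)\lambda_1(R)}\Big)^2},\qquad \kappa=\frac L\mu .$$ For $d>0$ and $\eta>0$ consider the hybrid heavy-ball system (the case $\beta=0$) with state $z=(K,p)$: it flows by $\dot K=p$, $\dot p=-2dp-\nabla f(K)$ as long as $K\in\mathcal S$ and either $f(K)<f(K_0)$ or $\frac{d}{dt}f(K)=\langle\nabla f(K),p\rangle<0$, and otherwise it jumps by $G(K,p)=(K,-\eta\nabla f(K))$. Let $0<a\le b$ and $\ell>0$. There is a constant $c_a>0$, depending only on $a,b,\ell$, such that for every SLQR problem with $L\ge \ell$, all $K_0,K^*$ as above, every $d$ with $a/\sqrt\kappa\le d\le b/\sqrt\kappa$ (that is, $d\sim1/\sqrt\kappa$) and every $S\in\mathbb N$ the following holds for all sufficiently small $\eta>0$. There is a constant $C_a>0$ such that, for every $z_0\in\mathcal A_f$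 from which the hybrid system executes at most $S$ jumps, the solution $\varphi_t(z_0)$ of the hybrid system exists for all $t\ge0$ and $$\|\varphi_t(z_0)-z^*\|_F\le C_a\|z_0-z^*\|_F\exp(-c_a t/\sqrt\kappa)\qquad\text{for all } t\ge0$$ (at a jump time, for the state before and the state after the jump). -/

import Mathlib

open scoped Matrix
open Set MeasureTheory

attribute [local instance] Matrix.frobeniusNormedAddCommGroup
attribute [local instance] Matrix.frobeniusNormedSpace

noncomputable section

/-- Data of a state-feedback linear-quadratic regulator problem: the system `x' = A x + B u` with
`x ∈ ℝⁿ`, `u ∈ ℝᵐ`, positive definite weights `Q`, `R`, and a random initial state with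
distribution `law`, zero mean and positive definite covariance matrix `Sig`. -/
structure SLQR (m n : ℕ) where
  A : Matrix (Fin n) (Fin n) ℝ
  B : Matrix (Fin n) (Fin m) ℝ
  Q : Matrix (Fin n) (Fin n) ℝ
  R : Matrix (Fin m) (Fin m) ℝ
  Sig : Matrix (Fin n) (Fin n) ℝ
  law : Measure (Fin n → ℝ)
  posDef_Q : Q.PosDef
  posDef_R : R.PosDef
  posDef_Sig : Sig.PosDef
  isProb : IsProbabilityMeasure law
  memLp : ∀ i, MemLp (fun x : Fin n → ℝ => x i) 2 law
  mean : ∀ i, ∫ x, x i ∂law = 0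
  cov : ∀ i j, ∫ x, x i * x j ∂law = Sig i j

/-- Smallest eigenvalue (used for real symmetric matrices of positive size). -/
def lamMin {k : ℕ} (M : Matrix (Fin k) (Fin k) ℝ) : ℝ := sInf (spectrum ℝ M)

/-- Largest eigenvalue (used for real symmetric matrices of positive size). -/
def lamMax {k : ℕ} (M : Matrix (Fin k) (Fin k) ℝ) : ℝ := sSup (spectrum ℝ M)

/-- Spectral norm: the operator norm with respect to the Euclidean norms. -/
def specNorm {k l : ℕ} (M : Matrix (Fin k) (Fin l) ℝ) : ℝ :=
  ‖LinearMap.toContinuousLinearMap (Matrix.toEuclideanLin M)‖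

/-- The gradient of `g` for the Frobenius inner product: the matrix of partial derivatives. -/
def matGrad {m n : ℕ} (g : Matrix (Fin m) (Fin n) ℝ → ℝ) (K : Matrix (Fin m) (Fin n) ℝ) :
    Matrix (Fin m) (Fin n) ℝ :=
  Matrix.of fun i j => fderiv ℝ g K (Matrix.single i j 1)

/-- The Frobenius norm of the stacked matrix with blocks `z.1` (position) and `z.2` (velocity). -/
def stackNorm {m n : ℕ} (z : Matrix (Fin m) (Fin n) ℝ × Matrix (Fin m) (Fin n) ℝ) : ℝ :=
  Real.sqrt (‖z.1‖ ^ 2 + ‖z.2‖ ^ 2)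

namespace SLQR

variable {m n : ℕ} (P : SLQR m n)

/-- The closed-loop matrix `A - B K`. -/
def closedLoop (K : Matrix (Fin m) (Fin n) ℝ) : Matrix (Fin n) (Fin n) ℝ := P.A - P.B * K

/-- The set of stabilizing feedback gains. -/
def stab : Set (Matrix (Fin m) (Fin n) ℝ) :=
  {K | ∀ z ∈ spectrum ℂ ((P.closedLoop K).map (fun r : ℝ => (r : ℂ))), z.re < 0}

/-- The closed-loop state at time `t` for the input `u = -K x` and the initial state `x₀`. -/
def state (K : Matrix (Fin m) (Fin n) ℝ) (x₀ : Fin n → ℝ) (t : ℝ) : Fin n → ℝ :=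
  NormedSpace.exp (t • P.closedLoop K) *ᵥ x₀

/-- The running cost `xᵀ Q x + uᵀ R u`. -/
def stageCost (x : Fin n → ℝ) (u : Fin m → ℝ) : ℝ :=
  x ⬝ᵥ (P.Q *ᵥ x) + u ⬝ᵥ (P.R *ᵥ u)

/-- The LQR cost of the gain `K` (meaningful for `K ∈ P.stab`). -/
def cost (K : Matrix (Fin m) (Fin n) ℝ) : ℝ :=
  ∫ x₀, (∫ t in Ioi (0 : ℝ), P.stageCost (P.state K x₀ t) (-(K *ᵥ P.state K x₀ t))) ∂P.law

/-- `K` is an optimal gain. -/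
def IsOptimal (K : Matrix (Fin m) (Fin n) ℝ) : Prop :=
  K ∈ P.stab ∧ ∀ K' ∈ P.stab, P.cost K ≤ P.cost K'

/-- The sublevel set of the cost determined by the gain `K₀`. -/
def sublevel (K₀ : Matrix (Fin m) (Fin n) ℝ) : Set (Matrix (Fin m) (Fin n) ℝ) :=
  {K | K ∈ P.stab ∧ P.cost K ≤ P.cost K₀}

/-- The auxiliary constant `ξ(α)` in the smoothness constant. -/
def xi (α : ℝ) : ℝ :=
  Real.sqrt n * α / lamMin P.Sig *
    (α * specNorm P.B / (lamMin P.Q * lamMin P.Sig) +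
      Real.sqrt ((α * specNorm P.B / (lamMin P.Q * lamMin P.Sig)) ^ 2 + lamMax P.R))

/-- The smoothness constant `C(α)` of the cost at the level `α`. -/
def smoothConst (α : ℝ) : ℝ :=
  2 * α / lamMin P.Q * (lamMax P.R + Real.sqrt n * specNorm P.B * P.xi α)

/-- The Polyak-Łojasiewicz constant `μ(α)` of the cost at the level `α`, where `fopt` is the
optimal value of the cost. -/
def plConst (fopt α : ℝ) : ℝ :=
  lamMin P.R * lamMin P.Sig ^ 2 * lamMin P.Q /
    (8 * fopt * (specNorm P.A + specNorm P.B ^ 2 * α / (lamMin P.Sig * lamMin P.R)) ^ 2)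

/-- `L = C(f(K*))`, for an optimal gain `Kopt`. -/
def bigL (Kopt : Matrix (Fin m) (Fin n) ℝ) : ℝ := P.smoothConst (P.cost Kopt)

/-- `μ = μ(f(K*))`, for an optimal gain `Kopt`. -/
def mu (Kopt : Matrix (Fin m) (Fin n) ℝ) : ℝ := P.plConst (P.cost Kopt) (P.cost Kopt)

/-- `κ = L / μ`, for an optimal gain `Kopt`. -/
def kappa (Kopt : Matrix (Fin m) (Fin n) ℝ) : ℝ := P.bigL Kopt / P.mu Kopt

/-- The damping force `f_d(q, p) = -2 d p - (∇f(q + β p) - ∇f(q))`. -/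
def damping (d β : ℝ) (q p : Matrix (Fin m) (Fin n) ℝ) : Matrix (Fin m) (Fin n) ℝ :=
  -((2 * d) • p) - (matGrad P.cost (q + β • p) - matGrad P.cost q)

/-- The flow map of the (modified) heavy-ball system. -/
def flowMap (d β : ℝ) (z : Matrix (Fin m) (Fin n) ℝ × Matrix (Fin m) (Fin n) ℝ) :
    Matrix (Fin m) (Fin n) ℝ × Matrix (Fin m) (Fin n) ℝ :=
  (z.2, -matGrad P.cost z.1 + P.damping d β z.1 z.2)

/-- The flow set: the cost is below the level of `K₀`, or its derivative along the flow, that is,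
in the direction of the velocity, is negative. -/
def flowSet (K₀ : Matrix (Fin m) (Fin n) ℝ) :
    Set (Matrix (Fin m) (Fin n) ℝ × Matrix (Fin m) (Fin n) ℝ) :=
  {z | z.1 ∈ P.stab ∧ (P.cost z.1 < P.cost K₀ ∨ fderiv ℝ P.cost z.1 z.2 < 0)}

/-- The jump (restart) map. -/
def jumpMap (η : ℝ) (z : Matrix (Fin m) (Fin n) ℝ × Matrix (Fin m) (Fin n) ℝ) :
    Matrix (Fin m) (Fin n) ℝ × Matrix (Fin m) (Fin n) ℝ :=
  (z.1, -(η • matGrad P.cost z.1))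

/-- The set `A_f` of initial points. -/
def initSet (K₀ : Matrix (Fin m) (Fin n) ℝ) :
    Set (Matrix (Fin m) (Fin n) ℝ × Matrix (Fin m) (Fin n) ℝ) :=
  P.sublevel K₀ ×ˢ univ

end SLQR

/-- `t` is an instant of the `k`-th phase, when the time axis is the interval `J`, there are `N`
jumps, and the phases `0, …, N` begin at the times `τ 0, …, τ N`. Phases `k < N` are the closed
intervals `[τ k, τ (k+1)]`, so that a jump time belongs to the phase before the jump and to the
phase after it. -/
def phase (J : Set ℝ) (N : ℕ) (τ : ℕ → ℝ) (k : ℕ) : Set ℝ :=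
  {t | t ∈ J ∧ τ k ≤ t ∧ (k < N → t ≤ τ (k + 1))}

/-- A solution with exactly `N` jumps, on the time interval `J` with left end point `0` (for
instance `[0, ∞)` or `[0, T]`), of the hybrid system with flow map `F`, flow set `C` and jump map
`G` (`z' = F z` as long as `z ∈ C`, and `z⁺ = G z` otherwise), from the initial point `z₀`. The
trajectory in the `k`-th phase is `x k`, and `x k t`, for `k ≤ N`, matters only for `t` in that
phase. -/
structure IsHybridSolution {E : Type*} [NormedAddCommGroup E] [NormedSpace ℝ E]
    (F : E → E) (C : Set E) (G : E → E) (z₀ : E)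
    (J : Set ℝ) (N : ℕ) (τ : ℕ → ℝ) (x : ℕ → ℝ → E) : Prop where
  ordConnected : J.OrdConnected
  isLeast : IsLeast J 0
  start_time : τ 0 = 0
  mono : ∀ k < N, τ k ≤ τ (k + 1)
  mem : τ N ∈ J
  start : x 0 0 = z₀
  flow : ∀ k ≤ N, ∀ t ∈ phase J N τ k, HasDerivWithinAt (x k) (F (x k t)) (phase J N τ k) t
  /-- The state is in the flow set at every instant of a phase but its last one. -/
  mem_flowSet : ∀ k ≤ N, ∀ t ∈ phase J N τ k, ∀ s ∈ phase J N τ k, t < s → x k t ∈ C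
  /-- A jump takes place at the first instant at which the state is not in the flow set. -/
  exit : ∀ k < N, x k (τ (k + 1)) ∉ C
  jump : ∀ k < N, x (k + 1) (τ (k + 1)) = G (x k (τ (k + 1)))

namespace SLQR

variable {m n : ℕ} (P : SLQR m n)

/-- Solutions of the heavy-ball hybrid system with damping parameters `d`, `β`, level gain `K₀` and
restart parameter `η`. -/
def IsSolution (d β η : ℝ) (K₀ : Matrix (Fin m) (Fin n) ℝ)
    (z₀ : Matrix (Fin m) (Fin n) ℝ × Matrix (Fin m) (Fin n) ℝ) (J : Set ℝ) (N : ℕ) (τ : ℕ → ℝ)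
    (x : ℕ → ℝ → Matrix (Fin m) (Fin n) ℝ × Matrix (Fin m) (Fin n) ℝ) : Prop :=
  IsHybridSolution (P.flowMap d β) (P.flowSet K₀) (P.jumpMap η) z₀ J N τ x

/-- The jump map is executed at most `S` times along the trajectory that starts at `z₀`. -/
def JumpsAtMost (d β η : ℝ) (K₀ : Matrix (Fin m) (Fin n) ℝ)
    (z₀ : Matrix (Fin m) (Fin n) ℝ × Matrix (Fin m) (Fin n) ℝ) (S : ℕ) : Prop :=
  ∀ (J : Set ℝ) (N : ℕ) (τ : ℕ → ℝ)
    (x : ℕ → ℝ → Matrix (Fin m) (Fin n) ℝ × Matrix (Fin m) (Fin n) ℝ),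
    P.IsSolution d β η K₀ z₀ J N τ x → N ≤ S

end SLQR

end

/-! The argument has an abstract half, about a function with compact sublevel sets and a single
critical point (`Landscape`), and a half that verifies these properties for the LQR cost
(`SLQR.landscape`). Write q = K - K*.

Near the minimizer, V = f - f(K*) + ½‖p + dq‖² + ½d²‖q‖² satisfies V' = -d‖p‖² - d⟨q, ∇f⟩ along the
flow. The local inequality ⟨q, ∇f⟩ ≥ f - f(K*) + μ‖q‖² turns this into V' ≤ -ρV with ρ = min(d,
2μ/(3d)). For d between a/√κ and b/√κ both entries are at least a multiple of 1/√κ, the second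
because μ/d ≥ μ√κ/b = L/(b√κ) ≥ ℓ/(b√κ). Thus L enters only through κ and the bound L ≥ ℓ, never as
a Lipschitz constant.

Far from the minimizer, W = f + ½‖p‖² + ε⟨p, ∇f⟩ decreases at a definite speed, so a flow with
bounded momentum reaches the region of local decay within a uniform time. A large momentum is first
damped during a time log‖p‖/(2d); the exponential factor lost meanwhile is at most ‖p‖, hence linear
in the distance to z*, and the constant stays independent of z₀ (`Landscape.exists_decay`). A jump
keeps K and creates a momentum of size η‖∇f(K)‖ = O(‖q‖), so at most S jumps cost a bounded factor
(`Landscape.exists_hybrid_decay`). A bound on the number of jumps also forces some phase to last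
forever (`Landscape.exists_isHybridSolution`). If f(K₀) = f(K*), every initial point jumps without
end, and the bound on the jumps fails.

For the LQR cost everything rests on the exact difference formula `SLQR.cost_sub_cost` with the
Gramian of the new gain. It yields the gradient, the uniqueness of the critical point and, with the
optimal gain as the new one, the local inequality. Its constant comes from 2μ ≤ λ₁(R)λ₁(X*), where
X* is the Gramian of K* (`SLQR.mu_pos_and_le`). Compactness of the sublevel sets holds because a
Lyapunov certificate survives passage to the limit (`SLQR.isCompact_sublevel`). -/

noncomputable section

open Filter Topology InnerProductSpace

/-! ### Comparison principle, landscapes and the two Lyapunov functions -/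

/-- A comparison principle: a nonnegative function that starts below `v₀` and satisfies
`V' ≤ -ρ V` as long as it stays below `v₀` decays exponentially, at every rate below `ρ`. -/
theorem le_mul_exp_of_deriv_le_below {V V' : ℝ → ℝ} {s T ρ ρ' v₀ : ℝ}
    (hV : ContinuousOn V (Icc s T))
    (hd : ∀ t ∈ Ico s T, HasDerivWithinAt V (V' t) (Ici t) t)
    (hle : ∀ t ∈ Ico s T, V t < v₀ → V' t ≤ -ρ * V t)
    (hρ' : 0 ≤ ρ') (hρ : ρ' < ρ) (hs : V s < v₀) (h0 : 0 ≤ V s) :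
    ∀ t ∈ Icc s T, V t ≤ V s * Real.exp (-ρ' * (t - s)) := by
  intro t ht
  refine le_of_forall_pos_le_add fun ε hε => ?_
  -- The slack `e` makes the barrier positive, which gives strict inequality of derivatives at a
  -- contact point, and keeps it below `v₀`, where `hle` is available.
  obtain ⟨e, he, hev, heε⟩ : ∃ e : ℝ, 0 < e ∧ V s + e < v₀ ∧ e ≤ ε :=
    ⟨min ε ((v₀ - V s) / 2), lt_min hε (by linarith),
      by linarith [min_le_right ε ((v₀ - V s) / 2)], min_le_left _ _⟩
  have key := image_le_of_deriv_right_lt_deriv_boundary (f := V) (f' := V') (a := s) (b := T)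
    (B := fun t => (V s + e) * Real.exp (-ρ' * (t - s)))
    (B' := fun t => (V s + e) * (Real.exp (-ρ' * (t - s)) * (-ρ'))) hV hd (by simp [he.le])
    (fun x => by
      have h1 : HasDerivAt (fun t => -ρ' * (t - s)) (-ρ') x := by
        simpa using ((hasDerivAt_id x).sub_const s).const_mul (-ρ')
      exact (h1.exp).const_mul _)
    (fun x hx hVx => by
      have hexp : Real.exp (-ρ' * (x - s)) ≤ 1 := Real.exp_le_one_iff.2 (by nlinarith [hx.1])
      have hpos := Real.exp_pos (-ρ' * (x - s))
      have hB : V x < v₀ := by rw [hVx]; nlinarith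
      have h1 := hle x hx hB
      have h2 : 0 < V x := by rw [hVx]; positivity
      have h3 : (V s + e) * (Real.exp (-ρ' * (x - s)) * (-ρ')) = -ρ' * V x := by rw [hVx]; ring
      show V' x < (V s + e) * (Real.exp (-ρ' * (x - s)) * (-ρ'))
      rw [h3]; nlinarith) ht
  have hexp : Real.exp (-ρ' * (t - s)) ≤ 1 := Real.exp_le_one_iff.2 (by nlinarith [ht.1])
  have hpos := Real.exp_pos (-ρ' * (t - s))
  have : V t ≤ (V s + e) * Real.exp (-ρ' * (t - s)) := key
  nlinarith

variable {E : Type*} [NormedAddCommGroup E]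

/-- The Euclidean norm of a pair. -/
def pairNorm (z : E × E) : ℝ := Real.sqrt (‖z.1‖ ^ 2 + ‖z.2‖ ^ 2)

theorem pairNorm_nonneg (z : E × E) : 0 ≤ pairNorm z := Real.sqrt_nonneg _

theorem pairNorm_sq (z : E × E) : pairNorm z ^ 2 = ‖z.1‖ ^ 2 + ‖z.2‖ ^ 2 :=
  Real.sq_sqrt (by positivity)

theorem pairNorm_sub_sq (z : E × E) (x : E) :
    pairNorm (z - (x, 0)) ^ 2 = ‖z.1 - x‖ ^ 2 + ‖z.2‖ ^ 2 := by
  rw [pairNorm_sq, Prod.fst_sub, Prod.snd_sub, sub_zero]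

theorem norm_fst_sub_le_pairNorm (z : E × E) (x : E) : ‖z.1 - x‖ ≤ pairNorm (z - (x, 0)) :=
  le_of_sq_le_sq (by rw [pairNorm_sub_sq]; nlinarith [sq_nonneg ‖z.2‖]) (pairNorm_nonneg _)

theorem norm_snd_le_pairNorm (z : E × E) (x : E) : ‖z.2‖ ≤ pairNorm (z - (x, 0)) :=
  le_of_sq_le_sq (by rw [pairNorm_sub_sq]; nlinarith [sq_nonneg ‖z.1 - x‖]) (pairNorm_nonneg _)

theorem pairNorm_sub_le_add (z : E × E) (x : E) : pairNorm (z - (x, 0)) ≤ ‖z.1 - x‖ + ‖z.2‖ :=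
  le_of_sq_le_sq (by rw [pairNorm_sub_sq]; nlinarith [norm_nonneg z.2, norm_nonneg (z.1 - x)])
    (by positivity)

variable [InnerProductSpace ℝ E]

/-- The vector field of the heavy-ball system with gradient `g` and damping `d`. -/
def heavyBall (g : E → E) (d : ℝ) (z : E × E) : E × E := (z.2, -g z.1 - (2 * d) • z.2)

/-- A function `f` on an open set `U` with gradient `g`, whose sublevel set at level `f₀` is
compact, whose only critical point is the minimizer `xs`, and whose growth at `xs` is at least
quadratic with constant `h`. -/
structure Landscape (f : E → ℝ) (g : E → E) (U : Set E) (f₀ : ℝ) (xs : E) (h : ℝ) : Prop where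
  isOpen : IsOpen U
  hasFDerivAt : ∀ x ∈ U, HasFDerivAt f (innerSL ℝ (g x)) x
  contDiffOn : ContDiffOn ℝ 1 g U
  isCompact : IsCompact {x | x ∈ U ∧ f x ≤ f₀}
  mem : xs ∈ U
  lt : f xs < f₀
  le_of_mem : ∀ x ∈ U, f xs ≤ f x
  crit : ∀ x ∈ U, g x = 0 → x = xs
  growth : ∀ᶠ x in 𝓝 xs, f x - f xs + h * ‖x - xs‖ ^ 2 ≤ inner ℝ (x - xs) (g x)

/-- A solution of the heavy-ball system on `[s, T]` that stays in a sublevel set. -/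
structure IsHBFlow (f : E → ℝ) (g : E → E) (U : Set E) (f₀ d s T : ℝ) (z : ℝ → E × E) : Prop where
  deriv : ∀ t ∈ Icc s T, HasDerivWithinAt z (heavyBall g d (z t)) (Icc s T) t
  mem : ∀ t ∈ Icc s T, (z t).1 ∈ U ∧ f (z t).1 ≤ f₀

theorem HasDerivWithinAt.pair_fst {z : ℝ → E × E} {z' : E × E} {I : Set ℝ} {t : ℝ}
    (h : HasDerivWithinAt z z' I t) : HasDerivWithinAt (fun t => (z t).1) z'.1 I t :=
  (hasFDerivAt_fst (𝕜 := ℝ) (p := z t)).comp_hasDerivWithinAt t h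

theorem HasDerivWithinAt.pair_snd {z : ℝ → E × E} {z' : E × E} {I : Set ℝ} {t : ℝ}
    (h : HasDerivWithinAt z z' I t) : HasDerivWithinAt (fun t => (z t).2) z'.2 I t :=
  (hasFDerivAt_snd (𝕜 := ℝ) (p := z t)).comp_hasDerivWithinAt t h

/-- Local Lyapunov function. -/
def lyapV (f : E → ℝ) (xs : E) (d : ℝ) (z : E × E) : ℝ :=
  f z.1 - f xs + 1 / 2 * ‖z.2 + d • (z.1 - xs)‖ ^ 2 + d ^ 2 / 2 * ‖z.1 - xs‖ ^ 2

/-- Global Lyapunov function. -/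
def lyapW (f : E → ℝ) (g : E → E) (ε : ℝ) (z : E × E) : ℝ :=
  f z.1 + 1 / 2 * ‖z.2‖ ^ 2 + ε * inner ℝ z.2 (g z.1)

namespace Landscape

variable {f : E → ℝ} {g : E → E} {U : Set E} {f₀ : ℝ} {xs : E} {h d : ℝ}

theorem grad_min (H : Landscape f g U f₀ xs h) : g xs = 0 := by
  have hmin : IsLocalMin f xs := by
    filter_upwards [H.isOpen.mem_nhds H.mem] with x hx using H.le_of_mem x hx
  have h0 := hmin.hasFDerivAt_eq_zero (H.hasFDerivAt xs H.mem)
  have h1 : inner ℝ (g xs) (g xs) = 0 := by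
    simpa using congrArg (fun φ : E →L[ℝ] ℝ => φ (g xs)) h0
  exact inner_self_eq_zero.1 h1

theorem continuousOn_grad (H : Landscape f g U f₀ xs h) : ContinuousOn g U :=
  H.contDiffOn.continuousOn

theorem continuousOn (H : Landscape f g U f₀ xs h) : ContinuousOn f U := fun x hx =>
  (H.hasFDerivAt x hx).continuousAt.continuousWithinAt

theorem exists_norm_grad_le (H : Landscape f g U f₀ xs h) :
    ∃ G, 0 ≤ G ∧ ∀ x ∈ U, f x ≤ f₀ → ‖g x‖ ≤ G := by
  obtain ⟨G, hG⟩ := H.isCompact.exists_bound_of_continuousOn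
    (H.continuousOn_grad.mono fun x hx => hx.1)
  exact ⟨max G 0, le_max_right _ _, fun x hx hf => (hG x ⟨hx, hf⟩).trans (le_max_left _ _)⟩

theorem exists_dist_le (H : Landscape f g U f₀ xs h) :
    ∃ D, 0 ≤ D ∧ ∀ x ∈ U, f x ≤ f₀ → ‖x - xs‖ ≤ D := by
  obtain ⟨G, hG⟩ := H.isCompact.exists_bound_of_continuousOn (f := fun x => x - xs)
    (by fun_prop)
  exact ⟨max G 0, le_max_right _ _, fun x hx hf => (hG x ⟨hx, hf⟩).trans (le_max_left _ _)⟩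

theorem exists_norm_fderiv_grad_le (H : Landscape f g U f₀ xs h) :
    ∃ M, 0 ≤ M ∧ ∀ x ∈ U, f x ≤ f₀ → ‖fderiv ℝ g x‖ ≤ M := by
  obtain ⟨G, hG⟩ := H.isCompact.exists_bound_of_continuousOn
    ((H.contDiffOn.continuousOn_fderiv_of_isOpen H.isOpen le_rfl).mono fun x hx => hx.1)
  exact ⟨max G 0, le_max_right _ _, fun x hx hf => (hG x ⟨hx, hf⟩).trans (le_max_left _ _)⟩

theorem hasFDerivAt_grad (H : Landscape f g U f₀ xs h) {x : E} (hx : x ∈ U) :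
    HasFDerivAt g (fderiv ℝ g x) x :=
  ((H.contDiffOn.contDiffAt (H.isOpen.mem_nhds hx)).differentiableAt one_ne_zero).hasFDerivAt

/-- The gradient is bounded by a multiple of the distance to the minimizer, and so is the excess
cost by a multiple of its square. -/
theorem exists_upper_bounds (H : Landscape f g U f₀ xs h) (hh : 0 ≤ h) :
    ∃ C, 0 < C ∧ ∀ x ∈ U, f x ≤ f₀ →
      ‖g x‖ ≤ C * ‖x - xs‖ ∧ f x - f xs ≤ C * ‖x - xs‖ ^ 2 := by
  obtain ⟨G, hG0, hG⟩ := H.exists_norm_grad_le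
  obtain ⟨c, hc⟩ := ((H.hasFDerivAt_grad H.mem).isBigO_sub).bound
  obtain ⟨r, hr, hball⟩ := Metric.eventually_nhds_iff.1 (hc.and H.growth)
  have hlt := H.lt
  refine ⟨|c| + G / r + (f₀ - f xs) / r ^ 2 + 1, ?_, fun x hx hf => ?_⟩
  · have : 0 ≤ (f₀ - f xs) / r ^ 2 := div_nonneg (by linarith) (by positivity)
    positivity
  have hA : 0 ≤ (f₀ - f xs) / r ^ 2 := div_nonneg (by linarith) (by positivity)
  have hB : 0 ≤ G / r := by positivity
  have hq := norm_nonneg (x - xs)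
  -- Near `xs`, differentiability of `g` bounds the gradient and the growth inequality with
  -- Cauchy–Schwarz bounds the excess. Elsewhere ‖x - xs‖ ≥ r and the global bounds on the sublevel
  -- set suffice.
  by_cases hxr : dist x xs < r
  · obtain ⟨h1, h2⟩ := hball hxr
    rw [H.grad_min, sub_zero] at h1
    have h3 : ‖g x‖ ≤ |c| * ‖x - xs‖ :=
      h1.trans (mul_le_mul_of_nonneg_right (le_abs_self c) hq)
    have h4 : inner ℝ (x - xs) (g x) ≤ ‖x - xs‖ * ‖g x‖ := real_inner_le_norm _ _
    have h5 : 0 ≤ h * ‖x - xs‖ ^ 2 := by positivity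
    constructor
    · nlinarith
    · nlinarith [mul_le_mul_of_nonneg_left h3 hq, sq_nonneg ‖x - xs‖, abs_nonneg c,
        mul_nonneg hA (sq_nonneg ‖x - xs‖), mul_nonneg hB (sq_nonneg ‖x - xs‖)]
  · rw [not_lt, dist_eq_norm] at hxr
    constructor
    · have h1 := hG x hx hf
      have h2 : G ≤ G / r * ‖x - xs‖ := by
        rw [div_mul_eq_mul_div, le_div_iff₀ hr]; exact mul_le_mul_of_nonneg_left hxr hG0
      nlinarith [mul_nonneg hA hq, mul_nonneg (abs_nonneg c) hq]
    · have h2 : f₀ - f xs ≤ (f₀ - f xs) / r ^ 2 * ‖x - xs‖ ^ 2 := by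
        rw [div_mul_eq_mul_div, le_div_iff₀ (by positivity)]
        exact mul_le_mul_of_nonneg_left (by gcongr) (by linarith)
      nlinarith [mul_nonneg hB (sq_nonneg ‖x - xs‖), sq_nonneg ‖x - xs‖,
        mul_nonneg (abs_nonneg c) (sq_nonneg ‖x - xs‖)]

/-- Away from the minimizer the gradient is bounded below. -/
theorem exists_le_norm_grad (H : Landscape f g U f₀ xs h) {δ : ℝ} (hδ : 0 < δ) :
    ∃ γ, 0 < γ ∧ ∀ x ∈ U, f x ≤ f₀ → δ ≤ ‖x - xs‖ → γ ≤ ‖g x‖ := by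
  have hcl : IsClosed {x : E | δ ≤ ‖x - xs‖} := isClosed_le continuous_const (by fun_prop)
  have hK := H.isCompact.inter_right hcl
  rcases ({x | x ∈ U ∧ f x ≤ f₀} ∩ {x : E | δ ≤ ‖x - xs‖}).eq_empty_or_nonempty with he | hne
  · refine ⟨1, one_pos, fun x hx hf hd => ?_⟩
    have : x ∈ ({x | x ∈ U ∧ f x ≤ f₀} ∩ {x : E | δ ≤ ‖x - xs‖}) := ⟨⟨hx, hf⟩, hd⟩
    rw [he] at this; exact this.elim
  · obtain ⟨y, hy, hmin⟩ := hK.exists_isMinOn hne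
      ((H.continuousOn_grad.mono fun x hx => hx.1.1).norm)
    refine ⟨‖g y‖, norm_pos_iff.2 fun h0 => ?_, fun x hx hf hd => hmin ⟨⟨hx, hf⟩, hd⟩⟩
    have := H.crit y hy.1.1 h0
    have h2 : δ ≤ ‖y - xs‖ := hy.2
    rw [this, sub_self, norm_zero] at h2
    linarith

/-- The momentum is the difference of p + dq and dq, and both squares occur in `lyapV`; of `f` only
minimality at `xs` is needed. -/
theorem pairNorm_sq_le_lyapV (H : Landscape f g U f₀ xs h) (hd : 0 < d) {z : E × E}
    (hz : z.1 ∈ U) : pairNorm (z - (xs, 0)) ^ 2 ≤ (4 + 2 / d ^ 2) * lyapV f xs d z := by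
  have h1 := H.le_of_mem z.1 hz
  have h2 : ‖z.2‖ ≤ ‖z.2 + d • (z.1 - xs)‖ + d * ‖z.1 - xs‖ := by
    have := norm_sub_le (z.2 + d • (z.1 - xs)) (d • (z.1 - xs))
    rw [add_sub_cancel_right, norm_smul, Real.norm_of_nonneg hd.le] at this
    exact this
  have h3 : ‖z.2‖ ^ 2 ≤ 4 * lyapV f xs d z := by
    have : ‖z.2‖ ^ 2 ≤ (‖z.2 + d • (z.1 - xs)‖ + d * ‖z.1 - xs‖) ^ 2 := by gcongr
    unfold lyapV
    nlinarith [sq_nonneg (‖z.2 + d • (z.1 - xs)‖ - d * ‖z.1 - xs‖)]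
  have h4 : ‖z.1 - xs‖ ^ 2 ≤ 2 / d ^ 2 * lyapV f xs d z := by
    rw [div_mul_eq_mul_div, le_div_iff₀ (by positivity)]
    unfold lyapV
    nlinarith [sq_nonneg ‖z.2 + d • (z.1 - xs)‖]
  rw [pairNorm_sub_sq]
  linarith

theorem lyapV_nonneg (H : Landscape f g U f₀ xs h) {z : E × E} (hz : z.1 ∈ U) :
    0 ≤ lyapV f xs d z := by
  have h1 := H.le_of_mem z.1 hz
  have h2 : 0 ≤ f z.1 - f xs := by linarith
  unfold lyapV
  positivity

theorem exists_lyapV_le (H : Landscape f g U f₀ xs h) (hh : 0 ≤ h) (hd : 0 < d) :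
    ∃ C, 0 < C ∧ ∀ z : E × E, z.1 ∈ U → f z.1 ≤ f₀ →
      lyapV f xs d z ≤ C * pairNorm (z - (xs, 0)) ^ 2 := by
  obtain ⟨C, hC, hb⟩ := H.exists_upper_bounds hh
  refine ⟨C + 1 + 2 * d ^ 2, by positivity, fun z hz hf => ?_⟩
  have h1 := (hb z.1 hz hf).2
  have h2 : ‖z.2 + d • (z.1 - xs)‖ ≤ ‖z.2‖ + d * ‖z.1 - xs‖ := by
    have := norm_add_le z.2 (d • (z.1 - xs))
    rwa [norm_smul, Real.norm_of_nonneg hd.le] at this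
  have h3 : ‖z.2 + d • (z.1 - xs)‖ ^ 2 ≤ (‖z.2‖ + d * ‖z.1 - xs‖) ^ 2 := by gcongr
  rw [pairNorm_sub_sq]
  unfold lyapV
  nlinarith [sq_nonneg (‖z.2‖ - d * ‖z.1 - xs‖), sq_nonneg (d * ‖z.1 - xs‖), sq_nonneg ‖z.2‖,
    sq_nonneg ‖z.1 - xs‖, mul_nonneg hC.le (sq_nonneg ‖z.2‖),
    mul_nonneg (sq_nonneg d) (sq_nonneg ‖z.2‖)]

end Landscape

namespace IsHBFlow

variable {f : E → ℝ} {g : E → E} {U : Set E} {f₀ : ℝ} {xs : E} {h d s T : ℝ} {z : ℝ → E × E}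

theorem mono (F : IsHBFlow f g U f₀ d s T z) {s' T' : ℝ} (hs : s ≤ s') (hT : T' ≤ T) :
    IsHBFlow f g U f₀ d s' T' z where
  deriv t ht := (F.deriv t ⟨hs.trans ht.1, ht.2.trans hT⟩).mono (Icc_subset_Icc hs hT)
  mem t ht := F.mem t ⟨hs.trans ht.1, ht.2.trans hT⟩

theorem continuousOn (F : IsHBFlow f g U f₀ d s T z) : ContinuousOn z (Icc s T) :=
  fun t ht => (F.deriv t ht).continuousWithinAt

theorem deriv_right (F : IsHBFlow f g U f₀ d s T z) {t : ℝ} (ht : t ∈ Ico s T) :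
    HasDerivWithinAt z (heavyBall g d (z t)) (Ici t) t :=
  (F.deriv t ⟨ht.1, ht.2.le⟩).mono_of_mem_nhdsWithin (Icc_mem_nhdsGE_of_mem ht)

/-- The momentum is damped, up to the contribution of the force. -/
theorem norm_snd_le (F : IsHBFlow f g U f₀ d s T z) (hd : 0 < d) {G : ℝ} (hG : 0 ≤ G)
    (hg : ∀ x ∈ U, f x ≤ f₀ → ‖g x‖ ≤ G) :
    ∀ t ∈ Icc s T, ‖(z t).2‖ ≤ Real.exp (-(2 * d * (t - s))) * ‖(z s).2‖ + G / (2 * d) := by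
  intro t ht
  have hlin : ∀ x, HasDerivAt (fun t => 2 * d * (t - s)) (2 * d) x := fun x => by
    simpa using ((hasDerivAt_id x).sub_const s).const_mul (2 * d)
  -- The integrating factor e^{2d(t-s)} cancels the damping and leaves only the force in the
  -- derivative.
  have key := image_norm_le_of_norm_deriv_right_le_deriv_boundary (a := s) (b := T)
    (f := fun t => Real.exp (2 * d * (t - s)) • (z t).2)
    (f' := fun t => -(Real.exp (2 * d * (t - s)) • g (z t).1))
    (B := fun t => ‖(z s).2‖ + G / (2 * d) * (Real.exp (2 * d * (t - s)) - 1))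
    (B' := fun t => G / (2 * d) * (Real.exp (2 * d * (t - s)) * (2 * d)))
    (by
      have := F.continuousOn.snd
      fun_prop)
    (fun x hx => by
      have h1 := ((hlin x).exp.hasDerivWithinAt (s := Ici x)).smul (F.deriv_right hx).pair_snd
      refine h1.congr_deriv ?_
      simp only [heavyBall]
      module)
    (by simp)
    (fun x => (((hlin x).exp.sub_const 1).const_mul _).const_add _)
    (fun x hx => by
      have hm := F.mem x ⟨hx.1, hx.2.le⟩
      have := hg _ hm.1 hm.2
      rw [norm_neg, norm_smul, Real.norm_of_nonneg (Real.exp_pos _).le]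
      have h2 : G / (2 * d) * (Real.exp (2 * d * (x - s)) * (2 * d))
        = Real.exp (2 * d * (x - s)) * G := by field_simp
      rw [h2]
      gcongr) ht
  simp only [norm_smul, Real.norm_of_nonneg (Real.exp_pos _).le] at key
  have he := Real.exp_pos (2 * d * (t - s))
  rw [Real.exp_neg]
  have h3 : ‖(z t).2‖ ≤ (Real.exp (2 * d * (t - s)))⁻¹ *
      (‖(z s).2‖ + G / (2 * d) * (Real.exp (2 * d * (t - s)) - 1)) := by
    rw [le_inv_mul_iff₀ he]; exact key
  have h4 : (Real.exp (2 * d * (t - s)))⁻¹ *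
      (‖(z s).2‖ + G / (2 * d) * (Real.exp (2 * d * (t - s)) - 1)) =
      (Real.exp (2 * d * (t - s)))⁻¹ * ‖(z s).2‖ + G / (2 * d)
        - G / (2 * d) * (Real.exp (2 * d * (t - s)))⁻¹ := by
    field_simp
    ring
  have h5 : 0 ≤ G / (2 * d) * (Real.exp (2 * d * (t - s)))⁻¹ := by positivity
  linarith

/-- The weights in `lyapV` are matched to the damping 2d so that the terms in ⟨p, g⟩ and in ⟨p, q⟩
cancel. -/
theorem hasDeriv_lyapV (F : IsHBFlow f g U f₀ d s T z) (H : Landscape f g U f₀ xs h) {t : ℝ}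
    (ht : t ∈ Icc s T) :
    HasDerivWithinAt (fun t => lyapV f xs d (z t))
      (-d * ‖(z t).2‖ ^ 2 - d * inner ℝ ((z t).1 - xs) (g (z t).1)) (Icc s T) t := by
  have hz := F.deriv t ht
  have h1 := hz.pair_fst
  have h2 := hz.pair_snd
  have hf := (H.hasFDerivAt _ (F.mem t ht).1).comp_hasDerivWithinAt t h1
  have hq := h1.sub_const xs
  have := ((hf.sub_const (f xs)).add ((h2.add (hq.const_smul d)).norm_sq.const_mul (1 / 2))).add
    (hq.norm_sq.const_mul (d ^ 2 / 2))
  refine this.congr_deriv ?_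
  simp only [heavyBall, innerSL_apply_apply, inner_add_left, inner_sub_right, inner_add_right,
    inner_neg_right, real_inner_smul_left, real_inner_smul_right, inner_sub_left,
    Pi.add_apply, Pi.smul_apply]
  simp only [real_inner_self_eq_norm_sq, real_inner_comm (z t).2, real_inner_comm (g (z t).1) xs]
  ring

/-- The energy alone dissipates only through p. The cross term in `lyapW` contributes -ε‖g‖², so
dissipation persists at instants of zero momentum, at the price of a Hessian term. -/
theorem hasDeriv_lyapW (F : IsHBFlow f g U f₀ d s T z) (H : Landscape f g U f₀ xs h) (ε : ℝ)
    {t : ℝ} (ht : t ∈ Icc s T) :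
    HasDerivWithinAt (fun t => lyapW f g ε (z t))
      (-(2 * d) * ‖(z t).2‖ ^ 2 - ε * ‖g (z t).1‖ ^ 2 - 2 * d * ε * inner ℝ (z t).2 (g (z t).1)
        + ε * inner ℝ (z t).2 (fderiv ℝ g (z t).1 (z t).2)) (Icc s T) t := by
  have hz := F.deriv t ht
  have h1 := hz.pair_fst
  have h2 := hz.pair_snd
  have hf := (H.hasFDerivAt _ (F.mem t ht).1).comp_hasDerivWithinAt t h1
  have hg := (H.hasFDerivAt_grad (F.mem t ht).1).comp_hasDerivWithinAt t h1
  have := (hf.add (h2.norm_sq.const_mul (1 / 2))).add ((h2.inner ℝ hg).const_mul ε)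
  refine this.congr_deriv ?_
  simp only [heavyBall, innerSL_apply_apply, inner_sub_right, inner_neg_right, inner_sub_left,
    inner_neg_left, real_inner_smul_left, real_inner_smul_right, Function.comp]
  simp only [real_inner_self_eq_norm_sq, real_inner_comm (z t).2 (g (z t).1)]
  ring

end IsHBFlow
end

/-! ### Exponential decay along heavy-ball flows -/

noncomputable section

open Filter Topology InnerProductSpace

variable {E : Type*} [NormedAddCommGroup E] [InnerProductSpace ℝ E]
  {f : E → ℝ} {g : E → E} {U : Set E} {f₀ : ℝ} {xs : E} {h d s T : ℝ} {z : ℝ → E × E}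

namespace Landscape

/-- Points where the local Lyapunov function is small satisfy the growth condition. -/
theorem exists_growth_of_lyapV_lt (H : Landscape f g U f₀ xs h) (hd : 0 < d) :
    ∃ v₀, 0 < v₀ ∧ ∀ z : E × E, z.1 ∈ U → lyapV f xs d z < v₀ →
      f z.1 - f xs + h * ‖z.1 - xs‖ ^ 2 ≤ inner ℝ (z.1 - xs) (g z.1) := by
  obtain ⟨r, hr, hball⟩ := Metric.eventually_nhds_iff.1 H.growth
  -- With this level the last term of `lyapV` alone already forces ‖z.1 - xs‖ < r.
  refine ⟨d ^ 2 / 2 * r ^ 2, by positivity, fun z hz hV => hball ?_⟩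
  rw [dist_eq_norm]
  have h1 := H.le_of_mem z.1 hz
  unfold lyapV at hV
  have h2 : d ^ 2 / 2 * ‖z.1 - xs‖ ^ 2 < d ^ 2 / 2 * r ^ 2 := by
    nlinarith [sq_nonneg ‖z.2 + d • (z.1 - xs)‖]
  exact lt_of_pow_lt_pow_left₀ 2 hr.le (lt_of_mul_lt_mul_left h2 (by positivity))

/-- V is at most (f - f(xs)) + ‖p‖² + (3/2)d²‖q‖², to be compared term by term with the dissipation:
ρ ≤ d settles the first two terms, 3dρ ≤ 2h the third. -/
theorem neg_lyapV_deriv_ge (H : Landscape f g U f₀ xs h) (hd : 0 < d) {ρ : ℝ} (hρ0 : 0 ≤ ρ)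
    (hρd : ρ ≤ d) (hρh : 3 * d * ρ ≤ 2 * h) {z : E × E} (hz : z.1 ∈ U)
    (hg : f z.1 - f xs + h * ‖z.1 - xs‖ ^ 2 ≤ inner ℝ (z.1 - xs) (g z.1)) :
    -d * ‖z.2‖ ^ 2 - d * inner ℝ (z.1 - xs) (g z.1) ≤ -ρ * lyapV f xs d z := by
  have h1 := H.le_of_mem z.1 hz
  have h2 : ‖z.2 + d • (z.1 - xs)‖ ^ 2 ≤ 2 * ‖z.2‖ ^ 2 + 2 * d ^ 2 * ‖z.1 - xs‖ ^ 2 := by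
    have h2 : ‖z.2 + d • (z.1 - xs)‖ ≤ ‖z.2‖ + d * ‖z.1 - xs‖ := by
      have := norm_add_le z.2 (d • (z.1 - xs))
      rwa [norm_smul, Real.norm_of_nonneg hd.le] at this
    have h3 : ‖z.2 + d • (z.1 - xs)‖ ^ 2 ≤ (‖z.2‖ + d * ‖z.1 - xs‖) ^ 2 := by gcongr
    nlinarith [sq_nonneg (‖z.2‖ - d * ‖z.1 - xs‖)]
  have h3 : lyapV f xs d z ≤ (f z.1 - f xs) + ‖z.2‖ ^ 2 + 3 / 2 * d ^ 2 * ‖z.1 - xs‖ ^ 2 := by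
    unfold lyapV; linarith
  have h4 := mul_le_mul_of_nonneg_left h3 hρ0
  have h5 := mul_le_mul_of_nonneg_left hg hd.le
  have h6 : ρ * (f z.1 - f xs) ≤ d * (f z.1 - f xs) :=
    mul_le_mul_of_nonneg_right hρd (by linarith)
  have h7 : ρ * ‖z.2‖ ^ 2 ≤ d * ‖z.2‖ ^ 2 := mul_le_mul_of_nonneg_right hρd (sq_nonneg _)
  have h8 : (3 * d * ρ) * (d * ‖z.1 - xs‖ ^ 2) ≤ (2 * h) * (d * ‖z.1 - xs‖ ^ 2) :=
    mul_le_mul_of_nonneg_right hρh (by positivity)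
  nlinarith

/-- Exponential decay near the minimizer. -/
theorem exists_local_decay (H : Landscape f g U f₀ xs h) (hd : 0 < d) {c : ℝ} (hc : 0 ≤ c)
    (hcd : 2 * c < d) (hch : 3 * d * c < h) :
    ∃ v₀, 0 < v₀ ∧ ∀ s T (z : ℝ → E × E), IsHBFlow f g U f₀ d s T z → s ≤ T →
      lyapV f xs d (z s) < v₀ →
      lyapV f xs d (z T) ≤ lyapV f xs d (z s) * Real.exp (-(2 * c) * (T - s)) := by
  obtain ⟨v₀, hv₀, hg⟩ := H.exists_growth_of_lyapV_lt hd
  refine ⟨v₀, hv₀, fun s T z F hsT hs => ?_⟩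
  -- This minimum is the largest rate that `neg_lyapV_deriv_ge` admits. The factor 2 appears because
  -- V is quadratic in the distance.
  have hρ : 2 * c < min d (2 * h / (3 * d)) := by
    refine lt_min hcd ?_
    rw [lt_div_iff₀ (by positivity)]; linarith
  refine le_mul_exp_of_deriv_le_below (V := fun t => lyapV f xs d (z t))
    (V' := fun t => -d * ‖(z t).2‖ ^ 2 - d * inner ℝ ((z t).1 - xs) (g (z t).1))
    (ρ := min d (2 * h / (3 * d))) (v₀ := v₀)
    (fun t ht => (F.hasDeriv_lyapV H ht).continuousWithinAt)
    (fun t ht => (F.hasDeriv_lyapV H ⟨ht.1, ht.2.le⟩).mono_of_mem_nhdsWithin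
      (Icc_mem_nhdsGE_of_mem ht))
    (fun t ht hV => ?_) (by positivity) hρ hs
    (H.lyapV_nonneg (F.mem s ⟨le_rfl, hsT⟩).1) T ⟨hsT, le_rfl⟩
  have hU := (F.mem t ⟨ht.1, ht.2.le⟩).1
  refine H.neg_lyapV_deriv_ge hd (by linarith) (min_le_left _ _) ?_ hU (hg _ hU hV)
  have := min_le_right d (2 * h / (3 * d))
  rw [le_div_iff₀ (by positivity)] at this
  linarith

/-- The derivative of the global Lyapunov function is bounded above. -/
theorem lyapW_deriv_le {ε M : ℝ} (hd : 0 ≤ d) (hε : 0 ≤ ε)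
    (hεM : ε * M + 2 * d ^ 2 * ε = d) {x : E} (hM : ‖fderiv ℝ g x‖ ≤ M) (p : E) :
    -(2 * d) * ‖p‖ ^ 2 - ε * ‖g x‖ ^ 2 - 2 * d * ε * inner ℝ p (g x)
      + ε * inner ℝ p (fderiv ℝ g x p) ≤ -(d * ‖p‖ ^ 2 + ε / 2 * ‖g x‖ ^ 2) := by
  have h2 : -(‖p‖ * ‖g x‖) ≤ inner ℝ p (g x) := (abs_le.1 (abs_real_inner_le_norm _ _)).1
  have h3 : inner ℝ p (fderiv ℝ g x p) ≤ M * ‖p‖ ^ 2 := by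
    refine (real_inner_le_norm _ _).trans ?_
    have h5 := (fderiv ℝ g x).le_opNorm p
    have h4 := mul_le_mul_of_nonneg_right hM (norm_nonneg p)
    have h6 := mul_le_mul_of_nonneg_left (h5.trans h4) (norm_nonneg p)
    linarith
  have h5 := mul_le_mul_of_nonneg_left h2 (mul_nonneg (mul_nonneg zero_le_two hd) hε)
  have h6 := mul_le_mul_of_nonneg_left h3 hε
  have h7 : ε * M * ‖p‖ ^ 2 + 2 * d ^ 2 * ε * ‖p‖ ^ 2 = d * ‖p‖ ^ 2 := by
    linear_combination ‖p‖ ^ 2 * hεM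
  -- The mixed term is split as 2dε‖p‖‖g‖ ≤ 2d²ε‖p‖² + (ε/2)‖g‖².
  have h8 := mul_nonneg hε (sq_nonneg (2 * d * ‖p‖ - ‖g x‖))
  linarith

/-- Flows with bounded initial momentum get close to the minimizer within a uniform time. -/
theorem exists_hitting_time (H : Landscape f g U f₀ xs h) (hh : 0 ≤ h) (hd : 0 < d) {v₀ : ℝ}
    (hv₀ : 0 < v₀) (P : ℝ) :
    ∃ τ, 0 ≤ τ ∧ ∀ s (z : ℝ → E × E), IsHBFlow f g U f₀ d s (s + τ) z → ‖(z s).2‖ ≤ P →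
      ∃ t ∈ Icc s (s + τ), lyapV f xs d (z t) < v₀ := by
  obtain ⟨M, hM0, hM⟩ := H.exists_norm_fderiv_grad_le
  obtain ⟨G, hG0, hG⟩ := H.exists_norm_grad_le
  obtain ⟨C, hC, hV⟩ := H.exists_lyapV_le hh hd
  -- With this `ε` the Hessian term and the mixed term together use up exactly half of the damping
  -- 2d‖p‖².
  set ε : ℝ := d / (M + 2 * d ^ 2) with hε
  have hden : 0 < M + 2 * d ^ 2 := by positivity
  have hε0 : 0 < ε := by positivity
  have hεM : ε * M + 2 * d ^ 2 * ε = d := by rw [hε]; field_simp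
  -- Where V ≥ v₀, the squared distance to (xs, 0) is at least v₀/C, so ‖p‖² or ‖q‖² is at least
  -- v₀/(2C). In either case the dissipation of W is at least the `ω` below.
  obtain ⟨γ, hγ, hgrad⟩ := H.exists_le_norm_grad (δ := Real.sqrt (v₀ / (2 * C))) (by positivity)
  set ω : ℝ := min (d * (v₀ / (2 * C))) (ε / 2 * γ ^ 2) with hω
  have hω0 : 0 < ω := by positivity
  set P₁ : ℝ := |P| + G / (2 * d) with hP₁
  have hP₁0 : 0 ≤ P₁ := by positivity
  have hsnd : ∀ s T (z : ℝ → E × E), IsHBFlow f g U f₀ d s T z → ‖(z s).2‖ ≤ P →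
      ∀ t ∈ Icc s T, ‖(z t).2‖ ≤ P₁ := by
    intro s T z F hz t ht
    have h1 := F.norm_snd_le hd hG0 hG t ht
    have h2 : Real.exp (-(2 * d * (t - s))) ≤ 1 :=
      Real.exp_le_one_iff.2 (by nlinarith [ht.1, mul_nonneg hd.le (sub_nonneg.2 ht.1)])
    have h3 := mul_le_mul_of_nonneg_right h2 (norm_nonneg (z s).2)
    have h4 := le_abs_self P
    rw [hP₁]; linarith
  set W₀ : ℝ := f₀ + 1 / 2 * P₁ ^ 2 + ε * (P₁ * G) with hW₀
  set W₁ : ℝ := f xs - ε * (P₁ * G) with hW₁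
  have hW : ∀ y : E × E, y.1 ∈ U → f y.1 ≤ f₀ → ‖y.2‖ ≤ P₁ →
      W₁ ≤ lyapW f g ε y ∧ lyapW f g ε y ≤ W₀ := by
    intro y hy hf hp
    have h1 := H.le_of_mem y.1 hy
    have h2 : |inner ℝ y.2 (g y.1)| ≤ P₁ * G :=
      (abs_real_inner_le_norm _ _).trans (mul_le_mul hp (hG _ hy hf) (norm_nonneg _) hP₁0)
    obtain ⟨h3, h4⟩ := abs_le.1 h2
    have h5 : ‖y.2‖ ^ 2 ≤ P₁ ^ 2 := by gcongr
    have h6 := mul_le_mul_of_nonneg_left h3 hε0.le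
    have h7 := mul_le_mul_of_nonneg_left h4 hε0.le
    unfold lyapW
    constructor <;> nlinarith [sq_nonneg ‖y.2‖]
  have hW01 : W₁ ≤ W₀ := by
    have := H.lt
    have h1 : 0 ≤ ε * (P₁ * G) := by positivity
    nlinarith [sq_nonneg P₁]
  -- The extra 1 makes the total drop of W exceed its possible range strictly.
  refine ⟨(W₀ - W₁) / ω + 1, by have := div_nonneg (sub_nonneg.2 hW01) hω0.le; linarith,
    fun s z F hz => ?_⟩
  by_contra! hcon
  set τ : ℝ := (W₀ - W₁) / ω + 1 with hτ
  have hτ0 : 0 ≤ τ := by have := div_nonneg (sub_nonneg.2 hW01) hω0.le; linarith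
  have key := image_le_of_deriv_right_le_deriv_boundary
    (f := fun t => lyapW f g ε (z t))
    (f' := fun t => -(2 * d) * ‖(z t).2‖ ^ 2 - ε * ‖g (z t).1‖ ^ 2
        - 2 * d * ε * inner ℝ (z t).2 (g (z t).1)
        + ε * inner ℝ (z t).2 (fderiv ℝ g (z t).1 (z t).2)) (a := s) (b := s + τ)
    (B := fun t => lyapW f g ε (z s) + (-ω) * (t - s)) (B' := fun _ => -ω)
    (fun t ht => (F.hasDeriv_lyapW H ε ht).continuousWithinAt)
    (fun t ht => (F.hasDeriv_lyapW H ε ⟨ht.1, ht.2.le⟩).mono_of_mem_nhdsWithin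
      (Icc_mem_nhdsGE_of_mem ht)) (by simp) (by fun_prop)
    (fun t _ => by
      have := (((hasDerivAt_id t).sub_const s).const_mul (-ω)).const_add (lyapW f g ε (z s))
      simpa using this.hasDerivWithinAt)
    (fun t ht => by
      obtain ⟨hU, hf⟩ := F.mem t ⟨ht.1, ht.2.le⟩
      have h1 := hcon t ⟨ht.1, ht.2.le⟩
      have h4 : ω ≤ d * ‖(z t).2‖ ^ 2 + ε / 2 * ‖g (z t).1‖ ^ 2 := by
        have h5 := h1.trans (hV (z t) hU hf)
        rw [pairNorm_sub_sq] at h5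
        rcases le_total (v₀ / (2 * C)) (‖(z t).2‖ ^ 2) with h6 | h6
        · have h7 := mul_le_mul_of_nonneg_left h6 hd.le
          have h8 : 0 ≤ ε / 2 * ‖g (z t).1‖ ^ 2 := by positivity
          linarith [min_le_left (d * (v₀ / (2 * C))) (ε / 2 * γ ^ 2)]
        · have h7 : v₀ / (2 * C) ≤ ‖(z t).1 - xs‖ ^ 2 := by
            rw [div_le_iff₀ (by positivity)]
            rw [le_div_iff₀ (by positivity)] at h6
            linarith
          have h8 := hgrad _ hU hf (Real.sqrt_le_iff.2 ⟨norm_nonneg _, h7⟩)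
          have h9 : γ ^ 2 ≤ ‖g (z t).1‖ ^ 2 := by gcongr
          have h10 := mul_le_mul_of_nonneg_left h9 (half_pos hε0).le
          have h11 : 0 ≤ d * ‖(z t).2‖ ^ 2 := by positivity
          linarith [min_le_right (d * (v₀ / (2 * C))) (ε / 2 * γ ^ 2)]
      exact (lyapW_deriv_le hd.le hε0.le hεM (hM _ hU hf) (z t).2).trans (neg_le_neg h4))
    (⟨by linarith, le_rfl⟩ : s + τ ∈ Icc s (s + τ))
  have hs : s ∈ Icc s (s + τ) := ⟨le_rfl, by linarith⟩
  have hT : s + τ ∈ Icc s (s + τ) := ⟨by linarith, le_rfl⟩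
  have h1 := (hW _ (F.mem s hs).1 (F.mem s hs).2 (hsnd _ _ z F hz s hs)).2
  have h2 := (hW _ (F.mem _ hT).1 (F.mem _ hT).2 (hsnd _ _ z F hz _ hT)).1
  have h3 : ω * τ = W₀ - W₁ + ω := by rw [hτ]; field_simp
  have h4 : lyapW f g ε (z (s + τ)) ≤ lyapW f g ε (z s) + (-ω) * (s + τ - s) := key
  nlinarith

/-- Exponential decay along every flow of the heavy-ball system in the sublevel set, with a
uniform constant. -/
theorem exists_decay (H : Landscape f g U f₀ xs h) (hd : 0 < d) {c : ℝ} (hc : 0 ≤ c)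
    (hcd : 2 * c < d) (hch : 3 * d * c < h) :
    ∃ C, 1 ≤ C ∧ ∀ s T (z : ℝ → E × E), IsHBFlow f g U f₀ d s T z → s ≤ T →
      pairNorm (z T - (xs, 0)) ≤ C * pairNorm (z s - (xs, 0)) * Real.exp (-(c * (T - s))) := by
  have hh : 0 ≤ h := by
    have : 0 ≤ 3 * d * c := by positivity
    linarith
  obtain ⟨v₀, hv₀, hloc⟩ := H.exists_local_decay hd hc hcd hch
  obtain ⟨G, hG0, hG⟩ := H.exists_norm_grad_le
  obtain ⟨D, hD0, hD⟩ := H.exists_dist_le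
  obtain ⟨C, hC, hV⟩ := H.exists_lyapV_le hh hd
  -- This is the momentum bound after the waiting time `T₀` below: the initial momentum has been
  -- damped to at most 1, and the force adds at most G/(2d).
  obtain ⟨τ, hτ0, hit⟩ := H.exists_hitting_time hh hd hv₀ (1 + G / (2 * d))
  -- A flow that is already close decays.
  have hlow : ∀ s T (z : ℝ → E × E), IsHBFlow f g U f₀ d s T z → s ≤ T →
      lyapV f xs d (z s) < v₀ → pairNorm (z T - (xs, 0)) ≤
        Real.sqrt ((4 + 2 / d ^ 2) * lyapV f xs d (z s)) * Real.exp (-(c * (T - s))) := by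
    intro s T z F hsT hs
    have hU := (F.mem s ⟨le_rfl, hsT⟩).1
    have h1 := H.pairNorm_sq_le_lyapV hd (F.mem T ⟨hsT, le_rfl⟩).1
    have h2 := mul_le_mul_of_nonneg_left (hloc s T z F hsT hs)
      (by positivity : (0 : ℝ) ≤ 4 + 2 / d ^ 2)
    refine le_of_sq_le_sq ?_ (by positivity)
    rw [mul_pow, Real.sq_sqrt (mul_nonneg (by positivity) (H.lyapV_nonneg hU)), ← Real.exp_nat_mul]
    have h3 : (2 : ℕ) * -(c * (T - s)) = -(2 * c) * (T - s) := by push_cast; ring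
    rw [h3]
    linarith
  set y₀ : ℝ := Real.sqrt (v₀ / C) with hy₀
  have hy₀0 : 0 < y₀ := by positivity
  set A : ℝ := 1 / y₀ + 1 with hA
  set B : ℝ := Real.sqrt ((4 + 2 / d ^ 2) * v₀) with hB
  set C₁ : ℝ := Real.sqrt ((4 + 2 / d ^ 2) * C) with hC₁
  set C₂ : ℝ := (D + G / (2 * d) + B) * Real.exp (c * τ) * A with hC₂
  have hA0 : 0 < A := by positivity
  refine ⟨1 + C₁ + C₂, by have : 0 ≤ C₁ := by positivity
                          have : 0 ≤ C₂ := by positivity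
                          linarith, fun s T z F hsT => ?_⟩
  have hC₁0 : 0 ≤ C₁ := by positivity
  have hC₂0 : 0 ≤ C₂ := by positivity
  set y : ℝ := pairNorm (z s - (xs, 0)) with hy
  have hy0 : 0 ≤ y := pairNorm_nonneg _
  have hs := F.mem s ⟨le_rfl, hsT⟩
  have hT := F.mem T ⟨hsT, le_rfl⟩
  have hVs := hV _ hs.1 hs.2
  have hE := Real.exp_pos (-(c * (T - s)))
  by_cases hclose : lyapV f xs d (z s) < v₀
  · have h1 := hlow s T z F hsT hclose
    have h2 : Real.sqrt ((4 + 2 / d ^ 2) * lyapV f xs d (z s)) ≤ C₁ * y := by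
      rw [hC₁, ← Real.sqrt_sq hy0, ← Real.sqrt_mul (by positivity)]
      refine Real.sqrt_le_sqrt ?_
      rw [mul_assoc]
      exact mul_le_mul_of_nonneg_left hVs (by positivity)
    refine h1.trans (mul_le_mul_of_nonneg_right (h2.trans ?_) hE.le)
    nlinarith [mul_nonneg hC₂0 hy0]
  rw [not_lt] at hclose
  -- A start outside the local region lies at distance at least `y₀`, so additive constants can be
  -- absorbed into multiples of `y`.
  have hyy : y₀ ≤ y := by
    rw [hy₀]
    refine Real.sqrt_le_iff.2 ⟨hy0, ?_⟩
    rw [div_le_iff₀ hC, mul_comm]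
    exact hclose.trans hVs
  have hp : ‖(z s).2‖ ≤ y := norm_snd_le_pairNorm (z s) xs
  have hmax : max 1 ‖(z s).2‖ ≤ A * y := by
    have : 1 / y₀ * y = y / y₀ := by ring
    have h1 : 1 ≤ y / y₀ := (one_le_div hy₀0).2 hyy
    refine max_le ?_ ?_ <;> rw [hA] <;> nlinarith
  set T₀ : ℝ := Real.log (max 1 ‖(z s).2‖) / (2 * d) with hT₀
  have hmax1 : 1 ≤ max 1 ‖(z s).2‖ := le_max_left _ _
  have hT₀0 : 0 ≤ T₀ := div_nonneg (Real.log_nonneg hmax1) (by positivity)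
  have hexpT₀ : Real.exp (2 * d * T₀) = max 1 ‖(z s).2‖ := by
    rw [hT₀, mul_div_cancel₀ _ (by positivity : (2 * d : ℝ) ≠ 0), Real.exp_log (by linarith)]
  -- Since c ≤ 2d, waiting for `T₀` costs at most the factor max(1, ‖p‖), which is linear in `y`;
  -- thus one constant serves arbitrarily large momenta.
  have hexpc : Real.exp (c * (T₀ + τ)) ≤ Real.exp (c * τ) * (A * y) := by
    have h1 : Real.exp (c * T₀) ≤ Real.exp (2 * d * T₀) :=
      Real.exp_le_exp.2 (mul_le_mul_of_nonneg_right (by linarith) hT₀0)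
    rw [mul_add, Real.exp_add, mul_comm]
    exact mul_le_mul_of_nonneg_left ((h1.trans hexpT₀.le).trans hmax) (Real.exp_pos _).le
  have hmom := F.norm_snd_le hd hG0 hG
  have hC₂y : ∀ r, 0 ≤ r → r ≤ D + G / (2 * d) + B →
      r * Real.exp (c * (T₀ + τ)) ≤ C₂ * y := by
    intro r hr hr'
    calc r * Real.exp (c * (T₀ + τ))
        ≤ (D + G / (2 * d) + B) * (Real.exp (c * τ) * (A * y)) :=
          mul_le_mul hr' hexpc (Real.exp_pos _).le (by positivity)
      _ = C₂ * y := by rw [hC₂]; ring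
  have hBnn : 0 ≤ B := Real.sqrt_nonneg _
  -- Before the waiting and hitting times have elapsed, compactness and damping bound the state.
  -- Afterwards local decay applies from some hitting instant `u`.
  rcases le_total T (s + T₀ + τ) with hTs | hTs
  · have h1 : pairNorm (z T - (xs, 0)) ≤ ‖(z T).1 - xs‖ + ‖(z T).2‖ := 
      pairNorm_sub_le_add (z T) xs
    have h2 := hD _ hT.1 hT.2
    have h3 := hmom T ⟨hsT, le_rfl⟩
    have h4 : Real.exp (-(2 * d * (T - s))) ≤ Real.exp (-(c * (T - s))) :=
      Real.exp_le_exp.2 (neg_le_neg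
        (mul_le_mul_of_nonneg_right (by linarith) (sub_nonneg.2 hsT)))
    have h5 : Real.exp (-(2 * d * (T - s))) * ‖(z s).2‖ ≤ Real.exp (-(c * (T - s))) * y :=
      mul_le_mul h4 hp (norm_nonneg _) hE.le
    have h6 : D + G / (2 * d) ≤ C₂ * y * Real.exp (-(c * (T - s))) := by
      have h7 := mul_le_mul_of_nonneg_right
        (hC₂y (D + G / (2 * d)) (by positivity) (by linarith)) hE.le
      refine le_trans ?_ h7
      rw [mul_assoc, ← Real.exp_add]
      refine le_mul_of_one_le_right (by positivity) (Real.one_le_exp ?_)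
      have h8 := mul_nonneg hc (by linarith : 0 ≤ T₀ + τ - (T - s))
      linarith
    have h8 := mul_nonneg (mul_nonneg hC₁0 hy0) hE.le
    have h9 : (1 + C₁ + C₂) * y * Real.exp (-(c * (T - s))) = Real.exp (-(c * (T - s))) * y
      + C₁ * y * Real.exp (-(c * (T - s))) + C₂ * y * Real.exp (-(c * (T - s))) := by ring
    linarith
  · have hmid : s + T₀ ∈ Icc s T := ⟨by linarith, by linarith⟩
    have h1 := hmom _ hmid
    have h2 : ‖(z (s + T₀)).2‖ ≤ 1 + G / (2 * d) := by
      refine h1.trans (add_le_add_left ?_ _)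
      rw [add_sub_cancel_left, Real.exp_neg, hexpT₀, inv_mul_le_iff₀ (by linarith), mul_one]
      exact le_max_right _ _
    obtain ⟨u, hu, hVu⟩ := hit (s + T₀) z (F.mono (by linarith) hTs) h2
    have hsu : s ≤ u := by linarith [hu.1]
    have huT : u ≤ T := hu.2.trans hTs
    have h3 := hlow u T z (F.mono hsu le_rfl) huT hVu
    have h4 : Real.sqrt ((4 + 2 / d ^ 2) * lyapV f xs d (z u)) ≤ B :=
      Real.sqrt_le_sqrt (mul_le_mul_of_nonneg_left hVu.le (by positivity))
    have h5 : Real.exp (-(c * (T - u))) ≤ Real.exp (c * (T₀ + τ)) * Real.exp (-(c * (T - s))) := by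
      rw [← Real.exp_add]
      refine Real.exp_le_exp.2 ?_
      have h8 := mul_nonneg hc (by linarith [hu.2] : 0 ≤ T₀ + τ + s - u)
      linarith
    have h6 := hC₂y B hBnn (by have : 0 ≤ D + G / (2 * d) := by positivity
                               linarith)
    calc pairNorm (z T - (xs, 0)) ≤ B * Real.exp (-(c * (T - u))) :=
          h3.trans (mul_le_mul_of_nonneg_right h4 (Real.exp_pos _).le)
      _ ≤ B * Real.exp (c * (T₀ + τ)) * Real.exp (-(c * (T - s))) := by
          rw [mul_assoc]; exact mul_le_mul_of_nonneg_left h5 hBnn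
      _ ≤ C₂ * y * Real.exp (-(c * (T - s))) := mul_le_mul_of_nonneg_right h6 hE.le
      _ ≤ (1 + C₁ + C₂) * y * Real.exp (-(c * (T - s))) := by
          refine mul_le_mul_of_nonneg_right ?_ hE.le
          have h7 := mul_nonneg hC₁0 hy0
          have h8 : (1 + C₁ + C₂) * y = y + C₁ * y + C₂ * y := by ring
          linarith

end Landscape
end

/-! ### Complete vector fields, cutoffs and decay along hybrid solutions -/

noncomputable section

open Filter Topology InnerProductSpace
open scoped Manifold ContDiff NNReal

/-- A globally Lipschitz vector field of class `C¹` is complete. -/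
theorem exists_hasDerivAt_of_lipschitzWith {E : Type*} [NormedAddCommGroup E] [NormedSpace ℝ E]
    [CompleteSpace E] {v : E → E} (hv : ContDiff ℝ 1 v) {K : ℝ≥0} (hK : LipschitzWith K v)
    (t₀ : ℝ) (y : E) : ∃ w : ℝ → E, w t₀ = y ∧ ∀ t, HasDerivAt w (v (w t)) t := by
  -- On the ball of radius ‖v x‖ about `x` the field is bounded by (1 + K)‖v x‖, so a curve moves at
  -- most ‖v x‖/2 in this time. The existence time is independent of `x`, and local curves extend
  -- globally.
  have hε : (0 : ℝ) < 1 / (2 * (K + 1)) := by positivity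
  have hiff : ∀ (γ : ℝ → E) (t : ℝ), HasMFDerivAt 𝓘(ℝ, ℝ) 𝓘(ℝ, E) γ t
      ((1 : ℝ →L[ℝ] ℝ).smulRight (v (γ t))) ↔ HasDerivAt γ (v (γ t)) t := fun γ t => by
    have h1 : (1 : ℝ →L[ℝ] ℝ).smulRight (v (γ t)) =
        ContinuousLinearMap.toSpanSingleton ℝ (v (γ t)) := by
      ext; simp
    refine (hasMFDerivAt_iff_hasFDerivAt
      (f' := ((1 : ℝ →L[ℝ] ℝ).smulRight (v (γ t)) : ℝ →L[ℝ] E))).trans ?_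
    rw [hasDerivAt_iff_hasFDerivAt, h1]
    exact Iff.rfl
  have hex : ∀ x : E, ∃ γ : ℝ → E, γ 0 = x ∧
      IsMIntegralCurveOn (I := 𝓘(ℝ, E)) γ v (Ioo (-(1 / (2 * (K + 1)) : ℝ)) (1 / (2 * (K + 1)))) := by
    intro x
    have hPL : IsPicardLindelof (fun _ => v) (tmin := -(1 / (2 * (K + 1)) : ℝ))
        (tmax := 1 / (2 * (K + 1))) ⟨0, by constructor <;> linarith⟩ x ‖v x‖₊ 0
        (‖v x‖₊ + K * ‖v x‖₊) K :=
      { lipschitzOnWith := fun _ _ => hK.lipschitzOnWith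
        continuousOn := fun _ _ => continuousOn_const
        norm_le := fun _ _ z hz => by
          have h1 := hK.dist_le_mul z x
          have h2 : ‖v z‖ ≤ ‖v x‖ + dist (v z) (v x) := by
            rw [dist_eq_norm]; simpa using norm_add_le (v x) (v z - v x)
          have h3 := mul_le_mul_of_nonneg_left (Metric.mem_closedBall.1 hz) K.coe_nonneg
          push_cast at h3 ⊢
          linarith
        mul_max_le := by
          simp only [sub_zero, zero_sub, neg_neg, max_self]
          push_cast
          rw [mul_one_div, div_le_iff₀ (by positivity), sub_zero]
          have := mul_nonneg (norm_nonneg (v x)) (K.coe_nonneg)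
          nlinarith [norm_nonneg (v x)] }
    obtain ⟨γ, h0, hγ⟩ := hPL.exists_eq_forall_mem_Icc_hasDerivWithinAt₀
    refine ⟨γ, h0, fun t ht => ?_⟩
    have h1 := (hγ t (Ioo_subset_Icc_self ht)).hasDerivAt (Icc_mem_nhds ht.1 ht.2)
    exact ((hiff γ t).2 h1).hasMFDerivWithinAt
  obtain ⟨γ, h0, hγ⟩ := exists_isMIntegralCurve_of_isMIntegralCurveOn (I := 𝓘(ℝ, E)) (v := v)
    (contMDiff_vectorSpace_iff_contDiff.2 hv) hε hex y
  refine ⟨fun t => γ (t - t₀), by simpa using h0, fun t => ?_⟩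
  exact ((hiff γ _).1 (hγ (t - t₀))).comp_sub_const t t₀

/-- A vector field of class `C¹` on an open neighbourhood of a compact set agrees on that set with
a globally Lipschitz vector field of class `C¹`. -/
theorem exists_contDiff_lipschitzWith_eqOn {E F : Type*} [NormedAddCommGroup E] [NormedSpace ℝ E]
    [FiniteDimensional ℝ E] [NormedAddCommGroup F] [NormedSpace ℝ F] {g : E → F} {U S : Set E}
    (hU : IsOpen U) (hg : ContDiffOn ℝ 1 g U) (hS : IsCompact S) (hSU : S ⊆ U) :
    ∃ (g' : E → F) (K : ℝ≥0), ContDiff ℝ 1 g' ∧ LipschitzWith K g' ∧ EqOn g' g S := by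
  have : ProperSpace E := FiniteDimensional.proper ℝ E
  obtain ⟨L, hL, hSL, hLU⟩ := exists_compact_between hS hU hSU
  -- Multiplication by a cutoff that is 1 near `S` and vanishes off `L` gives a C¹ map of compact
  -- support, which is Lipschitz.
  obtain ⟨χ, h1, h0, -⟩ := exists_contMDiffMap_one_nhds_of_subset_interior 𝓘(ℝ, E) (n := 1)
    hS.isClosed hSL
  have hχ : ContDiff ℝ 1 χ := χ.contMDiff.contDiff
  have hsupp : Function.support (fun x => χ x • g x) ⊆ L := by
    intro x hx
    by_contra hxL
    exact hx (by simp [h0 x hxL])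
  have hc : ContDiff ℝ 1 fun x => χ x • g x := by
    rw [contDiff_iff_contDiffAt]
    intro x
    by_cases hx : x ∈ U
    · exact hχ.contDiffAt.smul (hg.contDiffAt (hU.mem_nhds hx))
    · have hx' : x ∈ Lᶜ := fun h => hx (hLU h)
      have : (fun x => χ x • g x) =ᶠ[𝓝 x] fun _ => 0 := by
        filter_upwards [hL.isClosed.isOpen_compl.mem_nhds hx'] with y hy
        simp [h0 y hy]
      exact contDiffAt_const.congr_of_eventuallyEq this
  obtain ⟨K, hK⟩ := hc.lipschitzWith_of_hasCompactSupport
    (HasCompactSupport.of_support_subset_isCompact hL hsupp) one_ne_zero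
  exact ⟨_, K, hc, hK, fun x hx => by simp [h1.self_of_nhdsSet x hx]⟩

namespace IsHybridSolution

variable {E : Type*} [NormedAddCommGroup E] [NormedSpace ℝ E] {F : E → E} {C : Set E} {G : E → E} {z₀ : E}
  {J : Set ℝ} {N : ℕ} {τ : ℕ → ℝ}
  {x : ℕ → ℝ → E}

theorem time_le_last (X : IsHybridSolution F C G z₀ J N τ x) {k : ℕ} (hk : k ≤ N) :
    τ k ≤ τ N := by
  induction hk using Nat.decreasingInduction with
  | self => exact le_rfl
  | of_succ k hk ih => exact (X.mono k hk).trans ih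

theorem time_nonneg (X : IsHybridSolution F C G z₀ J N τ x) {k : ℕ} (hk : k ≤ N) : 0 ≤ τ k := by
  induction k with
  | zero => exact X.start_time.ge
  | succ k ih => exact (ih (Nat.le_of_succ_le hk)).trans (X.mono k hk)

theorem time_mem (X : IsHybridSolution F C G z₀ J N τ x) {k : ℕ} (hk : k ≤ N) : τ k ∈ J :=
  X.ordConnected.out X.isLeast.1 X.mem ⟨X.time_nonneg hk, X.time_le_last hk⟩

theorem succ_time_mem_phase (X : IsHybridSolution F C G z₀ J N τ x) {k : ℕ} (hk : k < N) :
    τ (k + 1) ∈ phase J N τ k :=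
  ⟨X.time_mem hk, X.mono k hk, fun _ => le_rfl⟩

theorem Icc_subset_phase (X : IsHybridSolution F C G z₀ J N τ x) {k : ℕ} (hk : k ≤ N) {t : ℝ}
    (ht : t ∈ phase J N τ k) : Icc (τ k) t ⊆ phase J N τ k := fun _ hu =>
  ⟨X.ordConnected.out (X.time_mem hk) ht.1 hu, hu.1, fun h => hu.2.trans (ht.2.2 h)⟩

end IsHybridSolution

variable {E : Type*} [NormedAddCommGroup E] [InnerProductSpace ℝ E]
  {f : E → ℝ} {g : E → E} {U : Set E} {f₀ : ℝ} {xs : E} {h d η s T : ℝ} {z : ℝ → E × E}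

/-- The flow set of the heavy-ball system with restarts. -/
def hbFlowSet (f : E → ℝ) (U : Set E) (f₀ : ℝ) : Set (E × E) :=
  {z | z.1 ∈ U ∧ (f z.1 < f₀ ∨ fderiv ℝ f z.1 z.2 < 0)}

/-- The restart map. -/
def hbJump (g : E → E) (η : ℝ) (z : E × E) : E × E := (z.1, -(η • g z.1))

namespace Landscape

/-- Openness ensures that a trajectory which leaves the flow set has a first exit time, at which it
is already outside. It holds since f and ⟨g, p⟩ are continuous over `U`. -/
theorem isOpen_hbFlowSet (H : Landscape f g U f₀ xs h) : IsOpen (hbFlowSet f U f₀) := by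
  have hU : IsOpen {z : E × E | z.1 ∈ U} := H.isOpen.preimage continuous_fst
  have hm : MapsTo (fun z : E × E => z.1) {z : E × E | z.1 ∈ U} U := fun z hz => hz
  have h1 : ContinuousOn (fun z : E × E => f z.1) {z : E × E | z.1 ∈ U} :=
    H.continuousOn.comp continuous_fst.continuousOn hm
  have h2 : ContinuousOn (fun z : E × E => inner ℝ (g z.1) z.2) {z : E × E | z.1 ∈ U} :=
    (H.continuousOn_grad.comp continuous_fst.continuousOn hm).inner continuous_snd.continuousOn
  have h3 := (h1.isOpen_inter_preimage hU (isOpen_Iio (a := f₀))).union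
    (h2.isOpen_inter_preimage hU (isOpen_Iio (a := (0 : ℝ))))
  convert h3 using 1
  ext z
  simp only [hbFlowSet, mem_ofPred_eq, mem_union, mem_inter_iff, mem_preimage, mem_Iio]
  constructor
  · rintro ⟨hz, h⟩
    rw [(H.hasFDerivAt _ hz).fderiv, innerSL_apply_apply] at h
    tauto
  · intro hz
    have hzU : z.1 ∈ U := by tauto
    rw [(H.hasFDerivAt _ hzU).fderiv, innerSL_apply_apply]
    tauto

/-- A trajectory in the flow set that starts in the sublevel set stays there. -/
theorem mem_sublevel_of_mem_flowSet (H : Landscape f g U f₀ xs h)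
    (hz : ∀ t ∈ Icc s T, HasDerivWithinAt (fun t => (z t).1) (z t).2 (Icc s T) t)
    (hC : ∀ t ∈ Ico s T, z t ∈ hbFlowSet f U f₀) (hU : (z s).1 ∈ U) (hf : f (z s).1 ≤ f₀) :
    ∀ t ∈ Icc s T, (z t).1 ∈ U ∧ f (z t).1 ≤ f₀ := by
  have hlt : ∀ t ∈ Ico s T, (z t).1 ∈ U ∧ f (z t).1 ≤ f₀ := by
    intro t ht
    refine ⟨(hC t ht).1, le_of_forall_pos_le_add fun ε hε => ?_⟩
    have hd : ∀ u ∈ Icc s t, HasDerivWithinAt (fun u => f (z u).1)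
        (fderiv ℝ f (z u).1 (z u).2) (Icc s T) u := fun u hu => by
      have hu' : u ∈ Ico s T := ⟨hu.1, hu.2.trans_lt ht.2⟩
      have h1 := H.hasFDerivAt _ (hC u hu').1
      rw [h1.fderiv]
      exact h1.comp_hasDerivWithinAt u (hz u ⟨hu'.1, hu'.2.le⟩)
    -- At a contact with the level f₀ + ε the first alternative of the flow set is excluded, so the
    -- cost is strictly decreasing there.
    refine image_le_of_deriv_right_lt_deriv_boundary (f := fun u => f (z u).1) (a := s) (b := t)
      (f' := fun u => fderiv ℝ f (z u).1 (z u).2) (B := fun _ => f₀ + ε) (B' := fun _ => 0)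
      (fun u hu => ((hd u hu).mono (Icc_subset_Icc_right ht.2.le)).continuousWithinAt)
      (fun u hu => (hd u ⟨hu.1, hu.2.le⟩).mono_of_mem_nhdsWithin
        (Icc_mem_nhdsGE_of_mem ⟨hu.1, hu.2.trans ht.2⟩))
      (by linarith) (fun u => hasDerivAt_const _ _)
      (fun u hu hfu => ?_) ⟨ht.1, le_rfl⟩
    rcases (hC u ⟨hu.1, hu.2.trans ht.2⟩).2 with h1 | h1
    · linarith
    · exact h1
  intro t ht
  rcases eq_or_lt_of_le ht.2 with rfl | h2
  · rcases eq_or_lt_of_le ht.1 with rfl | h1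
    · exact ⟨hU, hf⟩
    -- The state may be outside the flow set at the final instant; there the claim follows from
    -- closedness of the sublevel set.
    · have hcl : t ∈ closure (Ico s t) := by
        rw [closure_Ico h1.ne]; exact ⟨h1.le, le_rfl⟩
      have hcont := (hz t ht).continuousWithinAt.mono Ico_subset_Icc_self
      have := hcont.mem_closure hcl (t := {x | x ∈ U ∧ f x ≤ f₀}) fun u hu => hlt u hu
      rwa [H.isCompact.isClosed.closure_eq] at this
  · exact hlt t ⟨ht.1, h2⟩

variable {J : Set ℝ} {N : ℕ} {τ : ℕ → ℝ} {x : ℕ → ℝ → E × E} {z₀ : E × E}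

theorem isHBFlow_of_isHybridSolution (H : Landscape f g U f₀ xs h)
    (X : IsHybridSolution (heavyBall g d) (hbFlowSet f U f₀) (hbJump g η) z₀ J N τ x)
    {k : ℕ} (hk : k ≤ N) (hU : (x k (τ k)).1 ∈ U) (hf : f (x k (τ k)).1 ≤ f₀) {t : ℝ}
    (ht : t ∈ phase J N τ k) : IsHBFlow f g U f₀ d (τ k) t (x k) := by
  have hsub := X.Icc_subset_phase hk ht
  have hd : ∀ u ∈ Icc (τ k) t,
      HasDerivWithinAt (x k) (heavyBall g d (x k u)) (Icc (τ k) t) u := fun u hu =>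
    (X.flow k hk u (hsub hu)).mono hsub
  exact ⟨hd, H.mem_sublevel_of_mem_flowSet (fun u hu => (hd u hu).pair_fst)
    (fun u hu => X.mem_flowSet k hk u (hsub ⟨hu.1, hu.2.le⟩) t ht hu.2) hU hf⟩

/-- A jump does not move the position, so the sublevel condition passes from the end of one phase to
the start of the next. -/
theorem phase_start_mem (H : Landscape f g U f₀ xs h)
    (X : IsHybridSolution (heavyBall g d) (hbFlowSet f U f₀) (hbJump g η) z₀ J N τ x)
    (hU : z₀.1 ∈ U) (hf : f z₀.1 ≤ f₀) {k : ℕ} (hk : k ≤ N) :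
    (x k (τ k)).1 ∈ U ∧ f (x k (τ k)).1 ≤ f₀ := by
  induction k with
  | zero => rw [X.start_time, X.start]; exact ⟨hU, hf⟩
  | succ k ih =>
    obtain ⟨h1, h2⟩ := ih (Nat.le_of_succ_le hk)
    rw [X.jump k hk]
    exact (H.isHBFlow_of_isHybridSolution X (Nat.le_of_succ_le hk) h1 h2
      (X.succ_time_mem_phase hk)).mem _ ⟨X.mono k hk, le_rfl⟩

/-- Exponential decay along all hybrid solutions with a bounded number of jumps. -/
theorem exists_hybrid_decay (H : Landscape f g U f₀ xs h) (hd : 0 < d) (hη : 0 ≤ η) {c : ℝ}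
    (hc : 0 ≤ c) (hcd : 2 * c < d) (hch : 3 * d * c < h) (S : ℕ) :
    ∃ A, 0 < A ∧ ∀ (z₀ : E × E) (J : Set ℝ) (N : ℕ) (τ : ℕ → ℝ) (x : ℕ → ℝ → E × E),
      z₀.1 ∈ U → f z₀.1 ≤ f₀ → N ≤ S →
      IsHybridSolution (heavyBall g d) (hbFlowSet f U f₀) (hbJump g η) z₀ J N τ x →
      ∀ k ≤ N, ∀ t ∈ phase J N τ k,
        pairNorm (x k t - (xs, 0)) ≤ A * pairNorm (z₀ - (xs, 0)) * Real.exp (-(c * t)) := by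
  have hh : 0 ≤ h := by
    have : 0 ≤ 3 * d * c := by positivity
    linarith
  obtain ⟨C, hC, hdecay⟩ := H.exists_decay hd hc hcd hch
  obtain ⟨C₁, hC₁, hup⟩ := H.exists_upper_bounds hh
  -- One phase costs the factor `C`. One jump costs 1 + ηC₁, because the new momentum is η times a
  -- gradient bounded by C₁‖q‖.
  set B : ℝ := C * (1 + η * C₁) with hB
  have hB1 : 1 ≤ B := by
    have := mul_nonneg hη hC₁.le
    nlinarith
  refine ⟨B ^ S * C, by positivity, fun z₀ J N τ x hU hf hN X => ?_⟩
  have hy := pairNorm_nonneg (z₀ - (xs, 0))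
  have hflow : ∀ k ≤ N, ∀ t ∈ phase J N τ k, IsHBFlow f g U f₀ d (τ k) t (x k) := fun k hk t ht =>
    have h1 := H.phase_start_mem X hU hf hk
    H.isHBFlow_of_isHybridSolution X hk h1.1 h1.2 ht
  have hstep : ∀ k ≤ N, ∀ b, pairNorm (x k (τ k) - (xs, 0)) ≤ b * Real.exp (-(c * τ k)) →
      ∀ t ∈ phase J N τ k, pairNorm (x k t - (xs, 0)) ≤ C * b * Real.exp (-(c * t)) := by
    intro k hk b hb t ht
    have h1 := hdecay (τ k) t (x k) (hflow k hk t ht) ht.2.1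
    have h2 : Real.exp (-(c * t)) = Real.exp (-(c * τ k)) * Real.exp (-(c * (t - τ k))) := by
      rw [← Real.exp_add]; ring_nf
    refine h1.trans ?_
    rw [h2, ← mul_assoc, mul_assoc C b]
    gcongr
  have hstart : ∀ k ≤ N, pairNorm (x k (τ k) - (xs, 0)) ≤
      B ^ k * pairNorm (z₀ - (xs, 0)) * Real.exp (-(c * τ k)) := by
    intro k
    induction k with
    | zero => intro _; rw [X.start_time, X.start]; simp
    | succ k ih =>
      intro hk
      have hk' : k ≤ N := Nat.le_of_succ_le hk
      have h1 := hstep k hk' _ (ih hk') _ (X.succ_time_mem_phase hk)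
      have h2 := (hflow k hk' _ (X.succ_time_mem_phase hk)).mem _ ⟨X.mono k hk, le_rfl⟩
      have h3 := (hup _ h2.1 h2.2).1
      rw [X.jump k hk]
      set y := x k (τ (k + 1)) with hy
      have h4 : pairNorm (hbJump g η y - (xs, 0)) ≤ (1 + η * C₁) * pairNorm (y - (xs, 0)) := by
        refine (pairNorm_sub_le_add _ _).trans ?_
        have h5 := norm_fst_sub_le_pairNorm y xs
        simp only [hbJump, norm_neg, norm_smul, Real.norm_of_nonneg hη]
        have h6 := mul_le_mul_of_nonneg_left (h3.trans (mul_le_mul_of_nonneg_left h5 hC₁.le)) hη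
        linarith
      refine h4.trans ?_
      have h5 := mul_le_mul_of_nonneg_left h1 (by positivity : 0 ≤ 1 + η * C₁)
      refine h5.trans (le_of_eq ?_)
      rw [hB]; ring
  intro k hk t ht
  have h1 := hstep k hk _ (hstart k hk) t ht
  refine h1.trans ?_
  have h2 : B ^ k ≤ B ^ S := pow_le_pow_right₀ hB1 (hk.trans hN)
  have h3 : C * (B ^ k * pairNorm (z₀ - (xs, 0))) ≤ B ^ S * C * pairNorm (z₀ - (xs, 0)) := by
    rw [mul_comm (B ^ S) C, mul_assoc]; gcongr
  exact mul_le_mul_of_nonneg_right h3 (Real.exp_pos _).le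

end Landscape
end

/-! ### Construction of hybrid solutions -/

noncomputable section

open Filter Topology InnerProductSpace
open scoped Manifold ContDiff NNReal

/-- The first `N` phases and jumps of a hybrid solution. -/
structure IsJumpChain {E : Type*} [NormedAddCommGroup E] [NormedSpace ℝ E]
    (F : E → E) (C : Set E) (G : E → E) (z₀ : E) (N : ℕ) (τ : ℕ → ℝ) (x : ℕ → ℝ → E) : Prop where
  start_time : τ 0 = 0
  start : x 0 0 = z₀
  mono : ∀ k < N, τ k ≤ τ (k + 1)
  flow : ∀ k < N, ∀ t ∈ Icc (τ k) (τ (k + 1)),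
    HasDerivWithinAt (x k) (F (x k t)) (Icc (τ k) (τ (k + 1))) t
  mem_flowSet : ∀ k < N, ∀ t ∈ Ico (τ k) (τ (k + 1)), x k t ∈ C
  exit : ∀ k < N, x k (τ (k + 1)) ∉ C
  jump : ∀ k < N, x (k + 1) (τ (k + 1)) = G (x k (τ (k + 1)))

namespace IsJumpChain

variable {E : Type*} [NormedAddCommGroup E] [NormedSpace ℝ E]
  {F : E → E} {C : Set E} {G : E → E} {z₀ : E} {N : ℕ} {τ : ℕ → ℝ} {x : ℕ → ℝ → E}

theorem time_le_last (X : IsJumpChain F C G z₀ N τ x) {k : ℕ} (hk : k ≤ N) : τ k ≤ τ N := by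
  induction hk using Nat.decreasingInduction with
  | self => exact le_rfl
  | of_succ k hk ih => exact (X.mono k hk).trans ih

theorem time_nonneg (X : IsJumpChain F C G z₀ N τ x) {k : ℕ} (hk : k ≤ N) : 0 ≤ τ k := by
  rw [← X.start_time]
  induction k with
  | zero => exact le_rfl
  | succ k ih => exact (ih (Nat.le_of_succ_le hk)).trans (X.mono k hk)

/-- A chain of jumps followed by a last phase is a hybrid solution. -/
theorem isHybridSolution (X : IsJumpChain F C G z₀ N τ x) {J : Set ℝ} (hJ : J.OrdConnected)
    (h0 : IsLeast J 0) (hN : τ N ∈ J)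
    (hflow : ∀ t ∈ J ∩ Ici (τ N), HasDerivWithinAt (x N) (F (x N t)) (J ∩ Ici (τ N)) t)
    (hmem : ∀ t ∈ J ∩ Ici (τ N), ∀ s ∈ J ∩ Ici (τ N), t < s → x N t ∈ C) :
    IsHybridSolution F C G z₀ J N τ x := by
  have hlast : phase J N τ N = J ∩ Ici (τ N) := by
    ext t; simp [phase]
  have hphase : ∀ k < N, phase J N τ k = Icc (τ k) (τ (k + 1)) := fun k hk => by
    ext t
    refine ⟨fun ht => ⟨ht.2.1, ht.2.2 hk⟩, fun ht => ⟨hJ.out h0.1 hN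
      ⟨(X.time_nonneg hk.le).trans ht.1, ht.2.trans (X.time_le_last hk)⟩, ht.1, fun _ => ht.2⟩⟩
  refine ⟨hJ, h0, X.start_time, X.mono, hN, X.start, fun k hk => ?_, fun k hk => ?_, X.exit,
    X.jump⟩
  · rcases hk.eq_or_lt with rfl | hk
    · rw [hlast]; exact hflow
    · rw [hphase k hk]; exact X.flow k hk
  · rcases hk.eq_or_lt with rfl | hk
    · rw [hlast]; exact hmem
    · rw [hphase k hk]
      exact fun t ht s hs hts => X.mem_flowSet k hk t ⟨ht.1, hts.trans_le hs.2⟩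

/-- The last phase of a chain may be reduced to its initial point. -/
theorem isHybridSolution_Icc (X : IsJumpChain F C G z₀ N τ x) :
    IsHybridSolution F C G z₀ (Icc 0 (τ N)) N τ x := by
  have hN := X.time_nonneg le_rfl
  have hpt : Icc 0 (τ N) ∩ Ici (τ N) = {τ N} := by
    ext t
    simp only [mem_inter_iff, mem_Icc, mem_Ici, mem_singleton_iff]
    exact ⟨fun h => le_antisymm h.1.2 h.2, fun h => by subst h; exact ⟨⟨hN, le_rfl⟩, le_rfl⟩⟩
  refine X.isHybridSolution ordConnected_Icc ⟨⟨le_rfl, hN⟩, fun t ht => ht.1⟩ ⟨hN, le_rfl⟩ ?_ ?_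
  · rw [hpt]
    intro t _
    exact HasFDerivWithinAt.of_subsingleton subsingleton_singleton
  · rw [hpt]
    rintro t rfl s rfl hts
    exact (lt_irrefl _ hts).elim

/-- The trajectory after the last jump of a chain may be replaced. -/
theorem update_last (X : IsJumpChain F C G z₀ N τ x) {w : ℝ → E} (hw : w (τ N) = x N (τ N)) :
    IsJumpChain F C G z₀ N τ (Function.update x N w) := by
  have hx : ∀ k < N, Function.update x N w k = x k := fun k hk =>
    Function.update_of_ne hk.ne _ _
  have hx' : ∀ k ≤ N, Function.update x N w k (τ k) = x k (τ k) := fun k hk => by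
    rcases hk.eq_or_lt with rfl | hk
    · simp [hw]
    · rw [hx k hk]
  refine ⟨X.start_time, ?_, X.mono, fun k hk => ?_, fun k hk => ?_, fun k hk => ?_, fun k hk => ?_⟩
  · have := hx' 0 (Nat.zero_le _)
    rwa [X.start_time, X.start] at this
  · rw [hx k hk]; exact X.flow k hk
  · rw [hx k hk]; exact X.mem_flowSet k hk
  · rw [hx k hk]; exact X.exit k hk
  · rw [hx k hk, hx' (k + 1) hk]; exact X.jump k hk

/-- A chain of jumps may be continued by a phase that leaves the flow set, and a jump. -/
theorem exists_succ (X : IsJumpChain F C G z₀ N τ x) {T : ℝ} (hT : τ N ≤ T)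
    (hflow : ∀ t ∈ Icc (τ N) T, HasDerivWithinAt (x N) (F (x N t)) (Icc (τ N) T) t)
    (hmem : ∀ t ∈ Ico (τ N) T, x N t ∈ C) (hexit : x N T ∉ C) :
    ∃ (τ' : ℕ → ℝ) (x' : ℕ → ℝ → E), IsJumpChain F C G z₀ (N + 1) τ' x' ∧
      τ' (N + 1) = T ∧ x' (N + 1) T = G (x N T) := by
  set τ' := Function.update τ (N + 1) T with hτ'
  set x' : ℕ → ℝ → E := Function.update x (N + 1) fun _ => G (x N T) with hx'
  have hτ : ∀ k ≤ N, τ' k = τ k := fun k hk => Function.update_of_ne (by omega) _ _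
  have hx : ∀ k ≤ N, x' k = x k := fun k hk => Function.update_of_ne (by omega) _ _
  have hτN : τ' (N + 1) = T := Function.update_self _ _ _
  have hxN : x' (N + 1) = fun _ => G (x N T) := Function.update_self _ _ _
  have key : ∀ k < N + 1, (k < N ∧ τ' k = τ k ∧ τ' (k + 1) = τ (k + 1) ∧ x' k = x k ∧
      x' (k + 1) = x (k + 1)) ∨ (τ' k = τ N ∧ τ' (k + 1) = T ∧ x' k = x N ∧
      x' (k + 1) = fun _ => G (x N T)) := fun k hk => by
    rcases (Nat.le_of_lt_succ hk).eq_or_lt with rfl | hk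
    · exact .inr ⟨hτ _ le_rfl, hτN, hx _ le_rfl, hxN⟩
    · exact .inl ⟨hk, hτ _ hk.le, hτ _ hk, hx _ hk.le, hx _ hk⟩
  refine ⟨τ', x', ⟨?_, ?_, fun k hk => ?_, fun k hk => ?_, fun k hk => ?_, fun k hk => ?_,
    fun k hk => ?_⟩, hτN, by rw [hxN]⟩
  · rw [hτ 0 (Nat.zero_le _), X.start_time]
  · rw [hx 0 (Nat.zero_le _), X.start]
  all_goals rcases key k hk with ⟨hk, h1, h2, h3, h4⟩ | ⟨h1, h2, h3, h4⟩
  · rw [h1, h2]; exact X.mono k hk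
  · rwa [h1, h2]
  · rw [h1, h2, h3]; exact X.flow k hk
  · rw [h1, h2, h3]; exact hflow
  · rw [h1, h2, h3]; exact X.mem_flowSet k hk
  · rw [h1, h2, h3]; exact hmem
  · rw [h2, h3]; exact X.exit k hk
  · rwa [h2, h3]
  · rw [h2, h3, h4]; exact X.jump k hk
  · rw [h2, h3, h4]

end IsJumpChain

namespace Landscape

variable {E : Type*} [NormedAddCommGroup E] [InnerProductSpace ℝ E] [FiniteDimensional ℝ E]
  {f : E → ℝ} {g : E → E} {U : Set E} {f₀ : ℝ} {xs : E} {h d η : ℝ}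

/-- From every point over the sublevel set there is a trajectory that solves the heavy-ball system
for all times, or until it leaves the flow set. -/
theorem exists_flow (H : Landscape f g U f₀ xs h) (d t₀ : ℝ) (y : E × E) (hU : y.1 ∈ U)
    (hf : f y.1 ≤ f₀) :
    ∃ w : ℝ → E × E, w t₀ = y ∧
      ((∀ t, t₀ ≤ t → HasDerivAt w (heavyBall g d (w t)) t ∧ w t ∈ hbFlowSet f U f₀) ∨
      ∃ T, t₀ ≤ T ∧ (∀ t ∈ Icc t₀ T, HasDerivAt w (heavyBall g d (w t)) t) ∧
        (∀ t ∈ Ico t₀ T, w t ∈ hbFlowSet f U f₀) ∧ w T ∉ hbFlowSet f U f₀ ∧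
        (w T).1 ∈ U ∧ f (w T).1 ≤ f₀) := by
  have : CompleteSpace E := FiniteDimensional.complete ℝ E
  -- The modified field is complete and agrees with the true one over the sublevel set, which the
  -- trajectory does not leave before its first exit from the flow set.
  obtain ⟨g', K, hg', hK, heq⟩ := exists_contDiff_lipschitzWith_eqOn H.isOpen H.contDiffOn
    H.isCompact fun x hx => hx.1
  have hv : ContDiff ℝ 1 (heavyBall g' d) := by
    unfold heavyBall
    fun_prop
  have hLip : ∃ K', LipschitzWith K' (heavyBall g' d) := by
    refine ⟨_, LipschitzWith.prodMk LipschitzWith.prod_snd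
      ((hK.comp LipschitzWith.prod_fst).neg.sub ((lipschitzWith_smul (2 * d)).comp
        LipschitzWith.prod_snd))⟩
  obtain ⟨K', hK'⟩ := hLip
  obtain ⟨w, hw0, hw⟩ := exists_hasDerivAt_of_lipschitzWith hv hK' t₀ y
  have hcont : Continuous w := continuous_iff_continuousAt.2 fun t => (hw t).continuousAt
  have hstay : ∀ T, (∀ t ∈ Ico t₀ T, w t ∈ hbFlowSet f U f₀) → ∀ t ∈ Icc t₀ T,
      (w t).1 ∈ U ∧ f (w t).1 ≤ f₀ := fun T hT =>
    H.mem_sublevel_of_mem_flowSet (fun t _ => ((hw t).hasDerivWithinAt (s := Icc t₀ T)).pair_fst) hT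
      (by rwa [hw0]) (by rwa [hw0])
  have htrue : ∀ t, ((w t).1 ∈ U ∧ f (w t).1 ≤ f₀) → HasDerivAt w (heavyBall g d (w t)) t := by
    intro t ht
    have h1 : heavyBall g' d (w t) = heavyBall g d (w t) := by
      simp only [heavyBall]; rw [heq ht]
    exact h1 ▸ hw t
  refine ⟨w, hw0, ?_⟩
  set B : Set ℝ := Ici t₀ ∩ w ⁻¹' (hbFlowSet f U f₀)ᶜ with hB
  have hBcl : IsClosed B :=
    isClosed_Ici.inter (H.isOpen_hbFlowSet.isClosed_compl.preimage hcont)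
  have hBb : BddBelow B := ⟨t₀, fun t ht => ht.1⟩
  rcases B.eq_empty_or_nonempty with hemp | hne
  · have hall : ∀ t, t₀ ≤ t → w t ∈ hbFlowSet f U f₀ := fun t ht => by
      by_contra hcon
      have : t ∈ B := ⟨ht, hcon⟩
      rw [hemp] at this
      exact this
    exact .inl fun t ht => ⟨htrue t (hstay t (fun u hu => hall u hu.1) t ⟨ht, le_rfl⟩), hall t ht⟩
  · have hT := hBcl.csInf_mem hne hBb
    have hbefore : ∀ t ∈ Ico t₀ (sInf B), w t ∈ hbFlowSet f U f₀ := fun t ht => by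
      by_contra hcon
      exact absurd (csInf_le hBb (⟨ht.1, hcon⟩ : t ∈ B)) (not_le.2 ht.2)
    have hS := hstay _ hbefore
    exact .inr ⟨sInf B, hT.1, fun t ht => htrue t (hS t ht), hbefore, hT.2, hS _ ⟨hT.1, le_rfl⟩⟩

/-- If the number of jumps is bounded, then the hybrid system has a solution for all times. -/
theorem exists_isHybridSolution (H : Landscape f g U f₀ xs h) {z₀ : E × E} (hU : z₀.1 ∈ U)
    (hf : f z₀.1 ≤ f₀) {S : ℕ}
    (hS : ∀ J N τ x, IsHybridSolution (heavyBall g d) (hbFlowSet f U f₀) (hbJump g η) z₀ J N τ x →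
      N ≤ S) :
    ∃ N τ x, IsHybridSolution (heavyBall g d) (hbFlowSet f U f₀) (hbJump g η) z₀ (Ici 0) N τ x := by
  by_contra hno
  -- If no phase lasts forever, each one ends in a jump and chains of every length exist, contrary
  -- to the bound `S`.
  have key : ∀ N : ℕ, ∃ (τ : ℕ → ℝ) (x : ℕ → ℝ → E × E),
      IsJumpChain (heavyBall g d) (hbFlowSet f U f₀) (hbJump g η) z₀ N τ x ∧
        (x N (τ N)).1 ∈ U ∧ f (x N (τ N)).1 ≤ f₀ := by
    intro N
    induction N with
    | zero =>
      exact ⟨fun _ => 0, fun _ _ => z₀, ⟨rfl, rfl, by simp, by simp, by simp, by simp, by simp⟩,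
        hU, hf⟩
    | succ N ih =>
      obtain ⟨τ, x, X, hxU, hxf⟩ := ih
      obtain ⟨w, hw0, hw⟩ := H.exists_flow d (τ N) (x N (τ N)) hxU hxf
      have X' := X.update_last hw0
      have hself : Function.update x N w N = w := Function.update_self _ _ _
      rcases hw with hw | ⟨T, hT, hder, hmem, hexit, hTU, hTf⟩
      · refine (hno ⟨N, τ, _, X'.isHybridSolution ordConnected_Ici isLeast_Ici
          (X.time_nonneg le_rfl) ?_ ?_⟩).elim
        · rw [hself]; exact fun t ht => (hw t ht.2).1.hasDerivWithinAt
        · rw [hself]; exact fun t ht s _ _ => (hw t ht.2).2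
      · obtain ⟨τ', x', X'', hτ', hx'⟩ := X'.exists_succ hT
          (by rw [hself]; exact fun t ht => (hder t ht).hasDerivWithinAt)
          (by rw [hself]; exact hmem) (by rw [hself]; exact hexit)
        refine ⟨τ', x', X'', ?_⟩
        rw [hτ', hx', hself]
        exact ⟨hTU, hTf⟩
  obtain ⟨τ, x, X, -⟩ := key (S + 1)
  exact absurd (hS _ _ _ _ X.isHybridSolution_Icc) (by omega)

end Landscape

/-- A point outside of the flow set whose iterates under the jump map stay outside of the flow set
admits arbitrarily many jumps. -/
theorem exists_isHybridSolution_of_iterate_notMem {E : Type*} [NormedAddCommGroup E]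
    [NormedSpace ℝ E] {F : E → E} {C : Set E} {G : E → E} {z₀ : E}
    (hz : ∀ k : ℕ, G^[k] z₀ ∉ C) (N : ℕ) :
    ∃ J τ x, IsHybridSolution F C G z₀ J N τ x := by
  -- All jumps take place at time 0, and every phase is a single instant.
  have X : IsJumpChain F C G z₀ N (fun _ => 0) (fun k _ => G^[k] z₀) := by
    refine ⟨rfl, rfl, fun _ _ => le_rfl, fun k _ t _ => ?_, fun k _ t ht => ?_, fun k _ => hz k,
      fun k _ => Function.iterate_succ_apply' G k z₀⟩
    · rw [Icc_self]
      exact HasFDerivWithinAt.of_subsingleton subsingleton_singleton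
    · exact absurd (ht.1.trans_lt ht.2) (lt_irrefl _)
  exact ⟨_, _, _, X.isHybridSolution_Icc⟩
end

/-! ### Trace and eigenvalue inequalities -/

noncomputable section

open Filter Topology InnerProductSpace
open scoped Manifold ContDiff NNReal

section MatrixInequalities

variable {m n : ℕ}

theorem frobenius_norm_sq (X : Matrix (Fin m) (Fin n) ℝ) : ‖X‖ ^ 2 = ∑ i, ∑ j, X i j * X i j := by
  rw [Matrix.frobenius_norm_def, ← Real.sqrt_eq_rpow, Real.sq_sqrt (by positivity)]
  refine Finset.sum_congr rfl fun i _ => Finset.sum_congr rfl fun j _ => ?_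
  rw [Real.norm_eq_abs, Real.rpow_two, sq_abs, sq]

theorem frobenius_norm_sq_eq_trace (X : Matrix (Fin m) (Fin n) ℝ) : ‖X‖ ^ 2 = (Xᵀ * X).trace := by
  rw [frobenius_norm_sq, Matrix.trace, Finset.sum_comm]
  simp [Matrix.mul_apply]

theorem Matrix.PosSemidef.exists_gram {X : Matrix (Fin n) (Fin n) ℝ} (hX : X.PosSemidef) :
    ∃ S : Matrix (Fin n) (Fin n) ℝ, X = Sᵀ * S := by
  open scoped MatrixOrder in
  obtain ⟨S, hS⟩ := CStarAlgebra.nonneg_iff_eq_star_mul_self.1 hX.nonneg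
  exact ⟨S, by rw [hS, Matrix.star_eq_conjTranspose, Matrix.conjTranspose_eq_transpose_of_trivial]⟩

/-- With X = SᵀS, the trace of X M is the sum of the quadratic form of M over the rows of S; no
symmetry of M is required. -/
theorem Matrix.PosSemidef.mul_trace_le {X M : Matrix (Fin n) (Fin n) ℝ} (hX : X.PosSemidef) {c : ℝ}
    (hM : ∀ x : Fin n → ℝ, c * (x ⬝ᵥ x) ≤ x ⬝ᵥ (M *ᵥ x)) : c * X.trace ≤ (X * M).trace := by
  obtain ⟨S, rfl⟩ := hX.exists_gram
  have h1 : (Sᵀ * S * M).trace = ∑ i, (S i) ⬝ᵥ (M *ᵥ (S i)) := by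
    rw [Matrix.mul_assoc, Matrix.trace_mul_comm, Matrix.trace]
    refine Finset.sum_congr rfl fun i _ => ?_
    rw [Matrix.diag_apply, Matrix.mul_assoc]
    simp only [Matrix.mul_apply, dotProduct, Matrix.mulVec, Matrix.transpose_apply]
  have h2 : (Sᵀ * S).trace = ∑ i, (S i) ⬝ᵥ (S i) := by
    rw [Matrix.trace_mul_comm]; rfl
  rw [h1, h2, Finset.mul_sum]
  exact Finset.sum_le_sum fun i _ => hM _

theorem Matrix.PosSemidef.norm_le_trace {X : Matrix (Fin n) (Fin n) ℝ} (hX : X.PosSemidef) :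
    ‖X‖ ≤ X.trace := by
  obtain ⟨S, rfl⟩ := hX.exists_gram
  rw [← frobenius_norm_sq_eq_trace, sq]
  exact (Matrix.frobenius_norm_mul _ _).trans_eq (by rw [Matrix.frobenius_norm_transpose])

/-- Cauchy–Schwarz over pairs of indices, for D and the rank-one matrix x xᵀ. -/
theorem abs_dotProduct_mulVec_le (D : Matrix (Fin n) (Fin n) ℝ) (x : Fin n → ℝ) :
    |x ⬝ᵥ (D *ᵥ x)| ≤ ‖D‖ * (x ⬝ᵥ x) := by
  have hx : 0 ≤ x ⬝ᵥ x := by simpa using dotProduct_star_self_nonneg x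
  refine abs_le_of_sq_le_sq ?_ (by positivity)
  have h1 : x ⬝ᵥ (D *ᵥ x) = ∑ p : Fin n × Fin n, D p.1 p.2 * (x p.1 * x p.2) := by
    rw [Fintype.sum_prod_type]
    simp only [dotProduct, Matrix.mulVec, Finset.mul_sum]
    exact Finset.sum_congr rfl fun i _ => Finset.sum_congr rfl fun j _ => by ring
  have h2 : (x ⬝ᵥ x) ^ 2 = ∑ p : Fin n × Fin n, (x p.1 * x p.2) ^ 2 := by
    rw [Fintype.sum_prod_type, sq, dotProduct, Finset.sum_mul_sum]
    exact Finset.sum_congr rfl fun i _ => Finset.sum_congr rfl fun j _ => by ring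
  have h3 : ‖D‖ ^ 2 = ∑ p : Fin n × Fin n, (D p.1 p.2) ^ 2 := by
    rw [Fintype.sum_prod_type, frobenius_norm_sq]
    exact Finset.sum_congr rfl fun i _ => Finset.sum_congr rfl fun j _ => by ring
  rw [mul_pow, h1, h2, h3]
  exact Finset.sum_mul_sq_le_sq_mul_sq _ _ _

theorem finite_spectrum_of_isHermitian {S : Matrix (Fin n) (Fin n) ℝ} (hS : S.IsHermitian) :
    (spectrum ℝ S).Finite := by
  rw [hS.spectrum_real_eq_range_eigenvalues]; exact finite_range _

theorem lamMin_mul_le {S : Matrix (Fin n) (Fin n) ℝ} (hS : S.IsHermitian) (x : Fin n → ℝ) :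
    lamMin S * (x ⬝ᵥ x) ≤ x ⬝ᵥ (S *ᵥ x) := by
  have h1 : (S - algebraMap ℝ _ (lamMin S)).PosSemidef := by
    refine Matrix.posSemidef_iff_isHermitian_and_spectrum_nonneg.2 ⟨?_, fun z hz => ?_⟩
    · rw [Algebra.algebraMap_eq_smul_one]
      exact hS.sub (by simp [Matrix.IsHermitian])
    · have : z + lamMin S ∈ spectrum ℝ S := by
        have := spectrum.add_mem_add_iff (R := ℝ) (a := S - algebraMap ℝ _ (lamMin S)) (r := z)
          (s := lamMin S)
        rw [← this] at hz
        simpa using hz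
      have := csInf_le (finite_spectrum_of_isHermitian hS).bddBelow this
      show 0 ≤ z
      unfold lamMin at this
      linarith
  have h2 := h1.dotProduct_mulVec_nonneg x
  rw [Algebra.algebraMap_eq_smul_one, star_trivial, Matrix.sub_mulVec, dotProduct_sub,
    Matrix.smul_mulVec, Matrix.one_mulVec, dotProduct_smul, smul_eq_mul] at h2
  linarith

theorem lamMin_mem_spectrum (hn : 0 < n) {S : Matrix (Fin n) (Fin n) ℝ} (hS : S.IsHermitian) :
    lamMin S ∈ spectrum ℝ S := by
  refine (finite_spectrum_of_isHermitian hS).isClosed.csInf_mem ?_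
    (finite_spectrum_of_isHermitian hS).bddBelow
  rw [hS.spectrum_real_eq_range_eigenvalues]
  exact ⟨_, ⟨0, hn⟩, rfl⟩

theorem lamMin_pos (hn : 0 < n) {S : Matrix (Fin n) (Fin n) ℝ} (hS : S.PosDef) : 0 < lamMin S := by
  have := lamMin_mem_spectrum hn hS.isHermitian
  rw [hS.isHermitian.spectrum_real_eq_range_eigenvalues] at this
  obtain ⟨i, hi⟩ := this
  rw [← hi]
  exact hS.eigenvalues_pos i

theorem dotProduct_self_eq_norm_sq (x : Fin n → ℝ) : x ⬝ᵥ x = ‖WithLp.toLp 2 x‖ ^ 2 := by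
  rw [EuclideanSpace.norm_sq_eq]
  simp [dotProduct, sq]

theorem dotProduct_le_norm_mul_norm (x y : Fin n → ℝ) :
    |x ⬝ᵥ y| ≤ ‖WithLp.toLp 2 x‖ * ‖WithLp.toLp 2 y‖ := by
  have := abs_real_inner_le_norm (WithLp.toLp 2 y) (WithLp.toLp 2 x)
  rw [EuclideanSpace.inner_toLp_toLp, mul_comm] at this
  simpa using this

theorem specNorm_nonneg (M : Matrix (Fin m) (Fin n) ℝ) : 0 ≤ specNorm M := norm_nonneg _

theorem norm_mulVec_le (M : Matrix (Fin m) (Fin n) ℝ) (x : Fin n → ℝ) :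
    ‖WithLp.toLp 2 (M *ᵥ x)‖ ≤ specNorm M * ‖WithLp.toLp 2 x‖ := by
  have := (LinearMap.toContinuousLinearMap (Matrix.toEuclideanLin M)).le_opNorm (WithLp.toLp 2 x)
  simpa [specNorm] using this

theorem norm_mulVec_le_frobenius (M : Matrix (Fin m) (Fin n) ℝ) (x : Fin n → ℝ) :
    ‖WithLp.toLp 2 (M *ᵥ x)‖ ≤ ‖M‖ * ‖WithLp.toLp 2 x‖ := by
  refine le_of_sq_le_sq ?_ (by positivity)
  rw [mul_pow, ← dotProduct_self_eq_norm_sq, ← dotProduct_self_eq_norm_sq, frobenius_norm_sq,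
    Finset.sum_mul, dotProduct]
  refine Finset.sum_le_sum fun i _ => ?_
  have := Finset.sum_mul_sq_le_sq_mul_sq Finset.univ (fun j => M i j) x
  simp only [Matrix.mulVec, dotProduct]
  simpa only [sq] using this

end MatrixInequalities
end

/-! ### Decay of the exponential of a Hurwitz matrix -/

noncomputable section

open Filter Topology InnerProductSpace
open scoped Manifold ContDiff NNReal

attribute [local instance] Matrix.frobeniusNormedRing
attribute [local instance] Matrix.frobeniusNormedAlgebra

section Stability

variable {m n : ℕ}

/-- All complex eigenvalues have negative real part. -/
def IsHurwitz (M : Matrix (Fin n) (Fin n) ℝ) : Prop :=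
  ∀ z ∈ spectrum ℂ (M.map (fun r : ℝ => (r : ℂ))), z.re < 0

theorem tendsto_pow_mul_cexp {z : ℂ} (hz : z.re < 0) (j : ℕ) :
    Tendsto (fun t : ℝ => (t : ℂ) ^ j * Complex.exp (t * z)) atTop (𝓝 0) := by
  rw [tendsto_zero_iff_norm_tendsto_zero]
  have h := tendsto_rpow_mul_exp_neg_mul_atTop_nhds_zero j (-z.re) (by linarith)
  refine h.congr' ?_
  filter_upwards [eventually_ge_atTop 0] with t ht
  rw [norm_mul, norm_pow, Complex.norm_exp, Complex.norm_real, Real.norm_of_nonneg ht,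
    Real.rpow_natCast]
  congr 2
  simp; ring

/-- The exponential series terminates on `v`. On a generalized eigenvector this leaves a polynomial
in t times a scalar exponential. -/
theorem exp_mulVec_of_pow_mulVec_eq_zero {N : Matrix (Fin n) (Fin n) ℂ} {v : Fin n → ℂ} {k : ℕ}
    (hk : (N ^ k) *ᵥ v = 0) (t : ℂ) :
    NormedSpace.exp (t • N) *ᵥ v =
      ∑ j ∈ Finset.range k, (t ^ j * (j.factorial : ℂ)⁻¹) • ((N ^ j) *ᵥ v) := by
  have h1 := NormedSpace.exp_series_hasSum_exp' (𝕂 := ℂ) (t • N)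
  let φ : Matrix (Fin n) (Fin n) ℂ →ₗ[ℂ] (Fin n → ℂ) :=
    { toFun := fun M => M *ᵥ v
      map_add' := fun A B => Matrix.add_mulVec A B v
      map_smul' := fun c A => Matrix.smul_mulVec c A v }
  have hφ : Continuous φ := φ.continuous_of_finiteDimensional
  have h2 := h1.map φ hφ
  have h3 : ∀ j, (φ ∘ fun j : ℕ => ((j.factorial : ℂ))⁻¹ • (t • N) ^ j) j =
      (t ^ j * (j.factorial : ℂ)⁻¹) • ((N ^ j) *ᵥ v) := fun j => by
    rw [Function.comp_apply, smul_pow, smul_smul, map_smul, mul_comm]; rfl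
  have h4 : ∀ j ∉ Finset.range k, (t ^ j * (j.factorial : ℂ)⁻¹) • ((N ^ j) *ᵥ v) = 0 := by
    intro j hj
    rw [Finset.mem_range, not_lt] at hj
    obtain ⟨i, rfl⟩ := Nat.exists_eq_add_of_le' hj
    rw [pow_add N, ← Matrix.mulVec_mulVec, hk, Matrix.mulVec_zero, smul_zero]
  have h5 : HasSum (fun j => (t ^ j * (j.factorial : ℂ)⁻¹) • ((N ^ j) *ᵥ v))
      (NormedSpace.exp (t • N) *ᵥ v) := by
    rw [funext h3] at h2
    exact h2
  exact h5.unique (hasSum_sum_of_ne_finset_zero h4)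

/-- The vectors with decaying trajectory form a subspace that contains all generalized eigenspaces,
and these span the space over ℂ. -/
theorem tendsto_exp_mulVec_complex {C : Matrix (Fin n) (Fin n) ℂ}
    (hC : ∀ z ∈ spectrum ℂ C, z.re < 0) (v : Fin n → ℂ) :
    Tendsto (fun t : ℝ => NormedSpace.exp ((t : ℂ) • C) *ᵥ v) atTop (𝓝 0) := by
  let D : Submodule ℂ (Fin n → ℂ) :=
    { carrier := {v | Tendsto (fun t : ℝ => NormedSpace.exp ((t : ℂ) • C) *ᵥ v) atTop (𝓝 0)}
      add_mem' := fun {a b} ha hb => by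
        have := Tendsto.add ha hb
        rw [add_zero] at this
        simpa only [mem_ofPred_eq, Matrix.mulVec_add] using this
      zero_mem' := by simp
      smul_mem' := fun c a ha => by
        have := Tendsto.const_smul ha c
        rw [smul_zero] at this
        simpa only [mem_ofPred_eq, Matrix.mulVec_smul] using this }
  suffices hD : D = ⊤ by
    have : v ∈ D := hD ▸ Submodule.mem_top
    exact this
  rw [eq_top_iff, ← Module.End.iSup_maxGenEigenspace_eq_top (Matrix.toLin' C)]
  refine iSup_le fun z w hw => ?_
  obtain ⟨k, hk⟩ := (Module.End.mem_maxGenEigenspace _ _ _).1 hw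
  have hk' : ((C - z • 1) ^ k) *ᵥ w = 0 := by
    have h1 : (Matrix.toLin' C - z • 1) = Matrix.toLin' (C - z • 1) := by
      rw [map_sub, map_smul, Matrix.toLin'_one]; rfl
    rw [h1, ← Matrix.toLin'_pow, Matrix.toLin'_apply] at hk
    exact hk
  by_cases hz : z ∈ spectrum ℂ C
  · have h2 : ∀ t : ℝ, NormedSpace.exp ((t : ℂ) • C) *ᵥ w =
        ∑ j ∈ Finset.range k, ((t : ℂ) ^ j * Complex.exp (t * z)) •
          ((j.factorial : ℂ)⁻¹ • (((C - z • 1) ^ j) *ᵥ w)) := by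
      intro t
      have h3 : (t : ℂ) • C = (t * z) • (1 : Matrix (Fin n) (Fin n) ℂ) + (t : ℂ) • (C - z • 1) := by
        rw [smul_sub, smul_smul]; abel
      have h4 : Commute ((t * z) • (1 : Matrix (Fin n) (Fin n) ℂ)) ((t : ℂ) • (C - z • 1)) :=
        (Commute.one_left _).smul_left _
      have h5 : NormedSpace.exp ((t * z) • (1 : Matrix (Fin n) (Fin n) ℂ)) =
          Complex.exp (t * z) • 1 := by
        rw [Matrix.smul_one_eq_diagonal, Matrix.exp_diagonal, Matrix.smul_one_eq_diagonal]
        congr 1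
        funext i
        rw [Pi.coe_exp, ← Complex.exp_eq_exp_ℂ]
      rw [h3, Matrix.exp_add_of_commute _ _ h4, h5, smul_one_mul, Matrix.smul_mulVec,
        exp_mulVec_of_pow_mulVec_eq_zero hk', Finset.smul_sum]
      refine Finset.sum_congr rfl fun j _ => ?_
      rw [smul_smul, smul_smul]
      congr 1; ring
    show Tendsto (fun t : ℝ => NormedSpace.exp ((t : ℂ) • C) *ᵥ w) atTop (𝓝 0)
    simp_rw [h2]
    rw [← Finset.sum_const_zero (ι := ℕ) (s := Finset.range k)]
    refine tendsto_finsetSum _ fun j _ => ?_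
    have := (tendsto_pow_mul_cexp (hC z hz) j).smul_const
      ((j.factorial : ℂ)⁻¹ • (((C - z • 1) ^ j) *ᵥ w))
    rwa [zero_smul] at this
  · have hu : IsUnit ((C - z • 1) ^ k) := by
      refine IsUnit.pow k ?_
      rw [spectrum.notMem_iff, Algebra.algebraMap_eq_smul_one, IsUnit.sub_iff] at hz
      exact hz
    have : w = 0 := by
      have hinj := Matrix.mulVec_injective_iff_isUnit.2 hu
      exact hinj (by rw [hk', Matrix.mulVec_zero])
    rw [this]; exact D.zero_mem

/-- The exponential of a Hurwitz matrix decays. -/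
theorem IsHurwitz.tendsto_exp {M : Matrix (Fin n) (Fin n) ℝ} (hM : IsHurwitz M) :
    Tendsto (fun t : ℝ => NormedSpace.exp (t • M)) atTop (𝓝 0) := by
  have h1 : ∀ t : ℝ, NormedSpace.exp ((t : ℂ) • M.map (fun r : ℝ => (r : ℂ))) =
      (NormedSpace.exp (t • M)).map (fun r : ℝ => (r : ℂ)) := fun t => by
    have h2 := NormedSpace.map_exp (Complex.ofRealHom.mapMatrix (m := Fin n))
      (by
        refine continuous_matrix fun i j => ?_
        exact Complex.continuous_ofReal.comp (continuous_id.matrix_elem i j)) (t • M)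
    have h3 : Complex.ofRealHom.mapMatrix (t • M) = (t : ℂ) • M.map (fun r : ℝ => (r : ℂ)) := by
      ext i j; simp
    rw [h3] at h2
    exact h2.symm
  refine tendsto_pi_nhds.2 fun i => tendsto_pi_nhds.2 fun j => ?_
  have h4 := tendsto_exp_mulVec_complex hM (Pi.single j 1)
  rw [tendsto_pi_nhds] at h4
  have h5 := h4 i
  simp_rw [h1, Matrix.mulVec_single_one] at h5
  have h6 := (Complex.continuous_re.tendsto _).comp h5
  simpa [Function.comp_def] using h6

end Stability
end

/-! ### The Lyapunov equation -/

noncomputable section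

open Filter Topology InnerProductSpace
open scoped Manifold ContDiff NNReal

attribute [local instance] Matrix.frobeniusNormedRing
attribute [local instance] Matrix.frobeniusNormedAlgebra

section LyapunovEquation

variable {m n : ℕ} {M S W X P : Matrix (Fin n) (Fin n) ℝ}

/-- The matrix exponential `exp (t M)` tends to zero. -/
def IsDecaying (M : Matrix (Fin n) (Fin n) ℝ) : Prop :=
  Tendsto (fun t : ℝ => NormedSpace.exp (t • M)) atTop (𝓝 0)

theorem IsDecaying.transpose (hM : IsDecaying M) : IsDecaying Mᵀ := by
  have h1 : ∀ t : ℝ, NormedSpace.exp (t • Mᵀ) = (NormedSpace.exp (t • M))ᵀ := fun t => by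
    rw [← Matrix.exp_transpose, Matrix.transpose_smul]
  have h2 : Continuous fun X : Matrix (Fin n) (Fin n) ℝ => Xᵀ := continuous_id.matrix_transpose
  have h3 := (h2.tendsto 0).comp hM
  unfold IsDecaying
  simp_rw [h1]
  simpa [Function.comp_def] using h3

theorem hasDerivAt_exp_conj (M P : Matrix (Fin n) (Fin n) ℝ) (t : ℝ) :
    HasDerivAt (fun t : ℝ => NormedSpace.exp (t • Mᵀ) * P * NormedSpace.exp (t • M))
      (NormedSpace.exp (t • Mᵀ) * (Mᵀ * P + P * M) * NormedSpace.exp (t • M)) t := by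
  have h1 := hasDerivAt_exp_smul_const (𝕂 := ℝ) Mᵀ t
  have h2 := hasDerivAt_exp_smul_const' (𝕂 := ℝ) M t
  have h3 := (h1.mul_const P).mul h2
  refine h3.congr_deriv ?_
  noncomm_ring

theorem IsDecaying.tendsto_exp_conj (hM : IsDecaying M) (P : Matrix (Fin n) (Fin n) ℝ) :
    Tendsto (fun t : ℝ => NormedSpace.exp (t • Mᵀ) * P * NormedSpace.exp (t • M)) atTop (𝓝 0) := by
  have h1 : Tendsto (fun t : ℝ => NormedSpace.exp (t • Mᵀ)) atTop (𝓝 0) := hM.transpose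
  have h2 : Tendsto (fun t : ℝ => NormedSpace.exp (t • M)) atTop (𝓝 0) := hM
  simpa using (h1.mul_const P).mul h2

/-- The conjugate e^{tMᵀ} P e^{tM} has zero derivative, so it always equals P, and it tends to zero.
-/
theorem IsDecaying.eq_zero (hM : IsDecaying M) (hP : Mᵀ * P + P * M = 0) : P = 0 := by
  have h1 : ∀ t : ℝ, HasDerivAt
      (fun t : ℝ => NormedSpace.exp (t • Mᵀ) * P * NormedSpace.exp (t • M)) 0 t := fun t => by
    simpa [hP] using hasDerivAt_exp_conj M P t
  have h2 : ∀ t : ℝ, NormedSpace.exp (t • Mᵀ) * P * NormedSpace.exp (t • M) = P := fun t => by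
    have := is_const_of_deriv_eq_zero (fun t => (h1 t).differentiableAt) (fun t => (h1 t).deriv) t 0
    simpa using this
  have h3 := hM.tendsto_exp_conj P
  simp_rw [h2] at h3
  exact tendsto_nhds_unique tendsto_const_nhds h3

/-- The Lyapunov operator. -/
def lyapOp (M : Matrix (Fin n) (Fin n) ℝ) :
    Matrix (Fin n) (Fin n) ℝ →ₗ[ℝ] Matrix (Fin n) (Fin n) ℝ :=
  LinearMap.mulLeft ℝ M + LinearMap.mulRight ℝ Mᵀ

@[simp] theorem lyapOp_apply (M X : Matrix (Fin n) (Fin n) ℝ) : lyapOp M X = M * X + X * Mᵀ := rfl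

theorem IsDecaying.lyapOp_injective (hM : IsDecaying M) : Function.Injective (lyapOp M) := by
  rw [← LinearMap.ker_eq_bot, LinearMap.ker_eq_bot']
  intro X hX
  exact hM.transpose.eq_zero (by simpa using hX)

/-- The solution `X` of the Lyapunov equation `M X + X Mᵀ = -S` (for decaying `M`). -/
def lyapSol (M S : Matrix (Fin n) (Fin n) ℝ) : Matrix (Fin n) (Fin n) ℝ :=
  Function.invFun (lyapOp M) (-S)

theorem IsDecaying.lyapSol_eq (hM : IsDecaying M) (S : Matrix (Fin n) (Fin n) ℝ) :
    M * lyapSol M S + lyapSol M S * Mᵀ = -S := by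
  have hsurj := LinearMap.injective_iff_surjective.1 hM.lyapOp_injective
  exact Function.invFun_eq (hsurj (-S))

theorem IsDecaying.eq_lyapSol (hM : IsDecaying M) (h : M * X + X * Mᵀ = -S) : X = lyapSol M S :=
  hM.lyapOp_injective (h.trans (hM.lyapSol_eq S).symm)

theorem IsDecaying.lyapSol_transpose (hM : IsDecaying M) (hS : Sᵀ = S) :
    (lyapSol M S)ᵀ = lyapSol M S := by
  refine hM.eq_lyapSol ?_
  have := congrArg Matrix.transpose (hM.lyapSol_eq S)
  rw [Matrix.transpose_add, Matrix.transpose_mul, Matrix.transpose_mul, Matrix.transpose_transpose,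
    Matrix.transpose_neg, hS, add_comm] at this
  exact this

/-- The quadratic form of the solution of the Lyapunov equation is an integral along the flow. -/
theorem IsDecaying.integral_eq (hM : IsDecaying M) (hP : Mᵀ * P + P * M = -W)
    (hW : ∀ x : Fin n → ℝ, 0 ≤ x ⬝ᵥ (W *ᵥ x)) (x : Fin n → ℝ) :
    ∫ t in Ioi (0 : ℝ), (NormedSpace.exp (t • M) *ᵥ x) ⬝ᵥ (W *ᵥ (NormedSpace.exp (t • M) *ᵥ x))
      = x ⬝ᵥ (P *ᵥ x) := by
  let φ : Matrix (Fin n) (Fin n) ℝ →ₗ[ℝ] ℝ :=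
    { toFun := fun Y => -(x ⬝ᵥ (Y *ᵥ x))
      map_add' := fun A B => by rw [Matrix.add_mulVec, dotProduct_add, neg_add]
      map_smul' := fun c A => by simp [Matrix.smul_mulVec] }
  have hconj : ∀ (t : ℝ) (Y : Matrix (Fin n) (Fin n) ℝ),
      x ⬝ᵥ ((NormedSpace.exp (t • Mᵀ) * Y * NormedSpace.exp (t • M)) *ᵥ x) =
      (NormedSpace.exp (t • M) *ᵥ x) ⬝ᵥ (Y *ᵥ (NormedSpace.exp (t • M) *ᵥ x)) := fun t Y => by
    have : NormedSpace.exp (t • Mᵀ) = (NormedSpace.exp (t • M))ᵀ := by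
      rw [← Matrix.exp_transpose, Matrix.transpose_smul]
    rw [this, ← Matrix.mulVec_mulVec, ← Matrix.mulVec_mulVec, Matrix.dotProduct_mulVec,
      Matrix.vecMul_transpose]
  have hφ : Continuous φ := φ.continuous_of_finiteDimensional
  have hder : ∀ t : ℝ, HasDerivAt
      (fun t : ℝ => φ (NormedSpace.exp (t • Mᵀ) * P * NormedSpace.exp (t • M)))
      ((NormedSpace.exp (t • M) *ᵥ x) ⬝ᵥ (W *ᵥ (NormedSpace.exp (t • M) *ᵥ x))) t := fun t => by
    have h1 := φ.toContinuousLinearMap.hasFDerivAt.comp_hasDerivAt t (hasDerivAt_exp_conj M P t)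
    refine h1.congr_deriv ?_
    show -(x ⬝ᵥ _) = _
    rw [hP, hconj, Matrix.neg_mulVec, dotProduct_neg, neg_neg]
  have hlim : Tendsto (fun t : ℝ => φ (NormedSpace.exp (t • Mᵀ) * P * NormedSpace.exp (t • M)))
      atTop (𝓝 0) := by
    have := (hφ.tendsto 0).comp (hM.tendsto_exp_conj P)
    simpa [Function.comp_def] using this
  -- Nonnegativity of the integrand supplies integrability; the sign in `φ` makes the integrand its
  -- derivative along the flow.
  rw [integral_Ioi_of_hasDerivAt_of_nonneg (hder 0).continuousAt.continuousWithinAt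
    (fun t _ => hder t) (fun t _ => hW _) hlim]
  simp [φ]

/-- Symmetry comes from uniqueness of the solution, nonnegativity from `IsDecaying.integral_eq`
applied to the transpose. -/
theorem IsDecaying.lyapSol_posSemidef (hM : IsDecaying M) (hS : S.PosSemidef) :
    (lyapSol M S).PosSemidef := by
  have hsymm : (lyapSol M S)ᵀ = lyapSol M S := by
    refine hM.lyapSol_transpose ?_
    rw [← Matrix.conjTranspose_eq_transpose_of_trivial]; exact hS.isHermitian
  refine Matrix.PosSemidef.of_dotProduct_mulVec_nonneg
    (by rw [Matrix.IsHermitian, Matrix.conjTranspose_eq_transpose_of_trivial, hsymm]) fun x => ?_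
  have hnn : ∀ x : Fin n → ℝ, 0 ≤ x ⬝ᵥ (S *ᵥ x) := fun x => by
    simpa using hS.dotProduct_mulVec_nonneg x
  rw [star_trivial, ← hM.transpose.integral_eq (W := S)
    (by rw [Matrix.transpose_transpose]; exact hM.lyapSol_eq S) hnn x]
  exact integral_nonneg fun t => hnn _

/-- Duality of the two Lyapunov equations. -/
theorem trace_mul_lyap (hX : M * X + X * Mᵀ = -S) (hP : Mᵀ * P + P * M = -W) :
    (P * S).trace = (W * X).trace := by
  have h1 : S = -(M * X + X * Mᵀ) := by rw [hX, neg_neg]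
  have h2 : W = -(Mᵀ * P + P * M) := by rw [hP, neg_neg]
  have h3 : (P * (X * Mᵀ)).trace = (Mᵀ * P * X).trace := by
    rw [← Matrix.mul_assoc, Matrix.trace_mul_comm, Matrix.mul_assoc]
  rw [h1, h2, Matrix.mul_neg, Matrix.neg_mul, Matrix.mul_add, Matrix.add_mul, Matrix.trace_neg,
    Matrix.trace_neg, Matrix.trace_add, Matrix.trace_add, h3, Matrix.mul_assoc P M X, add_comm]

theorem mulVec_dotProduct_of_symm (hX : Xᵀ = X) (x y : Fin n → ℝ) :
    x ⬝ᵥ (X *ᵥ y) = (X *ᵥ x) ⬝ᵥ y := by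
  rw [Matrix.dotProduct_mulVec, ← Matrix.mulVec_transpose, hX]

/-- Lower bound for the smallest eigenvalue of the solution of the Lyapunov equation. -/
theorem lamMin_le_of_lyap (hn : 0 < n) (hX : X.PosSemidef) (hS : S.PosDef)
    (h : M * X + X * Mᵀ = -S) {c : ℝ} (hc : ∀ x : Fin n → ℝ, |x ⬝ᵥ (M *ᵥ x)| ≤ c * (x ⬝ᵥ x)) :
    lamMin S ≤ 2 * c * lamMin X := by
  have hmem := lamMin_mem_spectrum hn hX.isHermitian
  rw [hX.isHermitian.spectrum_real_eq_range_eigenvalues] at hmem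
  obtain ⟨i, hi⟩ := hmem
  -- Tested on an eigenvector of X for its smallest eigenvalue λ, the left side of the equation
  -- becomes 2λ vᵀMv.
  set v : Fin n → ℝ := (hX.isHermitian.eigenvectorBasis i).ofLp with hv
  have hXv : X *ᵥ v = lamMin X • v := by
    rw [← hi]; exact hX.isHermitian.mulVec_eigenvectorBasis i
  have hpos : 0 < v ⬝ᵥ v := by
    rw [dotProduct_self_eq_norm_sq]
    have : WithLp.toLp 2 v = hX.isHermitian.eigenvectorBasis i := rfl
    rw [this, (hX.isHermitian.eigenvectorBasis).norm_eq_one]; norm_num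
  have hsymm : Xᵀ = X := by
    rw [← Matrix.conjTranspose_eq_transpose_of_trivial]; exact hX.isHermitian
  have hlam : 0 ≤ lamMin X := by rw [← hi]; exact hX.eigenvalues_nonneg i
  have h1 : v ⬝ᵥ ((M * X + X * Mᵀ) *ᵥ v) = 2 * lamMin X * (v ⬝ᵥ (M *ᵥ v)) := by
    rw [Matrix.add_mulVec, dotProduct_add, ← Matrix.mulVec_mulVec, ← Matrix.mulVec_mulVec, hXv,
      mulVec_dotProduct_of_symm hsymm, hXv, Matrix.mulVec_smul, dotProduct_smul, smul_dotProduct,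
      Matrix.dotProduct_mulVec v Mᵀ, Matrix.vecMul_transpose, dotProduct_comm (M *ᵥ v), smul_eq_mul]
    ring
  rw [h, Matrix.neg_mulVec, dotProduct_neg] at h1
  have h2 := lamMin_mul_le hS.isHermitian v
  have h3 := (abs_le.1 (hc v)).1
  have h4 := mul_le_mul_of_nonneg_left h3 hlam
  refine le_of_mul_le_mul_right ?_ hpos
  linarith

/-- A matrix with a positive semidefinite Lyapunov solution is Hurwitz. -/
theorem isHurwitz_of_lyap (hX : X.PosSemidef) (hS : S.PosDef) (h : M * X + X * Mᵀ = -S) :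
    IsHurwitz M := by
  intro z hz
  have hsymm : Xᵀ = X := by
    rw [← Matrix.conjTranspose_eq_transpose_of_trivial]; exact hX.isHermitian
  rw [spectrum.mem_iff, Matrix.isUnit_iff_isUnit_det, isUnit_iff_ne_zero, not_not,
    ← Matrix.exists_vecMul_eq_zero_iff] at hz
  obtain ⟨v, hv0, hv⟩ := hz
  rw [Matrix.vecMul_sub, sub_eq_zero, Algebra.algebraMap_eq_smul_one, Matrix.vecMul_smul,
    Matrix.vecMul_one] at hv
  -- The equation is tested on the real and imaginary parts of a left eigenvector. In the sum the
  -- terms with Im z cancel by symmetry of X, so 2 Re z (aᵀXa + bᵀXb) = -(aᵀSa + bᵀSb) < 0.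
  set a : Fin n → ℝ := fun i => (v i).re with ha
  set b : Fin n → ℝ := fun i => (v i).im with hb
  have hMa : Mᵀ *ᵥ a = z.re • a - z.im • b := by
    funext j
    have := congrArg Complex.re (congrFun hv j)
    simp only [Pi.smul_apply, smul_eq_mul, Complex.mul_re, Matrix.vecMul, dotProduct,
      Matrix.map_apply, Complex.re_sum, Complex.ofReal_re, Complex.ofReal_im, mul_zero,
      sub_zero] at this
    simp only [Matrix.mulVec, dotProduct, Matrix.transpose_apply, Pi.sub_apply, Pi.smul_apply,
      smul_eq_mul, ha, hb]
    rw [this]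
    exact Finset.sum_congr rfl fun i _ => mul_comm _ _
  have hMb : Mᵀ *ᵥ b = z.im • a + z.re • b := by
    funext j
    have := congrArg Complex.im (congrFun hv j)
    simp only [Pi.smul_apply, smul_eq_mul, Complex.mul_im, Matrix.vecMul, dotProduct,
      Matrix.map_apply, Complex.im_sum, Complex.ofReal_re, Complex.ofReal_im, mul_zero,
      zero_add] at this
    simp only [Matrix.mulVec, dotProduct, Matrix.transpose_apply, Pi.add_apply, Pi.smul_apply,
      smul_eq_mul, ha, hb]
    rw [add_comm, this]
    exact Finset.sum_congr rfl fun i _ => mul_comm _ _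
  have hquad : ∀ x : Fin n → ℝ, -(x ⬝ᵥ (S *ᵥ x)) = 2 * ((X *ᵥ x) ⬝ᵥ (Mᵀ *ᵥ x)) := fun x => by
    rw [← dotProduct_neg, ← Matrix.neg_mulVec, ← h, Matrix.add_mulVec, dotProduct_add,
      ← Matrix.mulVec_mulVec, ← Matrix.mulVec_mulVec, mulVec_dotProduct_of_symm hsymm,
      Matrix.dotProduct_mulVec x M, ← Matrix.mulVec_transpose, dotProduct_comm (Mᵀ *ᵥ x)]
    ring
  have h1 := hquad a
  have h2 := hquad b
  rw [hMa, dotProduct_sub, dotProduct_smul, dotProduct_smul, smul_eq_mul, smul_eq_mul] at h1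
  rw [hMb, dotProduct_add, dotProduct_smul, dotProduct_smul, smul_eq_mul, smul_eq_mul] at h2
  have h3 : (X *ᵥ a) ⬝ᵥ b = (X *ᵥ b) ⬝ᵥ a := by
    rw [← mulVec_dotProduct_of_symm hsymm, dotProduct_comm]
  have hnnX : ∀ x : Fin n → ℝ, 0 ≤ (X *ᵥ x) ⬝ᵥ x := fun x => by
    rw [dotProduct_comm]; simpa using hX.dotProduct_mulVec_nonneg x
  have hnnS : ∀ x : Fin n → ℝ, 0 ≤ x ⬝ᵥ (S *ᵥ x) := fun x => by
    simpa using hS.posSemidef.dotProduct_mulVec_nonneg x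
  have hpos : 0 < a ⬝ᵥ (S *ᵥ a) + b ⬝ᵥ (S *ᵥ b) := by
    by_cases ha0 : a = 0
    · have hb0 : b ≠ 0 := fun hb0 => hv0 <| by
        funext i
        exact Complex.ext (congrFun ha0 i) (congrFun hb0 i)
      have : 0 < b ⬝ᵥ (S *ᵥ b) := by simpa using hS.dotProduct_mulVec_pos hb0
      linarith [hnnS a]
    · have : 0 < a ⬝ᵥ (S *ᵥ a) := by simpa using hS.dotProduct_mulVec_pos ha0
      linarith [hnnS b]
  by_contra hre
  rw [not_lt] at hre
  have h4 := mul_nonneg hre (add_nonneg (hnnX a) (hnnX b))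
  rw [h3] at h1
  nlinarith

end LyapunovEquation
end

/-! ### Smooth dependence on the gain and cost identities -/

noncomputable section

open Filter Topology InnerProductSpace
open scoped Manifold ContDiff NNReal

attribute [local instance] Matrix.frobeniusNormedRing
attribute [local instance] Matrix.frobeniusNormedAlgebra

/-- The solution of a family of injective linear equations depends smoothly on the parameter. -/
theorem contDiffOn_of_injective_linear_eq {E F : Type*} [NormedAddCommGroup E] [NormedSpace ℝ E]
    [FiniteDimensional ℝ E] [NormedAddCommGroup F] [NormedSpace ℝ F] [FiniteDimensional ℝ F]
    {r : WithTop ℕ∞} {Φ₀ : E →ₗ[ℝ] E} {Φ : F →ₗ[ℝ] E →ₗ[ℝ] E} {b X : F → E} {U : Set F}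
    (hU : IsOpen U) (hb : ContDiffOn ℝ r b U) (hinj : ∀ k ∈ U, Function.Injective (Φ₀ + Φ k))
    (hX : ∀ k ∈ U, (Φ₀ + Φ k) (X k) = b k) : ContDiffOn ℝ r X U := by
  have : CompleteSpace E := FiniteDimensional.complete ℝ E
  let Ψ : F → E →L[ℝ] E := fun k => LinearMap.toContinuousLinearMap (Φ₀ + Φ k)
  let T : F →ₗ[ℝ] (E →L[ℝ] E) := LinearMap.toContinuousLinearMap.toLinearMap ∘ₗ Φ
  have hΨ : ContDiff ℝ r Ψ := by
    have h1 : Ψ = fun k => LinearMap.toContinuousLinearMap Φ₀ + T.toContinuousLinearMap k := by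
      funext k; exact map_add LinearMap.toContinuousLinearMap Φ₀ (Φ k)
    rw [h1]
    exact contDiff_const.add T.toContinuousLinearMap.contDiff
  have hequiv : ∀ k ∈ U, ∃ e : E ≃L[ℝ] E, (e : E →L[ℝ] E) = Ψ k := fun k hk =>
    ⟨(LinearEquiv.ofInjectiveEndo _ (hinj k hk)).toContinuousLinearEquiv, by ext x; rfl⟩
  have hinv : ContDiffOn ℝ r (fun k => (Ψ k).inverse (b k)) U := by
    intro k hk
    obtain ⟨e, he⟩ := hequiv k hk
    -- An injective endomorphism in finite dimension is invertible, and inversion is smooth at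
    -- invertible maps.
    have h1 : ContDiffAt ℝ r ContinuousLinearMap.inverse (Ψ k) := he ▸ contDiffAt_map_inverse e
    have h2 := h1.comp k hΨ.contDiffAt
    exact (h2.clm_apply (hb.contDiffAt (hU.mem_nhds hk))).contDiffWithinAt
  refine hinv.congr fun k hk => ?_
  obtain ⟨e, he⟩ := hequiv k hk
  rw [← he, ContinuousLinearMap.inverse_equiv]
  have h1 : e (X k) = b k := by
    rw [← hX k hk]
    exact congrArg (fun L : E →L[ℝ] E => L (X k)) he
  rw [← h1]
  exact (e.symm_apply_apply _).symm

section Frobenius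

variable {m n : ℕ}

/-- The Frobenius inner product. -/
@[reducible] def Matrix.frobeniusInnerProductSpace :
    InnerProductSpace ℝ (Matrix (Fin m) (Fin n) ℝ) where
  toNormedSpace := Matrix.frobeniusNormedSpace
  inner X Y := ∑ i, ∑ j, X i j * Y i j
  norm_sq_eq_re_inner X := frobenius_norm_sq X
  conj_inner_symm X Y := by simp [mul_comm]
  add_left X Y Z := by simp [add_mul, Finset.sum_add_distrib]
  smul_left X Y r := by simp [Finset.mul_sum, mul_assoc]

attribute [local instance] Matrix.frobeniusInnerProductSpace

theorem frobenius_inner_def (X Y : Matrix (Fin m) (Fin n) ℝ) :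
    inner ℝ X Y = ∑ i, ∑ j, X i j * Y i j := rfl

theorem frobenius_inner_eq_trace (X Y : Matrix (Fin m) (Fin n) ℝ) :
    inner ℝ X Y = (Xᵀ * Y).trace := by
  rw [frobenius_inner_def, Matrix.trace, Finset.sum_comm]
  simp [Matrix.mul_apply]

theorem abs_trace_mul_le (X : Matrix (Fin m) (Fin n) ℝ) (Y : Matrix (Fin n) (Fin m) ℝ) :
    |(X * Y).trace| ≤ ‖X‖ * ‖Y‖ := by
  have := abs_real_inner_le_norm Xᵀ Y
  rwa [frobenius_inner_eq_trace, Matrix.transpose_transpose, Matrix.frobenius_norm_transpose] at this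

theorem Matrix.PosDef.transpose_eq {S : Matrix (Fin n) (Fin n) ℝ} (hS : S.PosDef) : Sᵀ = S := by
  rw [← Matrix.conjTranspose_eq_transpose_of_trivial]; exact hS.isHermitian

theorem lamMin_mul_norm_sq_le {S : Matrix (Fin m) (Fin m) ℝ} (hS : S.IsHermitian)
    (D : Matrix (Fin m) (Fin n) ℝ) : lamMin S * ‖D‖ ^ 2 ≤ (Dᵀ * S * D).trace := by
  have h1 : (D * Dᵀ).PosSemidef := by
    simpa using Matrix.posSemidef_self_mul_conjTranspose D
  have h2 := h1.mul_trace_le (lamMin_mul_le hS)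
  rw [Matrix.trace_mul_comm D, ← frobenius_norm_sq_eq_trace] at h2
  refine h2.trans_eq ?_
  rw [Matrix.mul_assoc, Matrix.trace_mul_comm, Matrix.mul_assoc]

theorem lamMin_mul_lamMin_mul_norm_sq_le {S : Matrix (Fin m) (Fin m) ℝ}
    {X : Matrix (Fin n) (Fin n) ℝ} (hS : S.PosSemidef) (hX : X.IsHermitian) (hX0 : 0 ≤ lamMin X)
    (D : Matrix (Fin m) (Fin n) ℝ) :
    lamMin S * lamMin X * ‖D‖ ^ 2 ≤ (Dᵀ * S * D * X).trace := by
  have h1 : (Dᵀ * S * D).PosSemidef := by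
    simpa using hS.conjTranspose_mul_mul_same D
  have h2 := h1.mul_trace_le (lamMin_mul_le hX)
  have h3 := mul_le_mul_of_nonneg_left (lamMin_mul_norm_sq_le hS.isHermitian D) hX0
  linarith

end Frobenius

attribute [local instance] Matrix.frobeniusInnerProductSpace

namespace SLQR

variable {m n : ℕ} (P : SLQR m n)

/-- The weight `Q + Kᵀ R K` of the closed-loop state in the cost. -/
def weight (K : Matrix (Fin m) (Fin n) ℝ) : Matrix (Fin n) (Fin n) ℝ := P.Q + Kᵀ * P.R * K

/-- The integrated covariance of the closed-loop state. -/
def gram (K : Matrix (Fin m) (Fin n) ℝ) : Matrix (Fin n) (Fin n) ℝ :=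
  lyapSol (P.closedLoop K) P.Sig

/-- The matrix of the quadratic cost-to-go. -/
def costToGo (K : Matrix (Fin m) (Fin n) ℝ) : Matrix (Fin n) (Fin n) ℝ :=
  lyapSol (P.closedLoop K)ᵀ (P.weight K)

/-- The matrix `R K - Bᵀ P_K`, which vanishes exactly at the optimal gain. -/
def resid (K : Matrix (Fin m) (Fin n) ℝ) : Matrix (Fin m) (Fin n) ℝ :=
  P.R * K - P.Bᵀ * P.costToGo K

variable {P} {K K' : Matrix (Fin m) (Fin n) ℝ}

theorem isDecaying (hK : K ∈ P.stab) : IsDecaying (P.closedLoop K) :=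
  IsHurwitz.tendsto_exp hK

theorem gram_eq (hK : K ∈ P.stab) :
    P.closedLoop K * P.gram K + P.gram K * (P.closedLoop K)ᵀ = -P.Sig :=
  (isDecaying hK).lyapSol_eq _

theorem costToGo_eq (hK : K ∈ P.stab) :
    (P.closedLoop K)ᵀ * P.costToGo K + P.costToGo K * P.closedLoop K = -P.weight K := by
  have := (isDecaying hK).transpose.lyapSol_eq (P.weight K)
  rwa [Matrix.transpose_transpose] at this

theorem gram_posSemidef (hK : K ∈ P.stab) : (P.gram K).PosSemidef :=
  (isDecaying hK).lyapSol_posSemidef P.posDef_Sig.posSemidef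

theorem weight_posDef (K : Matrix (Fin m) (Fin n) ℝ) : (P.weight K).PosDef := by
  refine P.posDef_Q.add_posSemidef ?_
  simpa using P.posDef_R.posSemidef.conjTranspose_mul_mul_same K

theorem costToGo_posSemidef (hK : K ∈ P.stab) : (P.costToGo K).PosSemidef :=
  (isDecaying hK).transpose.lyapSol_posSemidef (weight_posDef K).posSemidef

theorem costToGo_transpose (hK : K ∈ P.stab) : (P.costToGo K)ᵀ = P.costToGo K :=
  (isDecaying hK).transpose.lyapSol_transpose (weight_posDef K).transpose_eq

theorem stageCost_eq (K : Matrix (Fin m) (Fin n) ℝ) (x : Fin n → ℝ) :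
    P.stageCost x (-(K *ᵥ x)) = x ⬝ᵥ (P.weight K *ᵥ x) := by
  unfold stageCost weight
  rw [Matrix.mulVec_neg, neg_dotProduct_neg, Matrix.add_mulVec, dotProduct_add,
    ← Matrix.mulVec_mulVec, ← Matrix.mulVec_mulVec, Matrix.dotProduct_mulVec x Kᵀ,
    Matrix.vecMul_transpose]

/-- Only the second moments of the law enter; square integrability allows the integral to be
exchanged with the sums. -/
theorem integral_quadratic (P : SLQR m n) (Y : Matrix (Fin n) (Fin n) ℝ) :
    ∫ x, x ⬝ᵥ (Y *ᵥ x) ∂P.law = (Yᵀ * P.Sig).trace := by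
  have hint : ∀ i j, Integrable (fun x : Fin n → ℝ => x i * x j) P.law := fun i j =>
    (P.memLp i).integrable_mul (P.memLp j)
  have h1 : ∀ x : Fin n → ℝ, x ⬝ᵥ (Y *ᵥ x) = ∑ i, ∑ j, Y i j * (x i * x j) := fun x => by
    simp only [dotProduct, Matrix.mulVec, Finset.mul_sum]
    exact Finset.sum_congr rfl fun i _ => Finset.sum_congr rfl fun j _ => by ring
  simp_rw [h1]
  rw [integral_finsetSum _ fun i _ => integrable_finsetSum _ fun j _ =>
    (hint i j).const_mul (Y i j)]
  rw [← frobenius_inner_eq_trace, frobenius_inner_def]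
  refine Finset.sum_congr rfl fun i _ => ?_
  rw [integral_finsetSum _ fun j _ => (hint i j).const_mul (Y i j)]
  refine Finset.sum_congr rfl fun j _ => ?_
  rw [integral_const_mul, P.cov]

theorem cost_eq_costToGo (hK : K ∈ P.stab) : P.cost K = (P.costToGo K * P.Sig).trace := by
  have h1 : ∀ x, ∫ t in Ioi (0 : ℝ), P.stageCost (P.state K x t) (-(K *ᵥ P.state K x t)) =
      x ⬝ᵥ (P.costToGo K *ᵥ x) := fun x => by
    simp_rw [stageCost_eq]
    exact (isDecaying hK).integral_eq (costToGo_eq hK)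
      (fun x => by simpa using (weight_posDef K).posSemidef.dotProduct_mulVec_nonneg x) x
  unfold cost
  simp_rw [h1]
  rw [integral_quadratic, costToGo_transpose hK]

theorem cost_eq_gram (hK : K ∈ P.stab) : P.cost K = (P.weight K * P.gram K).trace := by
  rw [cost_eq_costToGo hK]
  exact trace_mul_lyap (gram_eq hK) (costToGo_eq hK)

/-- The exact difference of the costs of two stabilizing gains. -/
theorem cost_sub_cost (hK : K ∈ P.stab) (hK' : K' ∈ P.stab) :
    P.cost K' - P.cost K = (((K' - K)ᵀ * P.R * (K' - K) + (K' - K)ᵀ * P.resid K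
      + (P.resid K)ᵀ * (K' - K)) * P.gram K').trace := by
  obtain ⟨D, rfl⟩ : ∃ D, K' = K + D := ⟨K' - K, by abel⟩
  -- Duality is applied to the cost-to-go of the old gain and the Gramian of the new one, which
  -- turns both costs into traces against the same Gramian.
  rw [add_sub_cancel_left, cost_eq_gram hK', cost_eq_costToGo hK,
    trace_mul_lyap (W := -((P.closedLoop (K + D))ᵀ * P.costToGo K
      + P.costToGo K * P.closedLoop (K + D))) (gram_eq hK') (neg_neg _).symm,
    ← Matrix.trace_sub, ← Matrix.sub_mul]
  congr 2
  have h1 := costToGo_eq hK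
  have h2 : P.closedLoop (K + D) = P.closedLoop K - P.B * D := by
    unfold closedLoop; rw [Matrix.mul_add]; abel
  have h3 : (P.closedLoop (K + D))ᵀ * P.costToGo K + P.costToGo K * P.closedLoop (K + D) =
      -P.weight K - (Dᵀ * (P.Bᵀ * P.costToGo K) + P.costToGo K * P.B * D) := by
    rw [h2, Matrix.transpose_sub, Matrix.sub_mul, Matrix.mul_sub, ← h1, Matrix.transpose_mul,
      Matrix.mul_assoc, Matrix.mul_assoc]
    abel
  have h4 : (P.resid K)ᵀ = Kᵀ * P.R - P.costToGo K * P.B := by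
    unfold resid
    rw [Matrix.transpose_sub, Matrix.transpose_mul, Matrix.transpose_mul, costToGo_transpose hK,
      Matrix.transpose_transpose, P.posDef_R.transpose_eq]
  rw [h3, h4]
  unfold weight resid
  simp only [Matrix.transpose_add, Matrix.add_mul, Matrix.mul_add, Matrix.sub_mul, Matrix.mul_sub,
    Matrix.mul_assoc]
  abel

end SLQR
end

/-! ### Gradient, critical points and compact sublevel sets of the cost -/

noncomputable section

open Filter Topology InnerProductSpace
open scoped Manifold ContDiff NNReal

attribute [local instance] Matrix.frobeniusNormedRing
attribute [local instance] Matrix.frobeniusNormedAlgebra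
attribute [local instance] Matrix.frobeniusInnerProductSpace

namespace SLQR

variable {m n : ℕ} {P : SLQR m n} {K K' Kopt : Matrix (Fin m) (Fin n) ℝ}

/-- The Gramian of `K` remains a Lyapunov certificate for nearby gains, because the right side of
the equation moves by less than the smallest eigenvalue of Σ and stays positive definite. -/
theorem isOpen_stab (hn : 0 < n) : IsOpen P.stab := by
  rw [isOpen_iff_mem_nhds]
  intro K hK
  have hX := gram_posSemidef hK
  have hXt : (P.gram K)ᵀ = P.gram K := by
    rw [← Matrix.conjTranspose_eq_transpose_of_trivial]; exact hX.isHermitian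
  let S' : Matrix (Fin m) (Fin n) ℝ → Matrix (Fin n) (Fin n) ℝ := fun K' =>
    -(P.closedLoop K' * P.gram K + P.gram K * (P.closedLoop K')ᵀ)
  have hcont : Continuous S' := by
    have : Continuous fun K' => P.closedLoop K' := by unfold closedLoop; fun_prop
    fun_prop
  have hSK : S' K = P.Sig := by
    show -(_ + _) = _
    rw [gram_eq hK, neg_neg]
  have hlam := lamMin_pos hn P.posDef_Sig
  have hev : ∀ᶠ K' in 𝓝 K, ‖S' K' - P.Sig‖ < lamMin P.Sig := by
    have h1 : Continuous fun K' => ‖S' K' - P.Sig‖ := continuous_norm.comp (hcont.sub continuous_const)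
    exact (h1.tendsto K).eventually_lt_const (by rw [hSK, sub_self, norm_zero]; exact hlam)
  filter_upwards [hev] with K' hK'
  refine isHurwitz_of_lyap (S := S' K') hX ?_ (neg_neg _).symm
  refine Matrix.PosDef.of_dotProduct_mulVec_pos ?_ fun x hx => ?_
  · rw [Matrix.IsHermitian, Matrix.conjTranspose_eq_transpose_of_trivial]
    simp only [S', Matrix.transpose_neg, Matrix.transpose_add, Matrix.transpose_mul,
      Matrix.transpose_transpose, hXt]
    rw [add_comm]
  · rw [star_trivial]
    have h1 := abs_dotProduct_mulVec_le (S' K' - P.Sig) x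
    have h2 := lamMin_mul_le P.posDef_Sig.isHermitian x
    have h3 : 0 < x ⬝ᵥ x := by
      rw [dotProduct_self_eq_norm_sq]
      exact pow_pos (norm_pos_iff.2 fun h => hx ((WithLp.toLp_eq_zero 2).1 h)) 2
    rw [Matrix.sub_mulVec, dotProduct_sub] at h1
    have h4 := (abs_le.1 h1).1
    nlinarith

/-- Products of smooth matrix-valued functions are smooth. -/
theorem _root_.ContDiffOn.matrix_mul {F : Type*} [NormedAddCommGroup F] [NormedSpace ℝ F]
    {p q r : ℕ} {k : WithTop ℕ∞} {U : Set F} {f : F → Matrix (Fin p) (Fin q) ℝ}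
    {g : F → Matrix (Fin q) (Fin r) ℝ} (hf : ContDiffOn ℝ k f U) (hg : ContDiffOn ℝ k g U) :
    ContDiffOn ℝ k (fun x => f x * g x) U := by
  have hb : IsBoundedBilinearMap ℝ
      (fun z : Matrix (Fin p) (Fin q) ℝ × Matrix (Fin q) (Fin r) ℝ => z.1 * z.2) :=
    { add_left := fun x y z => Matrix.add_mul x y z
      smul_left := fun c x y => Matrix.smul_mul c x y
      add_right := fun x y z => Matrix.mul_add x y z
      smul_right := fun c x y => Matrix.mul_smul x c y
      bound := ⟨1, one_pos, fun x y => by rw [one_mul]; exact Matrix.frobenius_norm_mul x y⟩ }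
  exact hb.contDiff.comp_contDiffOn (hf.prodMk hg)

theorem _root_.ContDiffOn.matrix_transpose {F : Type*} [NormedAddCommGroup F] [NormedSpace ℝ F]
    {p q : ℕ} {k : WithTop ℕ∞} {U : Set F} {f : F → Matrix (Fin p) (Fin q) ℝ}
    (hf : ContDiffOn ℝ k f U) : ContDiffOn ℝ k (fun x => (f x)ᵀ) U :=
  ((Matrix.transposeLinearEquiv (Fin p) (Fin q) ℝ ℝ).toLinearMap.toContinuousLinearMap.contDiff
    ).comp_contDiffOn hf

/-- The part of the Lyapunov operator that depends on the gain. -/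
def lyapGain (B : Matrix (Fin n) (Fin m) ℝ) :
    Matrix (Fin m) (Fin n) ℝ →ₗ[ℝ] Matrix (Fin n) (Fin n) ℝ →ₗ[ℝ] Matrix (Fin n) (Fin n) ℝ :=
  LinearMap.mk₂ ℝ (fun K X => -(B * K * X + X * (B * K)ᵀ))
    (fun K K' X => by
      simp only [Matrix.mul_add, Matrix.add_mul, Matrix.transpose_add]; abel)
    (fun c K X => by simp)
    (fun K X Y => by simp only [Matrix.mul_add, Matrix.add_mul]; abel)
    (fun c K X => by simp)

/-- The part of the dual Lyapunov operator that depends on the gain. -/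
def lyapGainDual (B : Matrix (Fin n) (Fin m) ℝ) :
    Matrix (Fin m) (Fin n) ℝ →ₗ[ℝ] Matrix (Fin n) (Fin n) ℝ →ₗ[ℝ] Matrix (Fin n) (Fin n) ℝ :=
  LinearMap.mk₂ ℝ (fun K X => -((B * K)ᵀ * X + X * (B * K)))
    (fun K K' X => by
      simp only [Matrix.mul_add, Matrix.add_mul, Matrix.transpose_add]; abel)
    (fun c K X => by simp)
    (fun K X Y => by simp only [Matrix.mul_add, Matrix.add_mul]; abel)
    (fun c K X => by simp)

theorem contDiffOn_gram (hn : 0 < n) : ContDiffOn ℝ 1 P.gram P.stab := by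
  have hΦ : ∀ K, lyapOp P.A + lyapGain P.B K = lyapOp (P.closedLoop K) := fun K => by
    ext1 X
    simp only [lyapGain, LinearMap.add_apply, lyapOp_apply, LinearMap.mk₂_apply, closedLoop,
      Matrix.sub_mul, Matrix.mul_sub, Matrix.transpose_sub]
    abel
  refine contDiffOn_of_injective_linear_eq (Φ₀ := lyapOp P.A) (Φ := lyapGain P.B)
    (b := fun _ => -P.Sig) (isOpen_stab hn) contDiffOn_const (fun K hK => ?_) (fun K hK => ?_)
  · rw [hΦ]; exact (isDecaying hK).lyapOp_injective
  · rw [hΦ]; exact gram_eq hK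

theorem contDiffOn_costToGo (hn : 0 < n) : ContDiffOn ℝ 1 P.costToGo P.stab := by
  have hΦ : ∀ K, lyapOp P.Aᵀ + lyapGainDual P.B K = lyapOp (P.closedLoop K)ᵀ := fun K => by
    ext1 X
    simp only [lyapGainDual, LinearMap.add_apply, lyapOp_apply, LinearMap.mk₂_apply, closedLoop,
      Matrix.sub_mul, Matrix.mul_sub, Matrix.transpose_sub, Matrix.transpose_transpose]
    abel
  have hb : ContDiffOn ℝ 1 (fun K => -P.weight K) P.stab := by
    unfold weight
    have h1 : ContDiffOn ℝ 1 (fun K : Matrix (Fin m) (Fin n) ℝ => K) P.stab := contDiffOn_id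
    exact (contDiffOn_const.add ((h1.matrix_transpose.matrix_mul contDiffOn_const).matrix_mul h1)).neg
  refine contDiffOn_of_injective_linear_eq (Φ₀ := lyapOp P.Aᵀ) (Φ := lyapGainDual P.B)
    (isOpen_stab hn) hb (fun K hK => ?_) (fun K hK => ?_)
  · rw [hΦ]; exact (isDecaying hK).transpose.lyapOp_injective
  · rw [hΦ, lyapOp_apply, Matrix.transpose_transpose]; exact costToGo_eq hK

theorem contDiffOn_resid (hn : 0 < n) : ContDiffOn ℝ 1 P.resid P.stab := by
  unfold resid
  exact (contDiffOn_const.matrix_mul contDiffOn_id).sub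
    (contDiffOn_const.matrix_mul (contDiffOn_costToGo hn))

theorem inner_resid_gram (hK : K ∈ P.stab) (D : Matrix (Fin m) (Fin n) ℝ) :
    inner ℝ ((2 : ℝ) • (P.resid K * P.gram K)) D =
      ((Dᵀ * P.resid K + (P.resid K)ᵀ * D) * P.gram K).trace := by
  have hXt : (P.gram K)ᵀ = P.gram K := by
    rw [← Matrix.conjTranspose_eq_transpose_of_trivial]; exact (gram_posSemidef hK).isHermitian
  have h1 : ((P.resid K)ᵀ * D * P.gram K).trace = ((P.resid K * P.gram K)ᵀ * D).trace := by
    rw [Matrix.transpose_mul, hXt, Matrix.trace_mul_comm, Matrix.mul_assoc]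
  have h2 : (Dᵀ * P.resid K * P.gram K).trace = ((P.resid K * P.gram K)ᵀ * D).trace := by
    rw [← Matrix.trace_transpose ((P.resid K * P.gram K)ᵀ * D), Matrix.transpose_mul,
      Matrix.transpose_transpose, Matrix.mul_assoc]
  rw [real_inner_smul_left, frobenius_inner_eq_trace, Matrix.add_mul, Matrix.trace_add, h1, h2]
  ring

/-- By `cost_sub_cost` the remainder is a quadratic term plus a linear term weighted by the change
of the Gramian, so continuity of the Gramian is enough. -/
theorem hasFDerivAt_cost (hn : 0 < n) (hK : K ∈ P.stab) :
    HasFDerivAt P.cost (innerSL ℝ ((2 : ℝ) • (P.resid K * P.gram K))) K := by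
  rw [hasFDerivAt_iff_isLittleO]
  have hgc : ContinuousAt P.gram K :=
    (contDiffOn_gram hn).continuousOn.continuousAt ((isOpen_stab hn).mem_nhds hK)
  set ψ : Matrix (Fin m) (Fin n) ℝ → ℝ := fun K' => ‖P.R‖ * ‖K' - K‖ * ‖P.gram K'‖ +
    2 * ‖P.resid K‖ * ‖P.gram K' - P.gram K‖ with hψ
  have hψ0 : Tendsto ψ (𝓝 K) (𝓝 0) := by
    have h1 : Tendsto (fun K' => ‖P.gram K'‖) (𝓝 K) (𝓝 ‖P.gram K‖) :=
      (continuous_norm.tendsto _).comp hgc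
    have h2 : Tendsto (fun K' : Matrix (Fin m) (Fin n) ℝ => ‖K' - K‖) (𝓝 K) (𝓝 0) :=
      tendsto_norm_sub_self K
    have h3 : Tendsto (fun K' => ‖P.gram K' - P.gram K‖) (𝓝 K) (𝓝 0) :=
      (tendsto_iff_norm_sub_tendsto_zero).1 hgc
    simpa using ((h2.const_mul ‖P.R‖).mul h1).add (h3.const_mul (2 * ‖P.resid K‖))
  refine Asymptotics.isLittleO_iff.2 fun c hc => ?_
  filter_upwards [(isOpen_stab hn).mem_nhds hK, hψ0.eventually_lt_const hc] with K' hK' hlt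
  rw [cost_sub_cost hK hK', innerSL_apply_apply, inner_resid_gram hK, ← Matrix.trace_sub]
  set D := K' - K with hD
  have h1 : (Dᵀ * P.R * D + Dᵀ * P.resid K + (P.resid K)ᵀ * D) * P.gram K' -
      (Dᵀ * P.resid K + (P.resid K)ᵀ * D) * P.gram K = (Dᵀ * P.R * D) * P.gram K' +
      (Dᵀ * P.resid K + (P.resid K)ᵀ * D) * (P.gram K' - P.gram K) := by
    simp only [Matrix.add_mul, Matrix.mul_sub]
    abel
  rw [h1, Matrix.trace_add]
  have h2 := abs_trace_mul_le (Dᵀ * P.R * D) (P.gram K')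
  have h3 := abs_trace_mul_le (Dᵀ * P.resid K + (P.resid K)ᵀ * D) (P.gram K' - P.gram K)
  have h4 : ‖Dᵀ * P.R * D‖ ≤ ‖D‖ * ‖P.R‖ * ‖D‖ := by
    refine (Matrix.frobenius_norm_mul _ _).trans ?_
    refine mul_le_mul_of_nonneg_right ?_ (norm_nonneg _)
    exact (Matrix.frobenius_norm_mul _ _).trans_eq (by rw [Matrix.frobenius_norm_transpose])
  have h5 : ‖Dᵀ * P.resid K + (P.resid K)ᵀ * D‖ ≤ 2 * ‖P.resid K‖ * ‖D‖ := by
    have h6 := Matrix.frobenius_norm_mul Dᵀ (P.resid K)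
    have h7 := Matrix.frobenius_norm_mul (P.resid K)ᵀ D
    rw [Matrix.frobenius_norm_transpose] at h6 h7
    have h8 := norm_add_le (Dᵀ * P.resid K) ((P.resid K)ᵀ * D)
    linarith
  rw [Real.norm_eq_abs]
  refine (abs_add_le _ _).trans ?_
  have h6 := mul_le_mul_of_nonneg_right h4 (norm_nonneg (P.gram K'))
  have h7 := mul_le_mul_of_nonneg_right h5 (norm_nonneg (P.gram K' - P.gram K))
  have h8 := mul_le_mul_of_nonneg_right hlt.le (norm_nonneg D)
  simp only [hψ] at h8
  linarith

theorem matGrad_cost (hn : 0 < n) (hK : K ∈ P.stab) :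
    matGrad P.cost K = (2 : ℝ) • (P.resid K * P.gram K) := by
  ext i j
  have h1 : matGrad P.cost K i j =
      innerSL ℝ ((2 : ℝ) • (P.resid K * P.gram K)) (Matrix.single i j 1) :=
    DFunLike.congr_fun (hasFDerivAt_cost hn hK).fderiv _
  rw [h1, innerSL_apply_apply, frobenius_inner_def, Finset.sum_eq_single i, Finset.sum_eq_single j]
  · simp
  · intro k _ hk; simp [hk.symm]
  · simp
  · intro k _ hk; simp [hk.symm]
  · simp

theorem contDiffOn_matGrad_cost (hn : 0 < n) : ContDiffOn ℝ 1 (matGrad P.cost) P.stab := by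
  have h : ContDiffOn ℝ 1 (fun K => (2 : ℝ) • (P.resid K * P.gram K)) P.stab :=
    ((contDiffOn_resid hn).matrix_mul (contDiffOn_gram hn)).const_smul 2
  exact h.congr fun _ hK => matGrad_cost hn hK

theorem lamMin_gram_pos (hn : 0 < n) (hK : K ∈ P.stab) : 0 < lamMin (P.gram K) := by
  have h1 := lamMin_le_of_lyap hn (gram_posSemidef hK) P.posDef_Sig (gram_eq hK)
    (abs_dotProduct_mulVec_le _)
  have h2 := lamMin_pos hn P.posDef_Sig
  by_contra hcon
  have := mul_nonneg (norm_nonneg (P.closedLoop K)) (neg_nonneg.2 (not_lt.1 hcon))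
  linarith

/-- The gradient is 2EX with E the residual, and tr(EᵀEX) ≥ λ₁(X)‖E‖² with λ₁(X) > 0. -/
theorem resid_eq_zero (hn : 0 < n) (hK : K ∈ P.stab) (h : matGrad P.cost K = 0) :
    P.resid K = 0 := by
  rw [matGrad_cost hn hK] at h
  have h1 : P.resid K * P.gram K = 0 := by simpa using h
  have h2 : ((P.resid K)ᵀ * P.resid K).PosSemidef := by
    simpa using Matrix.posSemidef_conjTranspose_mul_self (P.resid K)
  have h3 := h2.mul_trace_le (lamMin_mul_le (gram_posSemidef hK).isHermitian)
  rw [Matrix.mul_assoc, h1, Matrix.mul_zero, Matrix.trace_zero, ← frobenius_norm_sq_eq_trace] at h3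
  have h4 : ‖P.resid K‖ ^ 2 ≤ 0 := by
    by_contra hcon
    have := mul_pos (lamMin_gram_pos hn hK) (not_le.1 hcon)
    linarith
  exact norm_eq_zero.1 (pow_eq_zero_iff two_ne_zero |>.1 (le_antisymm h4 (sq_nonneg _)))

theorem fderiv_cost_eq_zero (hn : 0 < n) (hopt : P.IsOptimal Kopt) : fderiv ℝ P.cost Kopt = 0 := by
  have hmin : IsLocalMin P.cost Kopt := by
    filter_upwards [(isOpen_stab hn).mem_nhds hopt.1] with K hK using hopt.2 K hK
  exact hmin.fderiv_eq_zero

theorem resid_opt (hn : 0 < n) (hopt : P.IsOptimal Kopt) : P.resid Kopt = 0 := by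
  refine resid_eq_zero hn hopt.1 ?_
  ext i j
  have h1 : matGrad P.cost Kopt i j = fderiv ℝ P.cost Kopt (Matrix.single i j 1) := rfl
  rw [h1, fderiv_cost_eq_zero hn hopt]
  rfl

/-- Quadratic growth of the cost at a critical point. -/
theorem cost_growth (hn : 0 < n) (hK : K ∈ P.stab) (hK' : K' ∈ P.stab) (h : P.resid K = 0) :
    lamMin P.R * lamMin (P.gram K') * ‖K' - K‖ ^ 2 ≤ P.cost K' - P.cost K := by
  rw [cost_sub_cost hK hK', h]
  simpa using lamMin_mul_lamMin_mul_norm_sq_le P.posDef_R.posSemidef (gram_posSemidef hK').isHermitian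
    (lamMin_gram_pos hn hK').le (K' - K)

/-- Quadratic growth holds at any critical gain. Evaluated at the optimal gain, whose cost is no
larger, it leaves no distance between the two. -/
theorem eq_opt_of_matGrad_eq_zero (hm : 0 < m) (hn : 0 < n) (hopt : P.IsOptimal Kopt)
    (hK : K ∈ P.stab) (h : matGrad P.cost K = 0) : K = Kopt := by
  have h1 := cost_growth hn hK hopt.1 (resid_eq_zero hn hK h)
  have h2 := hopt.2 K hK
  have h3 := mul_pos (lamMin_pos hm P.posDef_R) (lamMin_gram_pos hn hopt.1)
  have h4 : ‖Kopt - K‖ ^ 2 ≤ 0 := by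
    by_contra hcon
    have := mul_pos h3 (not_le.1 hcon)
    linarith
  have h5 := norm_eq_zero.1 (pow_eq_zero_iff two_ne_zero |>.1 (le_antisymm h4 (sq_nonneg _)))
  exact (sub_eq_zero.1 h5).symm

theorem lamMin_mul_trace_gram_le (hK : K ∈ P.stab) :
    lamMin P.Q * (P.gram K).trace ≤ P.cost K := by
  have hW : ∀ x : Fin n → ℝ, lamMin P.Q * (x ⬝ᵥ x) ≤ x ⬝ᵥ (P.weight K *ᵥ x) := fun x => by
    have h1 := lamMin_mul_le P.posDef_Q.isHermitian x
    have h2 : 0 ≤ x ⬝ᵥ ((Kᵀ * P.R * K) *ᵥ x) := by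
      have : (Kᵀ * P.R * K).PosSemidef := by
        simpa using P.posDef_R.posSemidef.conjTranspose_mul_mul_same K
      simpa using this.dotProduct_mulVec_nonneg x
    unfold weight
    rw [Matrix.add_mulVec, dotProduct_add]
    linarith
  have := (gram_posSemidef hK).mul_trace_le hW
  rwa [Matrix.trace_mul_comm, ← cost_eq_gram hK] at this

theorem lamMin_gram_le_trace (hn : 0 < n) (hK : K ∈ P.stab) :
    lamMin (P.gram K) ≤ (P.gram K).trace := by
  rw [(gram_posSemidef hK).isHermitian.trace_eq_sum_eigenvalues]
  have hmem := lamMin_mem_spectrum hn (gram_posSemidef hK).isHermitian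
  rw [(gram_posSemidef hK).isHermitian.spectrum_real_eq_range_eigenvalues] at hmem
  obtain ⟨i, hi⟩ := hmem
  rw [← hi]
  exact Finset.single_le_sum (f := fun i => (gram_posSemidef hK).isHermitian.eigenvalues i)
    (fun i _ => (gram_posSemidef hK).eigenvalues_nonneg i) (Finset.mem_univ i)

theorem cost_pos (hn : 0 < n) (hK : K ∈ P.stab) : 0 < P.cost K := by
  have h1 := lamMin_mul_trace_gram_le hK
  have h2 := mul_pos (lamMin_pos hn P.posDef_Q)
    ((lamMin_gram_pos hn hK).trans_le (lamMin_gram_le_trace hn hK))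
  linarith

theorem lamMin_mul_norm_sq_le_cost (hn : 0 < n) (hK : K ∈ P.stab) :
    lamMin P.R * lamMin (P.gram K) * ‖K‖ ^ 2 ≤ P.cost K := by
  have h1 := lamMin_mul_lamMin_mul_norm_sq_le P.posDef_R.posSemidef
    (gram_posSemidef hK).isHermitian (lamMin_gram_pos hn hK).le K
  have h2 : 0 ≤ (P.Q * P.gram K).trace := by
    have h3 := (gram_posSemidef hK).mul_trace_le (c := 0) (M := P.Q) fun x => by
      simpa using P.posDef_Q.posSemidef.dotProduct_mulVec_nonneg x
    rw [Matrix.trace_mul_comm]; linarith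
  rw [cost_eq_gram hK, weight, Matrix.add_mul, Matrix.trace_add]
  linarith

/-- Gains of bounded cost are bounded. -/
theorem exists_norm_le_of_cost_le (hm : 0 < m) (hn : 0 < n) (α : ℝ) :
    ∃ c, ∀ K ∈ P.stab, P.cost K ≤ α → ‖K‖ ≤ c := by
  have hR := lamMin_pos hm P.posDef_R
  have hS := lamMin_pos hn P.posDef_Sig
  -- For ‖K‖ ≥ 1, λ₁(Σ) ≤ 2(‖A‖ + ‖B‖)‖K‖λ₁(X), while λ₁(R)λ₁(X)‖K‖² ≤ α. Eliminating λ₁(X) gives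
  -- the second entry.
  refine ⟨max 1 (2 * α * (‖P.A‖ + ‖P.B‖) / (lamMin P.R * lamMin P.Sig)), fun K hK hα => ?_⟩
  by_contra! hcon
  obtain ⟨h1, h2⟩ := max_lt_iff.1 hcon
  rw [div_lt_iff₀ (by positivity)] at h2
  have h3 := lamMin_le_of_lyap hn (gram_posSemidef hK) P.posDef_Sig (gram_eq hK)
    (abs_dotProduct_mulVec_le _)
  have h4 : ‖P.closedLoop K‖ ≤ (‖P.A‖ + ‖P.B‖) * ‖K‖ := by
    have h5 := norm_sub_le P.A (P.B * K)
    have h6 := Matrix.frobenius_norm_mul P.B K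
    have h7 := mul_le_mul_of_nonneg_left h1.le (norm_nonneg P.A)
    unfold closedLoop
    linarith
  have hX := lamMin_gram_pos hn hK
  have h5 := lamMin_mul_norm_sq_le_cost hn hK
  have h6 : lamMin P.Sig ≤ 2 * ((‖P.A‖ + ‖P.B‖) * ‖K‖) * lamMin (P.gram K) :=
    h3.trans (by gcongr)
  have h7 := mul_le_mul_of_nonneg_left h6 (by positivity : 0 ≤ lamMin P.R * ‖K‖ ^ 2)
  have h8 := mul_le_mul_of_nonneg_left (h5.trans hα)
    (by positivity : 0 ≤ 2 * ((‖P.A‖ + ‖P.B‖) * ‖K‖))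
  have h9 := mul_lt_mul_of_pos_right h2 (by linarith : 0 < ‖K‖)
  linarith

/-- The set of stabilizing gains is open, so closedness is the difficulty. Pairs of a gain and a
Gramian are cut out by closed conditions, and a positive semidefinite solution of the Lyapunov
equation certifies stability; the sublevel set is the projection of a compact set of such pairs. -/
theorem isCompact_sublevel (hm : 0 < m) (hn : 0 < n) (α : ℝ) :
    IsCompact {K | K ∈ P.stab ∧ P.cost K ≤ α} := by
  obtain ⟨c, hc⟩ := exists_norm_le_of_cost_le (P := P) hm hn α
  have hQ := lamMin_pos hn P.posDef_Q
  let Z : Set (Matrix (Fin m) (Fin n) ℝ × Matrix (Fin n) (Fin n) ℝ) :=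
    {z | z.2ᵀ = z.2} ∩ {z | ∀ x : Fin n → ℝ, 0 ≤ x ⬝ᵥ (z.2 *ᵥ x)} ∩
    {z | P.closedLoop z.1 * z.2 + z.2 * (P.closedLoop z.1)ᵀ = -P.Sig} ∩
    {z | (P.weight z.1 * z.2).trace ≤ α}
  have h2 : Continuous fun z : Matrix (Fin m) (Fin n) ℝ × Matrix (Fin n) (Fin n) ℝ => z.2 :=
    continuous_snd
  have hcl : Continuous fun z : Matrix (Fin m) (Fin n) ℝ × Matrix (Fin n) (Fin n) ℝ =>
      P.closedLoop z.1 := by unfold closedLoop; fun_prop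
  have hw : Continuous fun z : Matrix (Fin m) (Fin n) ℝ × Matrix (Fin n) (Fin n) ℝ =>
      P.weight z.1 := by unfold weight; fun_prop
  have hZ : IsClosed Z := by
    refine (((isClosed_eq h2.matrix_transpose h2).inter ?_).inter
      (isClosed_eq ?_ continuous_const)).inter (isClosed_le ?_ continuous_const)
    · simp only [ofPred_forall]
      exact isClosed_iInter fun x => isClosed_le continuous_const (by fun_prop)
    · fun_prop
    · exact (hw.matrix_mul h2).matrix_trace
  have hcomp := ((isCompact_closedBall (0 : Matrix (Fin m) (Fin n) ℝ) c).prod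
    (isCompact_closedBall (0 : Matrix (Fin n) (Fin n) ℝ) (α / lamMin P.Q))).inter_right hZ
  suffices h : {K | K ∈ P.stab ∧ P.cost K ≤ α} = Prod.fst '' ((Metric.closedBall 0 c ×ˢ
      Metric.closedBall 0 (α / lamMin P.Q)) ∩ Z) by
    rw [h]; exact hcomp.image continuous_fst
  refine Set.ext fun K => ⟨?_, ?_⟩
  · rintro ⟨hK, hα⟩
    have hX := gram_posSemidef hK
    refine ⟨(K, P.gram K), ⟨⟨?_, ?_⟩, ⟨⟨?_, ?_⟩, gram_eq hK⟩, ?_⟩, rfl⟩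
    · simpa using hc K hK hα
    · have h1 := hX.norm_le_trace
      have h3 := lamMin_mul_trace_gram_le hK
      have h4 : ‖P.gram K‖ ≤ α / lamMin P.Q := by
        rw [le_div_iff₀ hQ]
        have := mul_le_mul_of_nonneg_left h1 hQ.le
        linarith
      simpa using h4
    · show (P.gram K)ᵀ = P.gram K
      rw [← Matrix.conjTranspose_eq_transpose_of_trivial]; exact hX.isHermitian
    · exact fun x => by simpa using hX.dotProduct_mulVec_nonneg x
    · show (P.weight K * P.gram K).trace ≤ α
      rwa [← cost_eq_gram hK]
  · rintro ⟨⟨K', X⟩, ⟨-, ⟨⟨hsymm, hnn⟩, heq⟩, htr⟩, rfl⟩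
    have hX : X.PosSemidef := Matrix.PosSemidef.of_dotProduct_mulVec_nonneg
      (by rw [Matrix.IsHermitian, Matrix.conjTranspose_eq_transpose_of_trivial]; exact hsymm)
      fun x => by simpa using hnn x
    have hK' : K' ∈ P.stab := isHurwitz_of_lyap hX P.posDef_Sig heq
    refine ⟨hK', ?_⟩
    rw [cost_eq_gram hK']
    have : X = P.gram K' := (isDecaying hK').eq_lyapSol heq
    rw [← this]; exact htr

end SLQR
end

/-! ### The constant μ and the local gradient inequality -/

noncomputable section

open Filter Topology InnerProductSpace
open scoped NNReal

attribute [local instance] Matrix.frobeniusInnerProductSpace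

namespace SLQR

variable {m n : ℕ} {P : SLQR m n} {K Kopt : Matrix (Fin m) (Fin n) ℝ}

theorem cost_nonneg (hK : K ∈ P.stab) : 0 ≤ P.cost K := by
  rw [cost_eq_costToGo hK]
  simpa using (costToGo_posSemidef hK).mul_trace_le (c := 0) (M := P.Sig) fun x => by
    simpa using P.posDef_Sig.posSemidef.dotProduct_mulVec_nonneg x

theorem norm_costToGo_le (hn : 0 < n) (hK : K ∈ P.stab) :
    ‖P.costToGo K‖ ≤ P.cost K / lamMin P.Sig := by
  rw [le_div_iff₀ (lamMin_pos hn P.posDef_Sig), cost_eq_costToGo hK, mul_comm]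
  exact (mul_le_mul_of_nonneg_left (costToGo_posSemidef hK).norm_le_trace
    (lamMin_pos hn P.posDef_Sig).le).trans
    ((costToGo_posSemidef hK).mul_trace_le (lamMin_mul_le P.posDef_Sig.isHermitian))

/-- When the residual vanishes, RK = BᵀP_K, so λ₁(R)‖Kx‖² ≤ ⟨BKx, P_K x⟩, and ‖P_K‖ is at most the
cost divided by λ₁(Σ). -/
theorem norm_mulVec_opt_le (hm : 0 < m) (hn : 0 < n) (hK : K ∈ P.stab) (h : P.resid K = 0)
    (x : Fin n → ℝ) : ‖WithLp.toLp 2 (K *ᵥ x)‖ ≤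
      specNorm P.B * P.cost K / (lamMin P.Sig * lamMin P.R) * ‖WithLp.toLp 2 x‖ := by
  have hR := lamMin_pos hm P.posDef_R
  have hS := lamMin_pos hn P.posDef_Sig
  have hB := specNorm_nonneg P.B
  have h1 := lamMin_mul_le P.posDef_R.isHermitian (K *ᵥ x)
  have h2 : (K *ᵥ x) ⬝ᵥ (P.R *ᵥ (K *ᵥ x)) = (P.B *ᵥ (K *ᵥ x)) ⬝ᵥ (P.costToGo K *ᵥ x) := by
    rw [Matrix.mulVec_mulVec, sub_eq_zero.1 h, ← Matrix.mulVec_mulVec, Matrix.dotProduct_mulVec,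
      Matrix.vecMul_transpose]
  rw [h2, dotProduct_self_eq_norm_sq] at h1
  have h3 := (le_abs_self _).trans
    (dotProduct_le_norm_mul_norm (P.B *ᵥ (K *ᵥ x)) (P.costToGo K *ᵥ x))
  have h4 := norm_mulVec_le P.B (K *ᵥ x)
  have h5 : ‖WithLp.toLp 2 (P.costToGo K *ᵥ x)‖ ≤
      P.cost K / lamMin P.Sig * ‖WithLp.toLp 2 x‖ :=
    (norm_mulVec_le_frobenius _ x).trans
      (mul_le_mul_of_nonneg_right (norm_costToGo_le hn hK) (norm_nonneg _))
  have hf := cost_nonneg hK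
  rcases (norm_nonneg (WithLp.toLp 2 (K *ᵥ x))).eq_or_lt with h0 | h0
  · rw [← h0]; positivity
  have h6 : lamMin P.R * ‖WithLp.toLp 2 (K *ᵥ x)‖ ≤
      specNorm P.B * (P.cost K / lamMin P.Sig * ‖WithLp.toLp 2 x‖) := by
    refine le_of_mul_le_mul_right ?_ h0
    have h7 := h1.trans (h3.trans (mul_le_mul h4 h5 (norm_nonneg _) (by positivity)))
    linarith
  have h8 : specNorm P.B * P.cost K / (lamMin P.Sig * lamMin P.R) * ‖WithLp.toLp 2 x‖ =
      specNorm P.B * (P.cost K / lamMin P.Sig * ‖WithLp.toLp 2 x‖) / lamMin P.R := by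
    field_simp
  rw [h8, le_div_iff₀ hR, mul_comm]
  exact h6

theorem abs_dotProduct_closedLoop_opt_le (hm : 0 < m) (hn : 0 < n) (hK : K ∈ P.stab)
    (h : P.resid K = 0) (x : Fin n → ℝ) : |x ⬝ᵥ (P.closedLoop K *ᵥ x)| ≤
      (specNorm P.A + specNorm P.B ^ 2 * P.cost K / (lamMin P.Sig * lamMin P.R)) * (x ⬝ᵥ x) := by
  have hB := specNorm_nonneg P.B
  have h1 := norm_mulVec_le P.A x
  have h2 := (norm_mulVec_le P.B (K *ᵥ x)).trans
    (mul_le_mul_of_nonneg_left (norm_mulVec_opt_le hm hn hK h x) hB)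
  have h3 := dotProduct_le_norm_mul_norm x (P.closedLoop K *ᵥ x)
  have h4 : ‖WithLp.toLp 2 (P.closedLoop K *ᵥ x)‖ ≤
      ‖WithLp.toLp 2 (P.A *ᵥ x)‖ + ‖WithLp.toLp 2 (P.B *ᵥ (K *ᵥ x))‖ := by
    rw [closedLoop, Matrix.sub_mulVec, ← Matrix.mulVec_mulVec, WithLp.toLp_sub]
    exact norm_sub_le _ _
  refine h3.trans ?_
  have h5 := mul_le_mul_of_nonneg_left (h4.trans (add_le_add h1 h2)) (norm_nonneg (WithLp.toLp 2 x))
  rw [dotProduct_self_eq_norm_sq]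
  refine h5.trans_eq ?_
  ring

/-- With c the bracket in the denominator of μ, λ₁(Σ) ≤ 2cλ₁(X*). Squaring gives two factors λ₁(X*);
one is traded for the cost through λ₁(Q)λ₁(X*) ≤ f(K*). -/
theorem mu_pos_and_le (hm : 0 < m) (hn : 0 < n) (hopt : P.IsOptimal Kopt) :
    0 < P.mu Kopt ∧ 2 * P.mu Kopt ≤ lamMin P.R * lamMin (P.gram Kopt) := by
  have hR := lamMin_pos hm P.posDef_R
  have hS := lamMin_pos hn P.posDef_Sig
  have hQ := lamMin_pos hn P.posDef_Q
  have hX := lamMin_gram_pos hn hopt.1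
  have hf := cost_pos hn hopt.1
  have hA := specNorm_nonneg P.A
  have hB := specNorm_nonneg P.B
  have h1 := lamMin_le_of_lyap hn (gram_posSemidef hopt.1) P.posDef_Sig (gram_eq hopt.1)
    (abs_dotProduct_closedLoop_opt_le hm hn hopt.1 (resid_opt hn hopt))
  have h2 : lamMin P.Q * lamMin (P.gram Kopt) ≤ P.cost Kopt :=
    (mul_le_mul_of_nonneg_left (lamMin_gram_le_trace hn hopt.1) hQ.le).trans
      (lamMin_mul_trace_gram_le hopt.1)
  unfold mu plConst
  set c := specNorm P.A + specNorm P.B ^ 2 * P.cost Kopt / (lamMin P.Sig * lamMin P.R) with hc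
  have hc0 : 0 ≤ c := by positivity
  have hcpos : 0 < c := by
    refine hc0.lt_of_ne fun h => ?_
    rw [← h] at h1
    linarith
  refine ⟨by positivity, ?_⟩
  rw [← mul_div_assoc, div_le_iff₀ (by positivity)]
  have h3 : lamMin P.Sig ^ 2 ≤ (2 * c * lamMin (P.gram Kopt)) ^ 2 := by gcongr
  calc 2 * (lamMin P.R * lamMin P.Sig ^ 2 * lamMin P.Q)
      ≤ 2 * (lamMin P.R * (2 * c * lamMin (P.gram Kopt)) ^ 2 * lamMin P.Q) := by gcongr
    _ = 8 * lamMin P.R * lamMin (P.gram Kopt) * c ^ 2 * (lamMin P.Q * lamMin (P.gram Kopt)) := by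
        ring
    _ ≤ 8 * lamMin P.R * lamMin (P.gram Kopt) * c ^ 2 * P.cost Kopt := by gcongr
    _ = _ := by ring

/-- The gradient inequality at the optimal gain. -/
theorem eventually_growth (hm : 0 < m) (hn : 0 < n) (hopt : P.IsOptimal Kopt) :
    ∀ᶠ K in 𝓝 Kopt, P.cost K - P.cost Kopt + P.mu Kopt * ‖K - Kopt‖ ^ 2 ≤
      inner ℝ (K - Kopt) (matGrad P.cost K) := by
  have hnhds := (isOpen_stab hn).mem_nhds hopt.1
  obtain ⟨hμ, hμX⟩ := mu_pos_and_le hm hn hopt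
  have hdiff : DifferentiableAt ℝ P.resid Kopt :=
    ((contDiffOn_resid hn).contDiffAt hnhds).differentiableAt one_ne_zero
  obtain ⟨c, hc, hO⟩ := hdiff.isBigO_sub.exists_pos
  have hgc : Tendsto P.gram (𝓝 Kopt) (𝓝 (P.gram Kopt)) :=
    (contDiffOn_gram hn).continuousOn.continuousAt hnhds
  have h3 : Tendsto (fun K => ‖P.gram K - P.gram Kopt‖) (𝓝 Kopt) (𝓝 0) :=
    tendsto_iff_norm_sub_tendsto_zero.1 hgc
  -- Replacing the Gramian of K by that of K* costs at most 2c‖q‖² times their distance. Below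
  -- μ/(2c) this uses only one of the two multiples of μ‖q‖² provided by `mu_pos_and_le`.
  filter_upwards [hnhds, hO.bound, h3.eventually_lt_const (div_pos hμ (mul_pos two_pos hc))]
    with K hK hE hX
  rw [resid_opt hn hopt, sub_zero] at hE
  rw [lt_div_iff₀ (by positivity)] at hX
  -- With the optimal gain as the new one, the quadratic term carries the fixed Gramian of `Kopt`.
  have h4 := cost_sub_cost hK hopt.1
  rw [real_inner_comm, matGrad_cost hn hK, inner_resid_gram hK]
  set q := K - Kopt with hq
  have hq' : Kopt - K = -q := by rw [hq, neg_sub]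
  set E := P.resid K with hEdef
  have h5 : ((Kopt - K)ᵀ * P.R * (Kopt - K) + (Kopt - K)ᵀ * E + Eᵀ * (Kopt - K)) * P.gram Kopt =
      qᵀ * P.R * q * P.gram Kopt - (qᵀ * E + Eᵀ * q) * P.gram Kopt := by
    rw [hq', ← Matrix.sub_mul]
    congr 1
    simp only [Matrix.transpose_neg, Matrix.neg_mul, Matrix.mul_neg, neg_neg]
    abel
  rw [h5, Matrix.trace_sub] at h4
  have h6 : ((qᵀ * E + Eᵀ * q) * P.gram K).trace = ((qᵀ * E + Eᵀ * q) * P.gram Kopt).trace +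
      ((qᵀ * E + Eᵀ * q) * (P.gram K - P.gram Kopt)).trace := by
    rw [← Matrix.trace_add, ← Matrix.mul_add, add_sub_cancel]
  have h7 := lamMin_mul_lamMin_mul_norm_sq_le P.posDef_R.posSemidef
    (gram_posSemidef hopt.1).isHermitian (lamMin_gram_pos hn hopt.1).le q
  have h8 := (abs_le.1 (abs_trace_mul_le (qᵀ * E + Eᵀ * q) (P.gram K - P.gram Kopt))).1
  have h9 : ‖qᵀ * E + Eᵀ * q‖ ≤ 2 * c * ‖q‖ ^ 2 := by
    have h10 := Matrix.frobenius_norm_mul qᵀ E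
    have h11 := Matrix.frobenius_norm_mul Eᵀ q
    rw [Matrix.frobenius_norm_transpose] at h10 h11
    have h12 := norm_add_le (qᵀ * E) (Eᵀ * q)
    have h13 := mul_le_mul_of_nonneg_right hE (norm_nonneg q)
    linarith
  have h10 := mul_le_mul_of_nonneg_right h9 (norm_nonneg (P.gram K - P.gram Kopt))
  have h11 := mul_le_mul_of_nonneg_right hX.le (sq_nonneg ‖q‖)
  have h12 := mul_le_mul_of_nonneg_right hμX (sq_nonneg ‖q‖)
  rw [h6]
  linarith

/-- Above the optimal level, the cost is a landscape for the heavy-ball system. -/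
theorem landscape (hm : 0 < m) (hn : 0 < n) (hopt : P.IsOptimal Kopt) {f₀ : ℝ}
    (hlt : P.cost Kopt < f₀) :
    Landscape P.cost (matGrad P.cost) P.stab f₀ Kopt (P.mu Kopt) where
  isOpen := isOpen_stab hn
  hasFDerivAt K hK := by rw [matGrad_cost hn hK]; exact hasFDerivAt_cost hn hK
  contDiffOn := contDiffOn_matGrad_cost hn
  isCompact := isCompact_sublevel hm hn f₀
  mem := hopt.1
  lt := hlt
  le_of_mem := hopt.2
  crit _ hK h := eq_opt_of_matGrad_eq_zero hm hn hopt hK h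
  growth := eventually_growth hm hn hopt

theorem flowMap_zero (d : ℝ) : P.flowMap d 0 = heavyBall (matGrad P.cost) d := by
  funext z
  refine Prod.ext rfl ?_
  show -matGrad P.cost z.1 + (-((2 * d) • z.2) -
    (matGrad P.cost (z.1 + (0 : ℝ) • z.2) - matGrad P.cost z.1)) =
    -matGrad P.cost z.1 - (2 * d) • z.2
  rw [zero_smul, add_zero, sub_self, sub_zero, sub_eq_add_neg]

/-- At the optimal level, the number of jumps is not bounded. -/
theorem not_jumpsAtMost (hn : 0 < n) (hopt : P.IsOptimal Kopt) {d β η : ℝ}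
    {K₀ : Matrix (Fin m) (Fin n) ℝ} (h₀ : P.cost K₀ ≤ P.cost Kopt)
    {z₀ : Matrix (Fin m) (Fin n) ℝ × Matrix (Fin m) (Fin n) ℝ} (hz : z₀ ∈ P.initSet K₀) (S : ℕ) :
    ¬ P.JumpsAtMost d β η K₀ z₀ S := by
  intro hS
  have hz1 : P.IsOptimal z₀.1 := ⟨hz.1.1, fun K hK => (hz.1.2.trans h₀).trans (hopt.2 K hK)⟩
  have hfst : ∀ k, ((P.jumpMap η)^[k] z₀).1 = z₀.1 := fun k => by
    induction k with
    | zero => rfl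
    | succ k ih => rw [Function.iterate_succ_apply']; exact ih
  have hnot : ∀ k, (P.jumpMap η)^[k] z₀ ∉ P.flowSet K₀ := fun k => by
    rintro ⟨-, h2 | h2⟩
    · rw [hfst] at h2
      exact (h2.trans_le (h₀.trans (hopt.2 _ hz.1.1))).false
    · rw [hfst, fderiv_cost_eq_zero hn hz1] at h2
      exact lt_irrefl _ h2
  obtain ⟨J, τ, x, hx⟩ := exists_isHybridSolution_of_iterate_notMem (F := P.flowMap d β) hnot (S + 1)
  have := hS J _ τ x hx
  omega

end SLQR
end

/-! ### The convergence theorem -/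

theorem theorem5 (a b l : ℝ) (ha : 0 < a) (hab : a ≤ b) (hl : 0 < l) :
    ∃ ca : ℝ, 0 < ca ∧
      ∀ (m n : ℕ) (_hm : 0 < m) (_hn : 0 < n) (P : SLQR m n)
        (K₀ Kopt : Matrix (Fin m) (Fin n) ℝ) (_hK₀ : K₀ ∈ P.stab) (_hopt : P.IsOptimal Kopt)
        (_hL : l ≤ P.bigL Kopt)
        (d : ℝ) (_hd₁ : a / Real.sqrt (P.kappa Kopt) ≤ d)
        (_hd₂ : d ≤ b / Real.sqrt (P.kappa Kopt)) (S : ℕ),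
        ∃ η₀ : ℝ, 0 < η₀ ∧ ∀ η : ℝ, 0 < η → η < η₀ →
          ∃ Ca : ℝ, 0 < Ca ∧ ∀ z₀ ∈ P.initSet K₀, P.JumpsAtMost d 0 η K₀ z₀ S →
            (∃ (N : ℕ) (τ : ℕ → ℝ)
              (x : ℕ → ℝ → Matrix (Fin m) (Fin n) ℝ × Matrix (Fin m) (Fin n) ℝ),
              P.IsSolution d 0 η K₀ z₀ (Set.Ici 0) N τ x) ∧
            ∀ (J : Set ℝ) (N : ℕ) (τ : ℕ → ℝ)
              (x : ℕ → ℝ → Matrix (Fin m) (Fin n) ℝ × Matrix (Fin m) (Fin n) ℝ),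
              P.IsSolution d 0 η K₀ z₀ J N τ x →
              ∀ k ≤ N, ∀ t ∈ phase J N τ k,
                stackNorm (x k t - (Kopt, 0)) ≤
                  Ca * stackNorm (z₀ - (Kopt, 0)) *
                    Real.exp (-(ca * t / Real.sqrt (P.kappa Kopt))) := by
  have hlb : 0 < l / b := div_pos hl (ha.trans_le hab)
  -- The entry `a` serves the condition 2c < d, the entry l/b the condition 3dc < μ, and the 4 makes
  -- both strict.
  have hca : 0 < min a (l / b) / 4 := by positivity
  refine ⟨min a (l / b) / 4, hca, fun m n hm hn P K₀ Kopt _ hopt hL d hd₁ hd₂ S =>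
    -- The threshold is arbitrary: every positive `η` works, and only `Ca` depends on it.
    ⟨1, one_pos, fun η hη _ => ?_⟩⟩
  rcases le_or_gt (P.cost K₀) (P.cost Kopt) with h₀ | hlt
  · exact ⟨1, one_pos, fun z₀ hz hS => absurd hS (SLQR.not_jumpsAtMost hn hopt h₀ hz S)⟩
  have hμ := (SLQR.mu_pos_and_le hm hn hopt).1
  have hLpos := hl.trans_le hL
  have hκ : 0 < P.kappa Kopt := div_pos hLpos hμ
  set r := Real.sqrt (P.kappa Kopt) with hr
  have hr0 : 0 < r := Real.sqrt_pos.2 hκ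
  have hr2 : r ^ 2 = P.bigL Kopt / P.mu Kopt := Real.sq_sqrt hκ.le
  have hd : 0 < d := (div_pos ha hr0).trans_le hd₁
  have hcd : 2 * (min a (l / b) / 4 / r) < d := by
    refine lt_of_lt_of_le ?_ hd₁
    rw [← mul_div_assoc, div_lt_div_iff_of_pos_right hr0]
    linarith [min_le_left a (l / b)]
  -- Since d ≤ b/√κ, the left side is at most (3/4)l/κ, and l ≤ L = μκ.
  have hch : 3 * d * (min a (l / b) / 4 / r) < P.mu Kopt := by
    have hb := ha.trans_le hab
    have h1 : b * min a (l / b) ≤ l := by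
      have := mul_le_mul_of_nonneg_left (min_le_right a (l / b)) hb.le
      rwa [mul_div_cancel₀ _ hb.ne'] at this
    have h2 : P.bigL Kopt = P.mu Kopt * r ^ 2 := by rw [hr2, mul_div_cancel₀ _ hμ.ne']
    calc 3 * d * (min a (l / b) / 4 / r) ≤ 3 * (b / r) * (min a (l / b) / 4 / r) := by gcongr
      _ = 3 / 4 * (b * min a (l / b)) / r ^ 2 := by field_simp
      _ < P.mu Kopt := by
        rw [div_lt_iff₀ (by positivity), ← h2]
        linarith
  let _ := Matrix.frobeniusInnerProductSpace (m := m) (n := n)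
  have H := SLQR.landscape hm hn hopt hlt
  obtain ⟨A, hA, hdec⟩ := H.exists_hybrid_decay hd hη.le (by positivity) hcd hch S
  refine ⟨A, hA, fun z₀ hz hS => ?_⟩
  unfold SLQR.JumpsAtMost at hS
  unfold SLQR.IsSolution at hS ⊢
  rw [SLQR.flowMap_zero] at hS ⊢
  refine ⟨H.exists_isHybridSolution hz.1.1 hz.1.2 hS, fun J N τ x hx k hk t ht => ?_⟩
  have h1 := hdec z₀ J N τ x hz.1.1 hz.1.2 (hS J N τ x hx) hx k hk t ht
  have h2 : min a (l / b) / 4 / r * t = min a (l / b) / 4 * t / r := by ring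
  rw [h2] at h1
  exact h1
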